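/- **Setting.** Let $\mathbb{PT}$ be the total space of $\mathcal O(1)\oplus\mathcal O(1)\to\mathbb{CP}^1$, with coordinates $(z,v_1,v_2)$ over $\mathbb C=\mathbb{CP}^1\setminus\{\infty\}$. A point $x\in\mathbb R^4$ corresponds to the line $\mathbb{CP}^1_x\subset\mathbb{PT}$ given by $$v_1(z)=x_1+\mathrm i x_2+z(x_3-\mathrm i x_4),\qquad v_2(z)=x_3+\mathrm i x_4-z(x_1-\mathrm i x_2).$$ For $z,\lambda\in\mathbb C$ (independent) put $\langle q(z,\lambda),x\rangle=v_1(z)+\lambda v_2(z)$, where $q(z,\lambda)$ is a null vector. It has weight $-\tfrac12$ under each factor of the complexified rotations $SL_2\times SL_2$, which act by Möbius transformations of $z$ and of $\lambda$. Let $\ell_0,\ell_1$ and $\bar\ell_0,\bar\ell_1$ be the corresponding generators centred at $z_0$ and at $\lambda_0$, acting as complex linear vector fields on $\mathbb R^4$ and determined for all $z,\lambda$ by $\ell_k\langle q,x\rangle=(z-z_0)^{k+1}\partial_z\langle q,x\rangle-\tfrac{k+1}{2}(z-z_0)^k\langle q,x\rangle$, and likewise for $\bar\ell_k$ with $\lambda,\lambda_0$.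 *States of the 4d free scalar.* A conformal primary state of dimension $\Delta$ at $(z_0,\lambda_0)$ is a harmonic function $\phi:\mathbb R^4\to\mathbb C$ with $\ell_1\phi=\bar\ell_1\phi=0$, $(\ell_0+\bar\ell_0)\phi=\Delta\phi$ and $(\ell_0-\bar\ell_0)\phi=0$. The space $\mathcal P_\Delta(z_0)$ of conformal primary states of dimension $\Delta$ at $z=z_0$ is the linear span of those at $(z_0,\lambda)$, over all $\lambda\in\mathbb C$. *States on twistor space.* Consider distributional $(0,1)$-forms $\mathcal A$ on $\mathbb{PT}$ with values in $\mathcal O(-2)$ (trivialized by $\mathrm dz$), supported on the surface $z=z_0$ and satisfying $\bar\partial\mathcal A=0$, modulo the forms $\bar\partial\chi$ with $\chi$ a distributional section of $\mathcal O(-2)$ supported on $z=z_0$. The holomorphic vector fields $$L_k=-(z-z_0)^{k+1}\partial_z-\tfrac{k+1}{2}(z-z_0)^k\,(v_1\partial_{v_1}+v_2\partial_{v_2}),\qquad k\ge 0,$$ act by Lie derivative. Let $\mathcal T_h(z_0)$ be the space of classes $[\mathcal A]$ with $L_k[\mathcal A]=0$ for all $k>0$ and $L_0[\mathcal A]=h[\mathcal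 A]$: the conformal primary states on twistor space of dimension $h$ at $z=z_0$. **Proposition.** Let $n\le 0$ be an integer and $z_0\in\mathbb C$. 1. For every $\lambda\in\mathbb C$, the conformal primary states of dimension $n$ at $(z_0,\lambda)$ are exactly the complex multiples of the standard conformal primary wavefunction $\langle q(z_0,\lambda),x\rangle^{-n}=(v_1(z_0)+\lambda v_2(z_0))^{-n}$. 2. Integration along the twistor lines, $\phi(x)=\int_{\mathbb{CP}^1_x}\mathcal A$ (fibre integration of distributional forms along the projection $\mathbb{PT}\to\mathbb R^4$ whose fibres are the lines $\mathbb{CP}^1_x$), gives a well-defined linear bijection $\mathcal T_{n/2}(z_0)\to\mathcal P_n(z_0)$. 3. For every $\lambda\in\mathbb C$, the form $\mathrm dz\,\delta_{z=z_0}(v_1+\lambda v_2)^{-n}$ (with $\delta_{z=z_0}$ normalized by $\int\mathrm dz\,\delta_{z=z_0}=1$) represents an element of $\mathcal T_{n/2}(z_0)$, and this bijection maps it to the standard wavefunction $(v_1(z_0)+\lambda v_2(z_0))^{-n}$. -/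

import Mathlib

open scoped Distributions Topology ComplexConjugate

noncomputable section

namespace Twistor

/-! ### Space-time and the incidence relation -/

/-- Euclidean space-time `ℝ⁴`; the coordinates `x₁, …, x₄` are `x 0, …, x 3`. -/
abbrev Spacetime := EuclideanSpace ℝ (Fin 4)

/-- The affine chart of twistor space (the total space of `O(1) ⊕ O(1)` over `ℂP¹`) over
`ℂ = ℂP¹ ∖ {∞}`, with holomorphic coordinates `(z, v₁, v₂) = (p 0, p 1, p 2)`.
A surface `z = z₀` is closed in twistor space and lies in this chart. -/
abbrev Chart := Fin 3 → ℂ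

/-- The first fibre coordinate of the line `ℂP¹ₓ` at `z`. -/
def v₁ (z : ℂ) (x : Spacetime) : ℂ :=
  (x 0 + Complex.I * x 1) + z * (x 2 - Complex.I * x 3)

/-- The second fibre coordinate of the line `ℂP¹ₓ` at `z`. -/
def v₂ (z : ℂ) (x : Spacetime) : ℂ :=
  (x 2 + Complex.I * x 3) - z * (x 0 - Complex.I * x 1)

/-- `x₁ + i x₂` for the unique point `x ∈ ℝ⁴` whose line passes through the twistor `p`. -/
def alpha (p : Chart) : ℂ := (p 1 - p 0 * conj (p 2)) / (1 + (‖p 0‖ : ℂ) ^ 2)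

/-- `x₃ + i x₄` for the unique point `x ∈ ℝ⁴` whose line passes through the twistor `p`. -/
def beta (p : Chart) : ℂ := (p 2 + p 0 * conj (p 1)) / (1 + (‖p 0‖ : ℂ) ^ 2)

/-- The projection of twistor space to `ℝ⁴`, with fibres the lines `ℂP¹ₓ`. -/
def toSpacetime (p : Chart) : Spacetime :=
  !₂[(alpha p).re, (alpha p).im, (beta p).re, (beta p).im]

/-! ### Conformal primary states of the free scalar field on `ℝ⁴` -/

/-- The linear function `⟨q(z,l), x⟩ = v₁(z) + l v₂(z)` of `x`, for the null vector `q(z,l)`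
labelled by the point `(z,l)` of the complexified celestial sphere (`l` is the coordinate
usually called `z̄`). -/
def nullPairing (z l : ℂ) (x : Spacetime) : ℂ := v₁ z x + l * v₂ z x

/-- The standard conformal primary wavefunction `⟨q(z,l), x⟩ ^ (-Δ)` of dimension `Δ`. -/
def wavefunction (Δ : ℤ) (z l : ℂ) : Spacetime → ℂ := fun x => nullPairing z l x ^ (-Δ)

/-- Derivative of a function on `ℝ⁴` along a vector field with complex coefficients. -/
def vectorDeriv (W : Spacetime → Fin 4 → ℂ) (φ : Spacetime → ℂ) (x : Spacetime) : ℂ :=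
  ∑ j, W x j * fderiv ℝ φ x (EuclideanSpace.single j 1)

/-! The function `⟨q(z,l), x⟩` is affine in `z` and in `l`; we use its Taylor coefficients at
`(z₀,l₀)`, namely
`⟨q(z,l), x⟩ = c₀₀ + c₁₀ (z - z₀) + c₀₁ (l - l₀) + c₁₁ (z - z₀) (l - l₀)`,
as linear coordinates on complexified space-time. -/

/-- The coefficient of `1`. -/
def c₀₀ (z₀ l₀ : ℂ) (x : Spacetime) : ℂ := nullPairing z₀ l₀ x

/-- The coefficient of `z - z₀`. -/
def c₁₀ (_z₀ l₀ : ℂ) (x : Spacetime) : ℂ :=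
  (x 2 - Complex.I * x 3) - l₀ * (x 0 - Complex.I * x 1)

/-- The coefficient of `l - l₀`. -/
def c₀₁ (z₀ _l₀ : ℂ) (x : Spacetime) : ℂ := v₂ z₀ x

/-- The coefficient of `(z - z₀) (l - l₀)`. -/
def c₁₁ (_z₀ _l₀ : ℂ) (x : Spacetime) : ℂ := -(x 0 - Complex.I * x 1)

/-- The vector of `ℂ⁴` with prescribed coordinates `c₀₀, c₁₀, c₀₁, c₁₁`. -/
def fromCoeffs (z₀ l₀ a b c d : ℂ) : Fin 4 → ℂ :=
  let A := a - b * z₀ - c * l₀ + d * z₀ * l₀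
  let B := b - d * l₀
  let C := c - d * z₀
  ![(A - d) / 2, (A + d) / (2 * Complex.I), (B + C) / 2, (C - B) / (2 * Complex.I)]

/-! The complexified rotations `SL₂ × SL₂` of space-time act on the celestial sphere by Möbius
transformations of `z` and of `l`, and `⟨q(z,l), x⟩` has weight `-1/2` in `z` and in `l`. The
generator `ℓ_k` of the first factor (`k = 0, 1`) is the vector field on space-time with
`ℓ_k ⟨q(z,l), x⟩ = (z - z₀)^(k+1) ∂_z ⟨q(z,l), x⟩ - (k+1)/2 (z - z₀)^k ⟨q(z,l), x⟩`,
and similarly for the second factor with `l` in place of `z`. -/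

/-- The generator `ℓ₀` centred at `z₀`. -/
def ell₀ (z₀ l₀ : ℂ) (x : Spacetime) : Fin 4 → ℂ :=
  fromCoeffs z₀ l₀ (-c₀₀ z₀ l₀ x / 2) (c₁₀ z₀ l₀ x / 2) (-c₀₁ z₀ l₀ x / 2) (c₁₁ z₀ l₀ x / 2)

/-- The generator `ℓ₁` centred at `z₀`. -/
def ell₁ (z₀ l₀ : ℂ) (x : Spacetime) : Fin 4 → ℂ :=
  fromCoeffs z₀ l₀ 0 (-c₀₀ z₀ l₀ x) 0 (-c₀₁ z₀ l₀ x)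

/-- The generator `ℓ̄₀` centred at `l₀`. -/
def ellBar₀ (z₀ l₀ : ℂ) (x : Spacetime) : Fin 4 → ℂ :=
  fromCoeffs z₀ l₀ (-c₀₀ z₀ l₀ x / 2) (-c₁₀ z₀ l₀ x / 2) (c₀₁ z₀ l₀ x / 2) (c₁₁ z₀ l₀ x / 2)

/-- The generator `ℓ̄₁` centred at `l₀`. -/
def ellBar₁ (z₀ l₀ : ℂ) (x : Spacetime) : Fin 4 → ℂ :=
  fromCoeffs z₀ l₀ 0 0 (-c₀₀ z₀ l₀ x) (-c₁₀ z₀ l₀ x)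

/-- `φ` is a (spinless) conformal primary state of conformal dimension `Δ` at the point `(z₀,l₀)`
of the celestial sphere: a solution of the free field equation on `ℝ⁴`, annihilated by `ℓ₁` and
`ℓ̄₁`, whose weights under `ℓ₀` and `ℓ̄₀` have sum `Δ` and difference `0`. -/
structure IsConformalPrimary (Δ : ℤ) (z₀ l₀ : ℂ) (φ : Spacetime → ℂ) : Prop where
  harmonic : InnerProductSpace.HarmonicOnNhd φ Set.univ
  ell₁_eq : ∀ x, vectorDeriv (ell₁ z₀ l₀) φ x = 0
  ellBar₁_eq : ∀ x, vectorDeriv (ellBar₁ z₀ l₀) φ x = 0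
  dimension : ∀ x, vectorDeriv (ell₀ z₀ l₀) φ x + vectorDeriv (ellBar₀ z₀ l₀) φ x = Δ * φ x
  spin : ∀ x, vectorDeriv (ell₀ z₀ l₀) φ x - vectorDeriv (ellBar₀ z₀ l₀) φ x = 0

/-- The space of conformal primary states of dimension `Δ` at `z = z₀`: linear combinations of
conformal primary states at `(z₀,l)` for arbitrary `l`. -/
def spacetimePrimaries (Δ : ℤ) (z₀ : ℂ) : Submodule ℂ (Spacetime → ℂ) :=
  Submodule.span ℂ {φ | ∃ l : ℂ, IsConformalPrimary Δ z₀ l φ}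

/-! ### Distributions on the twistor chart -/

/-- Test functions on the twistor chart. -/
abbrev Test := 𝓓((⊤ : TopologicalSpace.Opens Chart), ℂ)

/-- Complex distributions on the twistor chart. A locally integrable function `f` is the
distribution `g ↦ ∫ f g`, for Lebesgue measure on `ℂ³ = ℝ⁶`. -/
abbrev Dist := Test →L[ℂ] ℂ

/-- Multiplication of test functions by a smooth function. -/
def mulTest (g : Chart → ℂ) (hg : ContDiff ℝ ((⊤ : ℕ∞) : WithTop ℕ∞) g) : Test →L[ℂ] Test :=
  TestFunction.limitCLM ℂ
    (fun f => ⟨fun p => f p * g p, f.contDiff.mul hg, f.hasCompactSupport.mul_right,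
      fun _ _ => trivial⟩)
    (fun K hK => TestFunction.ofSupportedInCLM ℂ hK ∘L
      ContDiffMapSupportedIn.bilinLeftCLM (ContinuousLinearMap.mul ℂ ℂ) hg)
    (fun K hK f => by ext p; simp [ContDiffMapSupportedIn.bilinLeftCLM_apply])

/-- Multiplication of distributions by a smooth function. -/
def mulDist (g : Chart → ℂ) (hg : ContDiff ℝ ((⊤ : ℕ∞) : WithTop ℕ∞) g) : Dist →ₗ[ℂ] Dist where
  toFun T := T ∘L mulTest g hg
  map_add' _ _ := rfl
  map_smul' _ _ := rfl

/-- The derivative of a distribution along a real direction `w`. -/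
def derivDist (w : Chart) : Dist →ₗ[ℂ] Dist where
  toFun T := -(T ∘L TestFunction.lineDerivCLM ℂ w)
  map_add' S T := by ext; simp; ring
  map_smul' c T := by ext; simp

/-- `∂/∂pₐ = (∂_{Re pₐ} - i ∂_{Im pₐ}) / 2`. -/
def del (a : Fin 3) : Dist →ₗ[ℂ] Dist :=
  (1 / 2 : ℂ) • (derivDist (Pi.single a 1) - Complex.I • derivDist (Pi.single a Complex.I))

/-- `∂/∂p̄ₐ = (∂_{Re pₐ} + i ∂_{Im pₐ}) / 2`. -/
def delBar (a : Fin 3) : Dist →ₗ[ℂ] Dist :=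
  (1 / 2 : ℂ) • (derivDist (Pi.single a 1) + Complex.I • derivDist (Pi.single a Complex.I))

/-- Distributions supported on the surface `z = z₀`. -/
def supportedOn (z₀ : ℂ) : Submodule ℂ Dist where
  carrier := {T | Distribution.IsVanishingOn T {p : Chart | p 0 ≠ z₀}}
  add_mem' hS hT f hf := by simp [hS f hf, hT f hf]
  zero_mem' _ _ := rfl
  smul_mem' c T hT f hf := by simp [hT f hf]

/-! ### The Dolbeault complex of `O(-2)` localized on a surface `z = z₀` -/

/-- Distributional `(0,1)`-forms with values in `O(-2)`, which is the pull-back of the canonical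
bundle of `ℂP¹` and is trivialized by `dz` in the chart: the family `A` stands for
`∑ₐ A a • dz ⊗ dp̄ₐ`. -/
abbrev Current := Fin 3 → Dist

/-- `χ dz ↦ ∂̄ (χ dz)`, up to the order of `dz` and `dp̄ₐ`. -/
def dbar : Dist →ₗ[ℂ] Current := LinearMap.pi delBar

/-- The solutions of the field equation `∂̄ A = 0` that are supported on `z = z₀`. -/
def localizedFields (z₀ : ℂ) : Submodule ℂ Current where
  carrier := {A | (∀ a b, delBar a (A b) = delBar b (A a)) ∧ ∀ a, A a ∈ supportedOn z₀}
  add_mem' hA hB := ⟨fun a b => by simp [hA.1 a b, hB.1 a b],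
    fun a => (supportedOn z₀).add_mem (hA.2 a) (hB.2 a)⟩
  zero_mem' := ⟨fun _ _ => by simp, fun _ => (supportedOn z₀).zero_mem⟩
  smul_mem' c _ hA := ⟨fun a b => by simp [hA.1 a b],
    fun a => (supportedOn z₀).smul_mem c (hA.2 a)⟩

/-- The gauge-trivial fields `∂̄ χ`, with `χ` supported on `z = z₀`. -/
def gaugeTrivial (z₀ : ℂ) : Submodule ℂ Current := (supportedOn z₀).map dbar

/-- The function `(z - z₀) ^ k` on the chart. -/
def zPow (z₀ : ℂ) (k : ℕ) : Chart → ℂ := fun p => (p 0 - z₀) ^ k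

lemma contDiff_zPow (z₀ : ℂ) (k : ℕ) :
    ContDiff ℝ ((⊤ : ℕ∞) : WithTop ℕ∞) (zPow z₀ k) := by
  unfold zPow
  fun_prop

lemma contDiff_coord (a : Fin 3) :
    ContDiff ℝ ((⊤ : ℕ∞) : WithTop ℕ∞) (fun p : Chart => p a) := by
  fun_prop

/-- The action of the holomorphic vector field
`L_k = -(z - z₀)^(k+1) ∂_z - (k+1)/2 (z - z₀)^k (v₁ ∂_{v₁} + v₂ ∂_{v₂})`
on the coefficient of `dz` in a section of `O(-2)`. The middle term is the Lie derivative of the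
frame `dz`. -/
def virasoroDist (z₀ : ℂ) (k : ℕ) : Dist →ₗ[ℂ] Dist :=
  -(mulDist (zPow z₀ (k + 1)) (contDiff_zPow z₀ (k + 1)) ∘ₗ del 0)
    - ((k : ℂ) + 1) • mulDist (zPow z₀ k) (contDiff_zPow z₀ k)
    - (((k : ℂ) + 1) / 2) • (mulDist (zPow z₀ k) (contDiff_zPow z₀ k) ∘ₗ
        (mulDist (fun p => p 1) (contDiff_coord 1) ∘ₗ del 1
          + mulDist (fun p => p 2) (contDiff_coord 2) ∘ₗ del 2))

/-- The action of `L_k` on `(0,1)`-forms with values in `O(-2)`. As `L_k` is a holomorphic vector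
field of type `(1,0)`, the Lie derivatives of the `dp̄ₐ` vanish. -/
def virasoro (z₀ : ℂ) (k : ℕ) : Current →ₗ[ℂ] Current :=
  LinearMap.pi fun a => virasoroDist z₀ k ∘ₗ LinearMap.proj a

/-- Fields localized on `z = z₀` whose gauge-equivalence class is a conformal primary of
dimension `h`: it is annihilated by `L_k` for all `k > 0`, and `L₀` acts on it as `h`. -/
def primaryFields (h z₀ : ℂ) : Submodule ℂ Current :=
  localizedFields z₀ ⊓
    (⨅ (k : ℕ) (_ : 0 < k), (gaugeTrivial z₀).comap (virasoro z₀ k)) ⊓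
    (gaugeTrivial z₀).comap (virasoro z₀ 0 - h • LinearMap.id)

/-- The space of conformal primary states on twistor space of dimension `h`, localized on
`z = z₀`: gauge-equivalence classes of primary fields. -/
def twistorPrimaries (h z₀ : ℂ) : Submodule ℂ (Current ⧸ gaugeTrivial z₀) :=
  (primaryFields h z₀).map (gaugeTrivial z₀).mkQ

/-- The gauge-equivalence class of a primary field. -/
def gaugeClass {h z₀ : ℂ} (A : primaryFields h z₀) : twistorPrimaries h z₀ :=
  ⟨(gaugeTrivial z₀).mkQ A, Submodule.mem_map_of_mem A.2⟩

/-! ### Delta-function states and integration over the twistor lines -/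

/-- The Dirac measure of the surface `z = z₀`, with `dz dz̄` normalized as Lebesgue measure. -/
def surfaceMeasure (z₀ : ℂ) : MeasureTheory.Measure Chart :=
  MeasureTheory.Measure.map (fun v : ℂ × ℂ => ![z₀, v.1, v.2]) MeasureTheory.volume

/-- The field `dz δ_{z=z₀} f`. Here `δ_{z=z₀}` is the `(0,1)`-form with `∫ dz δ_{z=z₀} = 1`, that
is, `i/2` times the Dirac distribution times `dz̄`, because `dz ∧ dz̄ = -2i d(Re z) d(Im z)`. -/
def deltaField (z₀ : ℂ) (f : Chart → ℂ) : Current :=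
  Pi.single 0 ((Complex.I / 2) • TestFunction.integralAgainstBilinCLM
    (ContinuousLinearMap.mul ℂ ℂ) (surfaceMeasure z₀) f)

/-- The twistor representative `dz δ_{z=z₀} (v₁ + l v₂) ^ (-Δ)`. -/
def twistorRep (Δ : ℤ) (z₀ l : ℂ) : Current :=
  deltaField z₀ fun p => (p 1 + l * p 2) ^ (-Δ)

/-- The components of `dp̄ₐ` along `dz̄` on the line `ℂP¹ₓ` through the twistor `p`. -/
def lineSlope (p : Chart) : Fin 3 → ℂ := ![1, beta p, -alpha p]

/-- `φ(x) = ∫_{ℂP¹ₓ} A` for all `x`, for a field `A` supported on `z = z₀`, as integration along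
the fibres of the projection to `ℝ⁴` in the sense of distributions. For a smooth field,
`∫_{ℂP¹ₓ} A = -2i ∫ (∑ₐ lineSlopeₐ A a) (z, v₁(z,x), v₂(z,x)) d(Re z) d(Im z)`. Pairing this with
a test function `ψ` and changing variables from `(z, x)` to `p = (z, v₁(z,x), v₂(z,x))`, with
Jacobian `(1 + |z|²)²`, gives the pairing of `A` below. The functions `Φ a` cut off the functions
`lineSlopeₐ ψ(x) / (1 + |z|²)²` away from the support of `A`. -/
def IsFibreIntegral (z₀ : ℂ) (A : Current) (φ : Spacetime → ℂ) : Prop :=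
  ∀ (ψ : 𝓓((⊤ : TopologicalSpace.Opens Spacetime), ℂ)) (Φ : Fin 3 → Test),
    (∀ a, ∀ᶠ p in 𝓝ˢ {p : Chart | p 0 = z₀},
      Φ a p = lineSlope p a * ψ (toSpacetime p) / (1 + (‖p 0‖ : ℂ) ^ 2) ^ 2) →
    -2 * Complex.I * ∑ a, A a (Φ a) = ∫ x, φ x * ψ x

end Twistor

end

open scoped Distributions Topology ComplexConjugate

noncomputable section

namespace Twistor

open MeasureTheory

/-! ### Complex directional derivatives on space-time -/

/-! Write `n = -m`. Both spaces of states are identified with `ℂ^(m+1)`, the coefficients of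
homogeneous polynomials of degree `m` in `(v₁, v₂)` at `z = z₀`, and integration over the twistor
lines is the identity in these coordinates.

Space-time side. In the linear coordinates `c₀₀, c₁₀, c₀₁, c₁₁` and their dual null frame, the
primary conditions are first-order equations and the Laplacian is `4 (∂₁₀∂₀₁ - ∂₀₀∂₁₁)`. Combining
them shows that `u = ∂₁₁φ` is homogeneous of degree `-(m+3)` along rays with `c₀₀ ≠ 0`
(`FrameEquations.euler`). As `u` is continuous at the origin, it vanishes there
(`FrameEquations.deriv₁₁_eq_zero`). The other equations then make `φ / c₀₀ ^ m` locally constant on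
a connected dense set, so `φ` is a multiple of `c₀₀ ^ m`. The powers `(v₁ + l v₂) ^ m`, with `l`
varying, span all homogeneous polynomials of degree `m` (`span_binomialCoeffs`).

Twistor side, gauge fixing. Let `X̄` be multiplication by the conjugate of `z - z₀`. Then `[∂̄₀, X̄]
= 1`, and on distributions supported on the surface `X̄` is locally nilpotent (`exists_order`).
Weyl-algebra arguments give each class a unique representative `dz ⊗ B dz̄` with `X̄ B = 0` and `B`
holomorphic along the fibre (`exists_normalForm`, `IsNormalForm.eq_zero_of_mem_gaugeTrivial`). The
operators `L_k` preserve such representatives, so conditions modulo gauge become equations for `B`.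
Those for `L₀` and `L₁` force `(z - z₀) B = 0` and fibre homogeneity of degree `m`
(`IsNormalForm.primary`).

Twistor side, classification. Such a `B` has a homogeneous polynomial density on the surface
(`IsPrimary.mem_polynomialDists`). Euler's identity reduces this to degree zero by induction. In
degree zero, pairing with translates of a test function is entire in the translation parameter, and
homogeneity bounds its growth by a power, so it is a polynomial: high fibre derivatives of `B`
vanish locally. Euler's identity brings this down to the first derivatives
(`IsHomogeneous.del_eq_zero`). A transverse distribution that is invariant under fibre translations
is a multiple of the surface delta (`IsTransverse.exists_smul_surfaceDelta`).

Integration. The density dual to integration over the lines is `∂̄`-divergence free, so gauge terms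
integrate to zero (`sum_dbar_apply_eq_zero`). On the surface the weight `(1 + |z₀|²)⁻²` cancels the
Jacobian of `x ↦ (v₁, v₂)`, and a polynomial density becomes the same polynomial on `ℝ⁴`
(`integral_lineDensity`). -/

/-- Derivative of `φ` along the constant complex vector `W`. -/
def cderiv (W : Fin 4 → ℂ) (φ : Spacetime → ℂ) (x : Spacetime) : ℂ :=
  ∑ j, W j * fderiv ℝ φ x (EuclideanSpace.single j 1)

/-- The linear form on space-time with complex coefficients `a`. -/
def linForm (a : Fin 4 → ℂ) : Spacetime →L[ℝ] ℂ :=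
  ∑ j, (a j) • (Complex.ofRealCLM.comp (EuclideanSpace.proj j : Spacetime →L[ℝ] ℝ))

lemma linForm_apply (a : Fin 4 → ℂ) (x : Spacetime) : linForm a x = ∑ j, a j * x j := by
  simp [linForm]

lemma linForm_single (a : Fin 4 → ℂ) (j : Fin 4) :
    linForm a (EuclideanSpace.single j 1) = a j := by
  simp [linForm_apply, PiLp.single_apply, apply_ite]

lemma cderiv_linForm (W a : Fin 4 → ℂ) (x : Spacetime) :
    cderiv W (linForm a) x = ∑ j, W j * a j := by
  simp [cderiv, linForm_single]

lemma vectorDeriv_eq_cderiv (W : Spacetime → Fin 4 → ℂ) (φ : Spacetime → ℂ) (x : Spacetime) :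
    vectorDeriv W φ x = cderiv (W x) φ x := rfl

lemma cderiv_mul {f g : Spacetime → ℂ} {x : Spacetime} (W : Fin 4 → ℂ)
    (hf : DifferentiableAt ℝ f x) (hg : DifferentiableAt ℝ g x) :
    cderiv W (fun y => f y * g y) x = cderiv W f x * g x + f x * cderiv W g x := by
  simp only [cderiv, Finset.sum_mul, Finset.mul_sum, ← Finset.sum_add_distrib]
  refine Finset.sum_congr rfl fun j _ => ?_
  rw [fderiv_fun_mul hf hg]
  simp
  ring

lemma cderiv_add {f g : Spacetime → ℂ} {x : Spacetime} (W : Fin 4 → ℂ)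
    (hf : DifferentiableAt ℝ f x) (hg : DifferentiableAt ℝ g x) :
    cderiv W (fun y => f y + g y) x = cderiv W f x + cderiv W g x := by
  simp only [cderiv, ← Finset.sum_add_distrib]
  refine Finset.sum_congr rfl fun j _ => ?_
  rw [fderiv_fun_add hf hg]
  simp
  ring

lemma cderiv_const_mul {f : Spacetime → ℂ} {x : Spacetime} (W : Fin 4 → ℂ) (c : ℂ)
    (hf : DifferentiableAt ℝ f x) :
    cderiv W (fun y => c * f y) x = c * cderiv W f x := by
  simp only [cderiv, Finset.mul_sum]
  refine Finset.sum_congr rfl fun j _ => ?_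
  rw [fderiv_const_mul hf]
  simp
  ring

lemma cderiv_zero (W : Fin 4 → ℂ) (x : Spacetime) : cderiv W (fun _ => 0) x = 0 := by
  simp [cderiv]

lemma differentiable_cderiv {φ : Spacetime → ℂ} (hφ : ContDiff ℝ 2 φ) (W : Fin 4 → ℂ) :
    Differentiable ℝ (cderiv W φ) := by
  have h : Differentiable ℝ (fderiv ℝ φ) :=
    (hφ.fderiv_right (m := 1) (by norm_num)).differentiable (by norm_num)
  unfold cderiv
  fun_prop

lemma cderiv_cderiv {φ : Spacetime → ℂ} (hφ : ContDiff ℝ 2 φ) (V W : Fin 4 → ℂ) (x : Spacetime) :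
    cderiv V (cderiv W φ) x = ∑ j, ∑ k, V j * W k *
      fderiv ℝ (fderiv ℝ φ) x (EuclideanSpace.single j 1) (EuclideanSpace.single k 1) := by
  have h : Differentiable ℝ (fderiv ℝ φ) :=
    (hφ.fderiv_right (m := 1) (by norm_num)).differentiable (by norm_num)
  have key : ∀ v, fderiv ℝ (cderiv W φ) x v = ∑ k, W k *
      fderiv ℝ (fderiv ℝ φ) x v (EuclideanSpace.single k 1) := by
    intro v
    have : HasFDerivAt (cderiv W φ) (∑ k, W k •
        ((ContinuousLinearMap.apply ℝ ℂ (EuclideanSpace.single k (1 : ℝ) : Spacetime)).comp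
          (fderiv ℝ (fderiv ℝ φ) x))) x := by
      unfold cderiv
      refine HasFDerivAt.fun_sum fun k _ => HasFDerivAt.const_mul ?_ _
      exact (ContinuousLinearMap.apply ℝ ℂ
        (EuclideanSpace.single k (1 : ℝ) : Spacetime)).hasFDerivAt.comp x (h x).hasFDerivAt
    rw [this.fderiv]
    simp
  rw [cderiv]
  simp only [key, Finset.mul_sum, mul_assoc]

lemma secondDeriv_symm {φ : Spacetime → ℂ} (hφ : ContDiff ℝ 2 φ) (x v w : Spacetime) :
    fderiv ℝ (fderiv ℝ φ) x v w = fderiv ℝ (fderiv ℝ φ) x w v :=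
  (hφ.contDiffAt.isSymmSndFDerivAt (by simp)).eq v w

lemma cderiv_comm {φ : Spacetime → ℂ} (hφ : ContDiff ℝ 2 φ) (V W : Fin 4 → ℂ) (x : Spacetime) :
    cderiv V (cderiv W φ) x = cderiv W (cderiv V φ) x := by
  rw [cderiv_cderiv hφ, cderiv_cderiv hφ, Finset.sum_comm]
  refine Finset.sum_congr rfl fun j _ => Finset.sum_congr rfl fun k _ => ?_
  rw [secondDeriv_symm hφ, mul_comm (V k)]

/-! ### The dual frame of the coordinates `c₀₀, c₁₀, c₀₁, c₁₁` -/

section Frame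

variable (z l : ℂ)

def coeff₀₀ : Fin 4 → ℂ := ![1 - l * z, Complex.I * (1 + l * z), z + l, Complex.I * (l - z)]
def coeff₁₀ : Fin 4 → ℂ := ![-l, Complex.I * l, 1, -Complex.I]
def coeff₀₁ : Fin 4 → ℂ := ![-z, Complex.I * z, 1, Complex.I]
def coeff₁₁ : Fin 4 → ℂ := ![-1, Complex.I, 0, 0]

lemma c₀₀_eq : c₀₀ z l = linForm (coeff₀₀ z l) := by
  ext x; simp [c₀₀, nullPairing, v₁, v₂, linForm_apply, coeff₀₀, Fin.sum_univ_four]; ring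
lemma c₁₀_eq : c₁₀ z l = linForm (coeff₁₀ l) := by
  ext x; simp [c₁₀, linForm_apply, coeff₁₀, Fin.sum_univ_four]; ring
lemma c₀₁_eq : c₀₁ z l = linForm (coeff₀₁ z) := by
  ext x; simp [c₀₁, v₂, linForm_apply, coeff₀₁, Fin.sum_univ_four]; ring
lemma c₁₁_eq : c₁₁ z l = linForm coeff₁₁ := by
  ext x; simp [c₁₁, linForm_apply, coeff₁₁, Fin.sum_univ_four]; ring

def frame₀₀ : Fin 4 → ℂ := ![1 / 2, -Complex.I / 2, 0, 0]
def frame₁₀ : Fin 4 → ℂ := ![-z / 2, Complex.I * z / 2, 1 / 2, Complex.I / 2]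
def frame₀₁ : Fin 4 → ℂ := ![-l / 2, Complex.I * l / 2, 1 / 2, -Complex.I / 2]
def frame₁₁ : Fin 4 → ℂ :=
  ![(z * l - 1) / 2, -Complex.I * (z * l + 1) / 2, -(z + l) / 2, -Complex.I * (l - z) / 2]

lemma div_two_mul_I (w : ℂ) : w / (2 * Complex.I) = -Complex.I * w / 2 := by
  field_simp
  ring_nf
  simp

lemma fromCoeffs_eq (a b c d : ℂ) (j : Fin 4) : fromCoeffs z l a b c d j =
    a * frame₀₀ j + b * frame₁₀ z j + c * frame₀₁ l j + d * frame₁₁ z l j := by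
  fin_cases j <;>
    simp [fromCoeffs, frame₀₀, frame₁₀, frame₀₁, frame₁₁, div_two_mul_I] <;> ring

lemma cderiv_fromCoeffs (a b c d : ℂ) (φ : Spacetime → ℂ) (x : Spacetime) :
    cderiv (fromCoeffs z l a b c d) φ x = a * cderiv frame₀₀ φ x + b * cderiv (frame₁₀ z) φ x
      + c * cderiv (frame₀₁ l) φ x + d * cderiv (frame₁₁ z l) φ x := by
  simp only [cderiv, fromCoeffs_eq, Finset.mul_sum, ← Finset.sum_add_distrib]
  exact Finset.sum_congr rfl fun j _ => by ring

lemma fromCoeffs_coords (v : Spacetime) :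
    fromCoeffs z l (c₀₀ z l v) (c₁₀ z l v) (c₀₁ z l v) (c₁₁ z l v) = fun j => (v j : ℂ) := by
  have hI : Complex.I * Complex.I = -1 := Complex.I_mul_I
  ext j
  fin_cases j <;>
    simp [fromCoeffs, c₀₀, c₁₀, c₀₁, c₁₁, nullPairing, v₁, v₂, div_two_mul_I] <;> ring_nf <;>
    simp only [Complex.I_sq] <;> ring

lemma fderiv_eq_frame (φ : Spacetime → ℂ) (x v : Spacetime) :
    fderiv ℝ φ x v = c₀₀ z l v * cderiv frame₀₀ φ x + c₁₀ z l v * cderiv (frame₁₀ z) φ x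
      + c₀₁ z l v * cderiv (frame₀₁ l) φ x + c₁₁ z l v * cderiv (frame₁₁ z l) φ x := by
  rw [← cderiv_fromCoeffs, fromCoeffs_coords, cderiv]
  conv_lhs => rw [← (EuclideanSpace.basisFun (Fin 4) ℝ).sum_repr v]
  simp

lemma cderiv_frame_c₀₀ (x : Spacetime) : cderiv frame₀₀ (c₀₀ z l) x = 1 ∧
    cderiv (frame₁₀ z) (c₀₀ z l) x = 0 ∧ cderiv (frame₀₁ l) (c₀₀ z l) x = 0 ∧
    cderiv (frame₁₁ z l) (c₀₀ z l) x = 0 := by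
  simp only [c₀₀_eq, cderiv_linForm]
  refine ⟨?_, ?_, ?_, ?_⟩ <;>
    simp [Fin.sum_univ_four, coeff₀₀, frame₀₀, frame₁₀, frame₀₁, frame₁₁] <;> ring_nf <;>
    simp only [Complex.I_sq] <;> ring

lemma cderiv_frame_c₁₀ (x : Spacetime) :
    cderiv (frame₁₀ z) (c₁₀ z l) x = 1 ∧ cderiv (frame₁₁ z l) (c₁₀ z l) x = 0 := by
  simp only [c₁₀_eq, cderiv_linForm]
  refine ⟨?_, ?_⟩ <;>
    simp [Fin.sum_univ_four, coeff₁₀, frame₁₀, frame₁₁] <;> ring_nf <;>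
    simp only [Complex.I_sq] <;> ring

lemma cderiv_frame_c₀₁ (x : Spacetime) : cderiv (frame₁₁ z l) (c₀₁ z l) x = 0 := by
  simp only [c₀₁_eq, cderiv_linForm]
  simp [Fin.sum_univ_four, coeff₀₁, frame₁₁]
  ring_nf
  simp only [Complex.I_sq]
  ring

lemma cderiv_frame_c₁₁ (x : Spacetime) : cderiv (frame₁₁ z l) (c₁₁ z l) x = 1 := by
  simp only [c₁₁_eq, cderiv_linForm]
  simp [Fin.sum_univ_four, coeff₁₁, frame₁₁]
  ring_nf
  simp only [Complex.I_sq]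
  ring

/-- The frame vectors are null for the complex bilinear extension of the Euclidean product. Only two
pairs have non-zero product: `1/2` for `frame₁₀, frame₀₁` and `-1/2` for `frame₀₀, frame₁₁`.
Inverting this Gram matrix gives the formula. -/
lemma laplacian_eq_frame {φ : Spacetime → ℂ} (hφ : ContDiff ℝ 2 φ) (x : Spacetime) :
    Laplacian.laplacian φ x = 4 * (cderiv (frame₁₀ z) (cderiv (frame₀₁ l) φ) x
      - cderiv frame₀₀ (cderiv (frame₁₁ z l) φ) x) := by
  have h := InnerProductSpace.laplacian_eq_iteratedFDeriv_orthonormalBasis φ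
    (EuclideanSpace.basisFun (Fin 4) ℝ)
  rw [h]
  simp only [iteratedFDeriv_two_apply, cderiv_cderiv hφ]
  simp only [Fin.sum_univ_four, frame₀₀, frame₁₀, frame₀₁, frame₁₁,
    EuclideanSpace.basisFun_apply]
  have s := secondDeriv_symm hφ x
  rw [s (EuclideanSpace.single 1 1) (EuclideanSpace.single 0 1),
    s (EuclideanSpace.single 2 1) (EuclideanSpace.single 0 1),
    s (EuclideanSpace.single 3 1) (EuclideanSpace.single 0 1),
    s (EuclideanSpace.single 2 1) (EuclideanSpace.single 1 1),
    s (EuclideanSpace.single 3 1) (EuclideanSpace.single 1 1),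
    s (EuclideanSpace.single 3 1) (EuclideanSpace.single 2 1)]
  simp
  ring_nf
  simp only [Complex.I_sq]
  ring

end Frame

/-! ### Conformal primary states are standard wavefunctions -/

lemma differentiable_linForm (a : Fin 4 → ℂ) : Differentiable ℝ (linForm a) :=
  (linForm a).differentiable

section Primary

variable {z l : ℂ} {m : ℕ} {φ : Spacetime → ℂ}

lemma contDiff_of_harmonicOnNhd_univ (h : InnerProductSpace.HarmonicOnNhd φ Set.univ) :
    ContDiff ℝ 2 φ := contDiffOn_univ.1 h.contDiffOn

lemma laplacian_of_harmonicOnNhd_univ (h : InnerProductSpace.HarmonicOnNhd φ Set.univ)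
    (x : Spacetime) : Laplacian.laplacian φ x = 0 := (h x trivial).2.self_of_nhds

/-- The equations of a conformal primary in the null frame. -/
structure FrameEquations (m : ℕ) (z l : ℂ) (φ : Spacetime → ℂ) : Prop where
  contDiff : ContDiff ℝ 2 φ
  wave : ∀ x, cderiv (frame₁₀ z) (cderiv (frame₀₁ l) φ) x
    = cderiv frame₀₀ (cderiv (frame₁₁ z l) φ) x
  eq₁₀ : ∀ x, c₀₀ z l x * cderiv (frame₁₀ z) φ x + c₀₁ z l x * cderiv (frame₁₁ z l) φ x = 0
  eq₀₁ : ∀ x, c₀₀ z l x * cderiv (frame₀₁ l) φ x + c₁₀ z l x * cderiv (frame₁₁ z l) φ x = 0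
  scaling : ∀ x, c₀₀ z l x * cderiv frame₀₀ φ x
    = c₁₁ z l x * cderiv (frame₁₁ z l) φ x + m * φ x
  spin : ∀ x, c₁₀ z l x * cderiv (frame₁₀ z) φ x = c₀₁ z l x * cderiv (frame₀₁ l) φ x

/-- In the dual frame `ℓ₀ + ℓ̄₀` is `-c₀₀ ∂₀₀ + c₁₁ ∂₁₁` and `ℓ₀ - ℓ̄₀` is `c₁₀ ∂₁₀ - c₀₁ ∂₀₁`, so
each condition becomes one line of algebra. -/
lemma isConformalPrimary_iff : IsConformalPrimary (-m) z l φ ↔ FrameEquations m z l φ := by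
  constructor
  · intro h
    have hc := contDiff_of_harmonicOnNhd_univ h.harmonic
    refine ⟨hc, fun x => ?_, fun x => ?_, fun x => ?_, fun x => ?_, fun x => ?_⟩
    · have := laplacian_eq_frame z l hc x
      rw [laplacian_of_harmonicOnNhd_univ h.harmonic] at this
      linear_combination -this / 4
    · have := h.ell₁_eq x
      rw [vectorDeriv_eq_cderiv, ell₁, cderiv_fromCoeffs] at this
      linear_combination -this
    · have := h.ellBar₁_eq x
      rw [vectorDeriv_eq_cderiv, ellBar₁, cderiv_fromCoeffs] at this
      linear_combination -this
    · have := h.dimension x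
      rw [vectorDeriv_eq_cderiv, vectorDeriv_eq_cderiv, ell₀, ellBar₀, cderiv_fromCoeffs,
        cderiv_fromCoeffs] at this
      push_cast at this
      linear_combination -this
    · have := h.spin x
      rw [vectorDeriv_eq_cderiv, vectorDeriv_eq_cderiv, ell₀, ellBar₀, cderiv_fromCoeffs,
        cderiv_fromCoeffs] at this
      linear_combination this
  · intro h
    refine ⟨fun x _ => ⟨h.contDiff.contDiffAt, Filter.Eventually.of_forall fun y => ?_⟩,
      fun x => ?_, fun x => ?_, fun x => ?_, fun x => ?_⟩
    · rw [laplacian_eq_frame z l h.contDiff, h.wave]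
      simp
    · rw [vectorDeriv_eq_cderiv, ell₁, cderiv_fromCoeffs]
      linear_combination -h.eq₁₀ x
    · rw [vectorDeriv_eq_cderiv, ellBar₁, cderiv_fromCoeffs]
      linear_combination -h.eq₀₁ x
    · rw [vectorDeriv_eq_cderiv, vectorDeriv_eq_cderiv, ell₀, ellBar₀, cderiv_fromCoeffs,
        cderiv_fromCoeffs]
      push_cast
      linear_combination -h.scaling x
    · rw [vectorDeriv_eq_cderiv, vectorDeriv_eq_cderiv, ell₀, ellBar₀, cderiv_fromCoeffs,
        cderiv_fromCoeffs]
      linear_combination h.spin x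

lemma differentiable_c₀₀ : Differentiable ℝ (c₀₀ z l) := c₀₀_eq z l ▸ differentiable_linForm _
lemma differentiable_c₁₀ : Differentiable ℝ (c₁₀ z l) := c₁₀_eq z l ▸ differentiable_linForm _
lemma differentiable_c₀₁ : Differentiable ℝ (c₀₁ z l) := c₀₁_eq z l ▸ differentiable_linForm _
lemma differentiable_c₁₁ : Differentiable ℝ (c₁₁ z l) := c₁₁_eq z l ▸ differentiable_linForm _

/-- The Euler operator acts on `∂φ/∂c₁₁` as `-(m + 3)` wherever `c₀₀` does not vanish. -/
lemma FrameEquations.euler (h : FrameEquations m z l φ) (x : Spacetime) :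
    c₀₀ z l x * fderiv ℝ (cderiv (frame₁₁ z l) φ) x x
      = -(m + 3) * c₀₀ z l x * cderiv (frame₁₁ z l) φ x := by
  have hφ := h.contDiff.differentiable (by norm_num)
  have hd := fun W y => differentiable_cderiv h.contDiff W y
  have d₀₀ : Differentiable ℝ (c₀₀ z l) := differentiable_c₀₀
  have d₁₀ : Differentiable ℝ (c₁₀ z l) := differentiable_c₁₀
  have d₀₁ : Differentiable ℝ (c₀₁ z l) := differentiable_c₀₁
  have d₁₁ : Differentiable ℝ (c₁₁ z l) := differentiable_c₁₁
  obtain ⟨f1, f2, f3, f4⟩ := cderiv_frame_c₀₀ z l x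
  obtain ⟨f5, f6⟩ := cderiv_frame_c₁₀ z l x
  have f7 := cderiv_frame_c₀₁ z l x
  have f8 := cderiv_frame_c₁₁ z l x
  -- Differentiating the first-order equations along `frame₁₁`, and one of them along `frame₁₀`,
  -- yields first-order equations for `u`. The mixed derivative `∂₁₀∂₀₁φ` that arises in `e3` is
  -- turned into `∂₀₀u` by the wave equation.
  have e1 : cderiv (frame₁₁ z l) (fun y => c₀₀ z l y * cderiv (frame₁₀ z) φ y
      + c₀₁ z l y * cderiv (frame₁₁ z l) φ y) x = 0 := by
    simp only [h.eq₁₀]; exact cderiv_zero _ _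
  have e2 : cderiv (frame₁₁ z l) (fun y => c₀₀ z l y * cderiv (frame₀₁ l) φ y
      + c₁₀ z l y * cderiv (frame₁₁ z l) φ y) x = 0 := by
    simp only [h.eq₀₁]; exact cderiv_zero _ _
  have e3 : cderiv (frame₁₀ z) (fun y => c₀₀ z l y * cderiv (frame₀₁ l) φ y
      + c₁₀ z l y * cderiv (frame₁₁ z l) φ y) x = 0 := by
    simp only [h.eq₀₁]; exact cderiv_zero _ _
  have e4 : cderiv (frame₁₁ z l) (fun y => c₀₀ z l y * cderiv frame₀₀ φ y) x =
      cderiv (frame₁₁ z l) (fun y => c₁₁ z l y * cderiv (frame₁₁ z l) φ y + m * φ y) x := by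
    simp only [h.scaling]
  rw [cderiv_add _ ((d₀₀ x).fun_mul (hd _ x)) ((d₀₁ x).fun_mul (hd _ x)),
    cderiv_mul _ (d₀₀ x) (hd _ x), cderiv_mul _ (d₀₁ x) (hd _ x), f4, f7,
    cderiv_comm h.contDiff] at e1
  rw [cderiv_add _ ((d₀₀ x).fun_mul (hd _ x)) ((d₁₀ x).fun_mul (hd _ x)),
    cderiv_mul _ (d₀₀ x) (hd _ x), cderiv_mul _ (d₁₀ x) (hd _ x), f4, f6,
    cderiv_comm h.contDiff] at e2
  rw [cderiv_add _ ((d₀₀ x).fun_mul (hd _ x)) ((d₁₀ x).fun_mul (hd _ x)),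
    cderiv_mul _ (d₀₀ x) (hd _ x), cderiv_mul _ (d₁₀ x) (hd _ x), f2, f5, h.wave] at e3
  rw [cderiv_add _ ((d₁₁ x).fun_mul (hd _ x)) ((hφ x).const_mul _),
    cderiv_mul _ (d₀₀ x) (hd _ x), cderiv_mul _ (d₁₁ x) (hd _ x),
    cderiv_const_mul _ _ (hφ x), f4, f8, cderiv_comm h.contDiff] at e4
  rw [fderiv_eq_frame z l]
  set u := cderiv (frame₁₁ z l) φ
  -- `2 e3 - e4` contains `c₁₀ ∂₁₀u` twice and `c₀₁ ∂₀₁u` not at all. After multiplication by `c₀₀`,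
  -- `e1` and `e2` trade one copy of the former for the latter, which completes the Euler operator.
  linear_combination 2 * c₀₀ z l x * e3 - c₀₀ z l x * e4 - c₁₀ z l x * e1 + c₀₁ z l x * e2

lemma c₀₀_smul (t : ℝ) (x : Spacetime) : c₀₀ z l (t • x) = t * c₀₀ z l x := by
  rw [c₀₀_eq, map_smul, Complex.real_smul]

lemma continuous_c₀₀ : Continuous (c₀₀ z l) := differentiable_c₀₀.continuous

/-- By the Euler relation `t ^ (m+3) u(t x)` is constant in `t`, and it is zero at `t = 0` because
`u` is defined at the origin. Regularity at the origin is what excludes other solutions. -/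
lemma FrameEquations.deriv₁₁_eq_zero (h : FrameEquations m z l φ) {x : Spacetime}
    (hx : c₀₀ z l x ≠ 0) : cderiv (frame₁₁ z l) φ x = 0 := by
  set u := cderiv (frame₁₁ z l) φ with hu
  have hud : Differentiable ℝ u := differentiable_cderiv h.contDiff _
  let g : ℝ → ℂ := fun t => (t : ℂ) ^ (m + 3) * u (t • x)
  have hg : ∀ t, HasDerivAt g (0 : ℂ) t := by
    intro t
    have h1 : HasDerivAt (fun t : ℝ => u (t • x)) (fderiv ℝ u (t • x) x) t := by
      have h0 : HasDerivAt (fun t : ℝ => t • x) x t := by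
        simpa using (hasDerivAt_id t).smul_const x
      exact (hud (t • x)).hasFDerivAt.comp_hasDerivAt t h0
    have h2 : HasDerivAt (fun t : ℝ => (t : ℂ) ^ (m + 3)) ((m + 3 : ℕ) * (t : ℂ) ^ (m + 2)) t := by
      simpa using (Complex.ofRealCLM.hasDerivAt (x := t)).fun_pow (m + 3)
    refine (h2.fun_mul h1).congr_deriv ?_
    rcases eq_or_ne t 0 with rfl | ht
    · simp
    · have e := h.euler (t • x)
      rw [map_smul, c₀₀_smul, Complex.real_smul, ← hu] at e
      have ht' : (t : ℂ) ≠ 0 := by exact_mod_cast ht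
      have e' : (t : ℂ) * fderiv ℝ u (t • x) x = -(m + 3) * u (t • x) := by
        apply mul_left_cancel₀ (mul_ne_zero ht' hx)
        linear_combination e
      push_cast
      linear_combination (t : ℂ) ^ (m + 2) * e'
  have hconst := is_const_of_deriv_eq_zero (𝕜 := ℝ) (f := g)
    (fun t => (hg t).differentiableAt) (fun t => (hg t).deriv) 1 0
  simpa [g] using hconst

/-! ### The open set where `c₀₀` does not vanish -/

lemma c₀₀_surjective : Function.Surjective (c₀₀ z l) := by
  intro w
  let N : ℝ := ∑ j, ‖coeff₀₀ z l j‖ ^ 2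
  have hN : (0 : ℝ) < N := by
    have h3 : 0 ≤ N := by positivity
    rcases h3.lt_or_eq with h | h
    · exact h
    · exfalso
      have h0 := (Finset.sum_eq_zero_iff_of_nonneg (fun j _ => by positivity)).1 h.symm
      have e0 := h0 0 (Finset.mem_univ _)
      have e1 := h0 1 (Finset.mem_univ _)
      simp [coeff₀₀] at e0 e1
      have : (2 : ℂ) = 0 := by linear_combination e0 + e1
      norm_num at this
  have hsq : ∑ j, coeff₀₀ z l j ^ 2 = 0 := by
    simp [Fin.sum_univ_four, coeff₀₀]
    ring_nf
    simp only [Complex.I_sq]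
    ring
  have hNC : (N : ℂ) = ∑ j, coeff₀₀ z l j * conj (coeff₀₀ z l j) := by
    simp [N, Complex.mul_conj, Complex.normSq_eq_norm_sq]
  -- For a null vector `q` with `N = ∑ |q_j|²`, taking `x_j = (2/N) Re (w q̄_j)` gives `⟨q, x⟩ = w +
  -- (w̄/N) ∑ q_j²`, and the last sum is zero.
  let x : Spacetime := WithLp.toLp 2 fun j => (2 / N) * (w * conj (coeff₀₀ z l j)).re
  refine ⟨x, ?_⟩
  rw [c₀₀_eq, linForm_apply]
  have hN0 : (N : ℂ) ≠ 0 := by exact_mod_cast hN.ne'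
  have : ∀ j, coeff₀₀ z l j * (x j : ℂ) = w / N * (coeff₀₀ z l j * conj (coeff₀₀ z l j))
      + conj w / N * coeff₀₀ z l j ^ 2 := by
    intro j
    simp only [x]
    push_cast
    rw [Complex.re_eq_add_conj]
    simp only [map_mul, Complex.conj_conj]
    ring
  simp only [this]
  rw [Finset.sum_add_distrib, ← Finset.mul_sum, ← Finset.mul_sum, hsq, ← hNC]
  field_simp
  simp

/-- The zero set is the kernel of a real-linear surjection onto `ℂ`. It has real codimension two, so
it does not disconnect `ℝ⁴`. -/
lemma isPreconnected_c₀₀_ne_zero : IsPreconnected {x | c₀₀ z l x ≠ 0} := by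
  let L : Spacetime →ₗ[ℝ] ℂ := (linForm (coeff₀₀ z l)).toLinearMap
  have hL : ∀ x, L x = c₀₀ z l x := fun x => by rw [c₀₀_eq]; rfl
  have hsurj : LinearMap.range L = ⊤ := LinearMap.range_eq_top.2 fun w => by
    obtain ⟨x, hx⟩ := c₀₀_surjective (z := z) (l := l) w
    exact ⟨x, by rw [hL, hx]⟩
  have hr : 1 < Module.rank ℝ (Spacetime ⧸ LinearMap.ker L) := by
    rw [LinearEquiv.rank_eq (L.quotKerEquivOfSurjective (LinearMap.range_eq_top.1 hsurj)),
      Complex.rank_real_complex]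
    norm_num
  have := (isPathConnected_compl_of_one_lt_codim hr).isConnected.isPreconnected
  convert this using 1
  ext x
  simp [hL]

lemma dense_c₀₀_ne_zero : Dense {x | c₀₀ z l x ≠ 0} := by
  obtain ⟨k, hk⟩ := c₀₀_surjective (z := z) (l := l) 1
  intro x
  by_cases hx : c₀₀ z l x = 0
  · have hlim : Filter.Tendsto (fun t : ℝ => x + t • k) (𝓝[≠] 0) (𝓝 x) := by
      have : Continuous fun t : ℝ => x + t • k := by fun_prop
      simpa using (this.tendsto 0).mono_left nhdsWithin_le_nhds
    refine mem_closure_of_tendsto hlim ?_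
    filter_upwards [self_mem_nhdsWithin] with t ht
    have : c₀₀ z l (x + t • k) = t := by
      rw [c₀₀_eq, map_add, map_smul, ← c₀₀_eq, hx, hk]; simp
    simpa [this] using ht
  · exact subset_closure hx

/-- Where `c₀₀ ≠ 0`, vanishing of `∂₁₁φ` forces `∂₁₀φ = ∂₀₁φ = 0` and `c₀₀ ∂₀₀φ = m φ`, so the
quotient by `c₀₀ ^ m` has zero derivative. Density and continuity extend the result to all of `ℝ⁴`.
-/
lemma FrameEquations.eq_const_mul_pow (h : FrameEquations m z l φ) :
    ∃ c : ℂ, ∀ x, φ x = c * c₀₀ z l x ^ m := by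
  have hφ := h.contDiff.differentiable (by norm_num)
  let s : Set Spacetime := {x | c₀₀ z l x ≠ 0}
  have hs : IsOpen s := isOpen_ne_fun continuous_c₀₀ continuous_const
  let Q : Spacetime → ℂ := fun x => φ x * (c₀₀ z l x ^ m)⁻¹
  have hQd : DifferentiableOn ℝ Q s := fun x hx =>
    ((hφ x).fun_mul (((differentiable_c₀₀ x).fun_pow m).fun_inv
      (pow_ne_zero _ hx))).differentiableWithinAt
  have hfd : ∀ x ∈ s, fderiv ℝ Q x = 0 := by
    intro x hx
    ext v
    have h11 := h.deriv₁₁_eq_zero hx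
    have h10 := h.eq₁₀ x
    have h01 := h.eq₀₁ x
    have h00 := h.scaling x
    simp only [h11, mul_zero, add_zero, zero_add] at h10 h01 h00
    have h10' := (mul_eq_zero.1 h10).resolve_left hx
    have h01' := (mul_eq_zero.1 h01).resolve_left hx
    have hv := fderiv_eq_frame z l φ x v
    rw [h11, h10', h01'] at hv
    have hc : HasFDerivAt (c₀₀ z l) (linForm (coeff₀₀ z l)) x := by
      rw [c₀₀_eq]; exact (linForm _).hasFDerivAt
    have hder : fderiv ℝ φ x v * c₀₀ z l x = m * φ x * c₀₀ z l v := by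
      rw [hv]; linear_combination c₀₀ z l v * h00
    have hinv : HasFDerivAt (fun x => (c₀₀ z l x ^ m)⁻¹)
        (-((c₀₀ z l x ^ m) ^ 2)⁻¹ • ((m * c₀₀ z l x ^ (m - 1)) • linForm (coeff₀₀ z l))) x := by
      refine (((hasDerivAt_pow m (c₀₀ z l x)).fun_inv (pow_ne_zero m hx)).comp_hasFDerivAt x
        hc).congr_fderiv ?_
      rw [smul_smul]
      congr 1
      ring
    have hQ := (hφ x).hasFDerivAt.fun_mul hinv
    have hfun : Q = fun x => φ x * (c₀₀ z l x ^ m)⁻¹ := rfl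
    rw [hfun, hQ.fderiv]
    simp only [add_apply, smul_apply, smul_eq_mul,
      zero_apply]
    rw [← c₀₀_eq]
    rcases Nat.eq_zero_or_pos m with rfl | hm
    · simp at hder
      simp [hder.resolve_right hx]
    · obtain ⟨k, rfl⟩ : ∃ k, m = k + 1 := ⟨m - 1, by omega⟩
      have hx' : c₀₀ z l x ≠ 0 := hx
      simp only [Nat.add_sub_cancel]
      field_simp
      linear_combination c₀₀ z l x ^ k * hder
  obtain ⟨c, hc⟩ := hs.exists_is_const_of_fderiv_eq_zero isPreconnected_c₀₀_ne_zero hQd hfd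
  refine ⟨c, fun x => ?_⟩
  have hcont : Continuous fun x => c * c₀₀ z l x ^ m :=
    continuous_const.mul (continuous_c₀₀.pow m)
  have hEq : Set.EqOn φ (fun x => c * c₀₀ z l x ^ m) s := fun y hy => by
    have hy' : c₀₀ z l y ≠ 0 := hy
    simp only [← hc y hy, Q]
    field_simp
  exact congrFun (Continuous.ext_on dense_c₀₀_ne_zero hφ.continuous hcont hEq) x

lemma cderiv_const_mul_c₀₀_pow (c : ℂ) (W : Fin 4 → ℂ) (k : ℕ) (x : Spacetime) :
    cderiv W (fun x => c * c₀₀ z l x ^ k) x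
      = c * (k * c₀₀ z l x ^ (k - 1) * cderiv W (c₀₀ z l) x) := by
  rw [cderiv_const_mul _ _ ((differentiable_c₀₀ x).fun_pow k)]
  simp only [cderiv, Finset.mul_sum]
  refine Finset.sum_congr rfl fun j _ => ?_
  rw [fderiv_fun_pow _ (differentiable_c₀₀ x)]
  simp only [smul_apply, nsmul_eq_mul, smul_eq_mul]
  ring

lemma contDiff_c₀₀ {k : WithTop ℕ∞} : ContDiff ℝ k (c₀₀ z l) := c₀₀_eq z l ▸ (linForm _).contDiff

lemma frameEquations_const_mul_pow (c : ℂ) :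
    FrameEquations m z l (fun x => c * c₀₀ z l x ^ m) := by
  have f := fun x => cderiv_frame_c₀₀ z l x
  have g10 : cderiv (frame₁₀ z) (fun x => c * c₀₀ z l x ^ m) = fun _ => 0 := by
    ext x; rw [cderiv_const_mul_c₀₀_pow, (f x).2.1]; simp
  have g01 : cderiv (frame₀₁ l) (fun x => c * c₀₀ z l x ^ m) = fun _ => 0 := by
    ext x; rw [cderiv_const_mul_c₀₀_pow, (f x).2.2.1]; simp
  have g11 : cderiv (frame₁₁ z l) (fun x => c * c₀₀ z l x ^ m) = fun _ => 0 := by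
    ext x; rw [cderiv_const_mul_c₀₀_pow, (f x).2.2.2]; simp
  refine ⟨contDiff_const.mul (contDiff_c₀₀.pow m), fun x => ?_, fun x => ?_, fun x => ?_,
    fun x => ?_, fun x => ?_⟩
  · rw [g01, g11, cderiv_zero, cderiv_zero]
  · rw [g10, g11]; simp
  · rw [g01, g11]; simp
  · rw [g11, cderiv_const_mul_c₀₀_pow, (f x).1]
    rcases Nat.eq_zero_or_pos m with rfl | hm
    · simp
    · obtain ⟨k, rfl⟩ : ∃ k, m = k + 1 := ⟨m - 1, by omega⟩
      simp only [Nat.add_sub_cancel]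
      ring
  · rw [g01, g10]; simp

lemma wavefunction_neg_natCast (m : ℕ) (z l : ℂ) (x : Spacetime) :
    wavefunction (-m) z l x = c₀₀ z l x ^ m := by
  simp [wavefunction, c₀₀]

theorem isConformalPrimary_iff_exists_smul : IsConformalPrimary (-m) z l φ ↔
    ∃ c : ℂ, φ = c • wavefunction (-m) z l := by
  rw [isConformalPrimary_iff]
  constructor
  · intro h
    obtain ⟨c, hc⟩ := h.eq_const_mul_pow
    exact ⟨c, by ext x; rw [hc, Pi.smul_apply, wavefunction_neg_natCast, smul_eq_mul]⟩
  · rintro ⟨c, rfl⟩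
    have := frameEquations_const_mul_pow (m := m) (z := z) (l := l) c
    convert this using 1
    ext x
    rw [Pi.smul_apply, wavefunction_neg_natCast, smul_eq_mul]

end Primary

/-! ### Test functions and operations on distributions -/

/-- Smooth functions with compact support. -/
structure IsTest (f : Chart → ℂ) : Prop where
  contDiff : ContDiff ℝ ((⊤ : ℕ∞) : WithTop ℕ∞) f
  compact : HasCompactSupport f

open scoped Classical in
/-- The test function with underlying function `f`, or zero if `f` is not one. -/
def toTest (f : Chart → ℂ) : Test :=
  if h : IsTest f then ⟨f, h.contDiff, h.compact, fun _ _ => trivial⟩ else 0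

lemma coe_toTest {f : Chart → ℂ} (h : IsTest f) : ⇑(toTest f) = f := by
  rw [toTest, dif_pos h]
  rfl

lemma isTest_coe (f : Test) : IsTest f := ⟨f.contDiff, f.hasCompactSupport⟩

lemma toTest_coe (f : Test) : toTest f = f := by
  ext p; rw [coe_toTest (isTest_coe f)]

lemma IsTest.add {f g : Chart → ℂ} (hf : IsTest f) (hg : IsTest g) : IsTest (fun p => f p + g p) :=
  ⟨hf.contDiff.add hg.contDiff, hf.compact.add hg.compact⟩

lemma IsTest.sub {f g : Chart → ℂ} (hf : IsTest f) (hg : IsTest g) : IsTest (fun p => f p - g p) :=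
  ⟨hf.contDiff.sub hg.contDiff, hf.compact.sub hg.compact⟩

lemma IsTest.mul_left {f g : Chart → ℂ} (hf : ContDiff ℝ ((⊤ : ℕ∞) : WithTop ℕ∞) f)
    (hg : IsTest g) : IsTest (fun p => f p * g p) :=
  ⟨hf.mul hg.contDiff, hg.compact.mul_left⟩

lemma IsTest.fderiv {f : Chart → ℂ} (hf : IsTest f) (w : Chart) :
    IsTest (fun p => _root_.fderiv ℝ f p w) :=
  ⟨(hf.contDiff.fderiv_right (m := ((⊤ : ℕ∞) : WithTop ℕ∞)) (by simp)).clm_apply contDiff_const,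
    hf.compact.fderiv_apply ℝ w⟩

lemma toTest_add {f g : Chart → ℂ} (hf : IsTest f) (hg : IsTest g) :
    toTest (fun p => f p + g p) = toTest f + toTest g := by
  ext p; simp [coe_toTest hf, coe_toTest hg, coe_toTest (hf.add hg)]

lemma toTest_sub {f g : Chart → ℂ} (hf : IsTest f) (hg : IsTest g) :
    toTest (fun p => f p - g p) = toTest f - toTest g := by
  ext p; simp [coe_toTest hf, coe_toTest hg, coe_toTest (hf.sub hg)]

lemma toTest_const_mul {f : Chart → ℂ} (c : ℂ) (hf : IsTest f) :
    toTest (fun p => c * f p) = c • toTest f := by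
  ext p; simp [coe_toTest hf, coe_toTest (IsTest.mul_left (f := fun _ => c) contDiff_const hf)]

@[simp] lemma mulTest_apply (g : Chart → ℂ) (hg : ContDiff ℝ ((⊤ : ℕ∞) : WithTop ℕ∞) g) (f : Test)
    (p : Chart) : mulTest g hg f p = f p * g p := rfl

lemma mulTest_eq_toTest (g : Chart → ℂ) (hg : ContDiff ℝ ((⊤ : ℕ∞) : WithTop ℕ∞) g) (f : Test) :
    mulTest g hg f = toTest (fun p => g p * f p) := by
  ext p; rw [coe_toTest (IsTest.mul_left hg (isTest_coe f)), mulTest_apply, mul_comm]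

lemma mulDist_apply (g : Chart → ℂ) (hg : ContDiff ℝ ((⊤ : ℕ∞) : WithTop ℕ∞) g) (T : Dist)
    (f : Test) : mulDist g hg T f = T (mulTest g hg f) := rfl

lemma lineDeriv_apply (w : Chart) (f : Test) (p : Chart) :
    (TestFunction.lineDerivCLM ℂ w f : Test) p = fderiv ℝ f p w := by
  rw [TestFunction.lineDerivCLM_eq_fderivCLM, TestFunction.fderivCLM_apply_of_le _ (by simp)]

lemma lineDeriv_eq_toTest (w : Chart) (f : Test) :
    (TestFunction.lineDerivCLM ℂ w f : Test) = toTest (fun p => fderiv ℝ f p w) := by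
  ext p; rw [coe_toTest ((isTest_coe f).fderiv w), lineDeriv_apply]

lemma derivDist_apply (w : Chart) (T : Dist) (f : Test) :
    derivDist w T f = -T (TestFunction.lineDerivCLM ℂ w f) := rfl

lemma derivDist_toTest (w : Chart) (T : Dist) {f : Chart → ℂ} (hf : IsTest f) :
    derivDist w T (toTest f) = -T (toTest (fun p => fderiv ℝ f p w)) := by
  rw [derivDist_apply, lineDeriv_eq_toTest, coe_toTest hf]

lemma mulDist_toTest (g : Chart → ℂ) (hg : ContDiff ℝ ((⊤ : ℕ∞) : WithTop ℕ∞) g) (T : Dist)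
    {f : Chart → ℂ} (hf : IsTest f) :
    mulDist g hg T (toTest f) = T (toTest (fun p => g p * f p)) := by
  rw [mulDist_apply, mulTest_eq_toTest, coe_toTest hf]

lemma differentiable_test (f : Test) : Differentiable ℝ f :=
  f.contDiff.differentiable (by simp)

lemma tsupport_mulTest_subset (g : Chart → ℂ) (hg : ContDiff ℝ ((⊤ : ℕ∞) : WithTop ℕ∞) g)
    (f : Test) : tsupport (mulTest g hg f) ⊆ tsupport f := tsupport_mul_subset_left

lemma tsupport_lineDeriv_subset (w : Chart) (f : Test) :
    tsupport (TestFunction.lineDerivCLM ℂ w f : Test) ⊆ tsupport f := by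
  have : ⇑(TestFunction.lineDerivCLM ℂ w f : Test) = fun p => fderiv ℝ f p w :=
    funext (lineDeriv_apply w f)
  rw [this]
  exact tsupport_fderiv_apply_subset ℝ w

/-- The distributions that vanish on `s`. -/
def vanishing (s : Set Chart) : Submodule ℂ Dist where
  carrier := {T | Distribution.IsVanishingOn T s}
  add_mem' hS hT f hf := by simp [hS f hf, hT f hf]
  zero_mem' _ _ := rfl
  smul_mem' c T hT f hf := by simp [hT f hf]

lemma mulDist_mem_vanishing {s : Set Chart} {T : Dist} (hT : T ∈ vanishing s) (g : Chart → ℂ)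
    (hg : ContDiff ℝ ((⊤ : ℕ∞) : WithTop ℕ∞) g) : mulDist g hg T ∈ vanishing s :=
  fun f hf => hT _ ((tsupport_mulTest_subset g hg f).trans hf)

lemma derivDist_mem_vanishing {s : Set Chart} {T : Dist} (hT : T ∈ vanishing s) (w : Chart) :
    derivDist w T ∈ vanishing s := fun f hf => by
  rw [derivDist_apply, hT _ ((tsupport_lineDeriv_subset w f).trans hf), neg_zero]

lemma del_mem_vanishing {s : Set Chart} {T : Dist} (hT : T ∈ vanishing s) (a : Fin 3) :
    del a T ∈ vanishing s :=
  Submodule.smul_mem _ _ (Submodule.sub_mem _ (derivDist_mem_vanishing hT _)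
    (Submodule.smul_mem _ _ (derivDist_mem_vanishing hT _)))

lemma delBar_mem_vanishing {s : Set Chart} {T : Dist} (hT : T ∈ vanishing s) (a : Fin 3) :
    delBar a T ∈ vanishing s :=
  Submodule.smul_mem _ _ (Submodule.add_mem _ (derivDist_mem_vanishing hT _)
    (Submodule.smul_mem _ _ (derivDist_mem_vanishing hT _)))

/-- This reduces global identities to compact sets, where distributions have finite order. -/
lemma eq_zero_of_forall_vanishing {T : Dist}
    (h : ∀ K : Set Chart, IsCompact K → T ∈ vanishing K) : T = 0 := by
  ext f
  exact h _ f.hasCompactSupport f subset_rfl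

/-! ### Commutation relations -/

/-- The Leibniz rule, for factors with constant derivative along `w`. Coordinates, their real and
imaginary parts and their conjugates are the only factors that need it. -/
lemma derivDist_mulDist {g : Chart → ℂ} {hg : ContDiff ℝ ((⊤ : ℕ∞) : WithTop ℕ∞) g} {w : Chart}
    {c : ℂ} (hc : ∀ p, fderiv ℝ g p w = c) (T : Dist) :
    derivDist w (mulDist g hg T) = mulDist g hg (derivDist w T) + c • T := by
  ext f
  have : (TestFunction.lineDerivCLM ℂ w (mulTest g hg f) : Test)
      = mulTest g hg (TestFunction.lineDerivCLM ℂ w f) + c • f := by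
    ext p
    have hfun : ⇑(mulTest g hg f) = fun p => f p * g p := rfl
    rw [lineDeriv_apply, hfun, fderiv_fun_mul (differentiable_test f p)
      (hg.differentiable (by simp) p)]
    simp [lineDeriv_apply, -TestFunction.lineDerivCLM_apply, hc]
    ring
  simp only [derivDist_apply, mulDist_apply, add_apply, smul_apply, smul_eq_mul, this, map_add,
    map_smul]
  ring

lemma derivDist_comm (v w : Chart) (T : Dist) :
    derivDist v (derivDist w T) = derivDist w (derivDist v T) := by
  ext f
  simp only [derivDist_apply, neg_neg]
  congr 1
  ext p
  have hf2 : ContDiff ℝ 2 f := f.contDiff.of_le (by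
    rw [← WithTop.coe_ofNat]; exact WithTop.coe_le_coe.2 le_top)
  have hd : Differentiable ℝ (fderiv ℝ f) :=
    (hf2.fderiv_right (m := 1) (by norm_num)).differentiable (by norm_num)
  have key : ∀ v w : Chart, fderiv ℝ (fun p => fderiv ℝ f p w) p v
      = fderiv ℝ (fderiv ℝ f) p v w := by
    intro v w
    rw [fderiv_clm_apply (hd p) (differentiableAt_const _)]
    simp
  have hfun : ∀ w, ⇑(TestFunction.lineDerivCLM ℂ w f : Test) = fun p => fderiv ℝ f p w :=
    fun w => funext (lineDeriv_apply w f)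
  rw [lineDeriv_apply, lineDeriv_apply, hfun, hfun, key, key]
  exact (hf2.contDiffAt.isSymmSndFDerivAt (by simp)).eq _ _

lemma mulDist_comm {g h : Chart → ℂ} {hg : ContDiff ℝ ((⊤ : ℕ∞) : WithTop ℕ∞) g}
    {hh : ContDiff ℝ ((⊤ : ℕ∞) : WithTop ℕ∞) h} (T : Dist) :
    mulDist g hg (mulDist h hh T) = mulDist h hh (mulDist g hg T) := by
  ext f
  simp only [mulDist_apply]
  congr 1
  ext p
  simp
  ring

lemma del_apply (a : Fin 3) (T : Dist) : del a T = (1 / 2 : ℂ) •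
    (derivDist (Pi.single a 1) T - Complex.I • derivDist (Pi.single a Complex.I) T) := rfl

lemma delBar_apply (a : Fin 3) (T : Dist) : delBar a T = (1 / 2 : ℂ) •
    (derivDist (Pi.single a 1) T + Complex.I • derivDist (Pi.single a Complex.I) T) := rfl

lemma del_mulDist {g : Chart → ℂ} {hg : ContDiff ℝ ((⊤ : ℕ∞) : WithTop ℕ∞) g} {a : Fin 3} {c d : ℂ}
    (hc : ∀ p, fderiv ℝ g p (Pi.single a 1) = c)
    (hd : ∀ p, fderiv ℝ g p (Pi.single a Complex.I) = d) (T : Dist) :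
    del a (mulDist g hg T) = mulDist g hg (del a T) + ((c - Complex.I * d) / 2) • T := by
  rw [del_apply, del_apply, derivDist_mulDist hc, derivDist_mulDist hd]
  simp only [map_smul, map_sub]
  module

lemma delBar_mulDist {g : Chart → ℂ} {hg : ContDiff ℝ ((⊤ : ℕ∞) : WithTop ℕ∞) g} {a : Fin 3}
    {c d : ℂ} (hc : ∀ p, fderiv ℝ g p (Pi.single a 1) = c)
    (hd : ∀ p, fderiv ℝ g p (Pi.single a Complex.I) = d) (T : Dist) :
    delBar a (mulDist g hg T) = mulDist g hg (delBar a T) + ((c + Complex.I * d) / 2) • T := by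
  rw [delBar_apply, delBar_apply, derivDist_mulDist hc, derivDist_mulDist hd]
  simp only [map_smul, map_add]
  module

lemma del_delBar_comm (a b : Fin 3) (T : Dist) : del a (delBar b T) = delBar b (del a T) := by
  simp only [del_apply, delBar_apply, map_smul, map_add, map_sub]
  simp only [derivDist_comm (Pi.single b _)]
  module

lemma delBar_comm (a b : Fin 3) (T : Dist) : delBar a (delBar b T) = delBar b (delBar a T) := by
  simp only [delBar_apply, map_smul, map_add]
  rw [derivDist_comm (Pi.single b 1) (Pi.single a 1), derivDist_comm (Pi.single b 1),
    derivDist_comm (Pi.single b Complex.I) (Pi.single a 1), derivDist_comm (Pi.single b Complex.I)]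
  module

lemma del_comm (a b : Fin 3) (T : Dist) : del a (del b T) = del b (del a T) := by
  simp only [del_apply, map_smul, map_sub]
  rw [derivDist_comm (Pi.single b 1) (Pi.single a 1), derivDist_comm (Pi.single b 1),
    derivDist_comm (Pi.single b Complex.I) (Pi.single a 1), derivDist_comm (Pi.single b Complex.I)]
  module

/-- Multiplication by the coordinate `p a`. -/
def mulCoord (a : Fin 3) : Dist →ₗ[ℂ] Dist := mulDist (fun p => p a) (contDiff_coord a)

lemma contDiff_normal (z₀ : ℂ) :
    ContDiff ℝ ((⊤ : ℕ∞) : WithTop ℕ∞) (fun p : Chart => p 0 - z₀) := by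
  fun_prop

lemma contDiff_conj : ContDiff ℝ ((⊤ : ℕ∞) : WithTop ℕ∞) (fun z : ℂ => conj z) :=
  Complex.conjCLE.contDiff

lemma contDiff_normalBar (z₀ : ℂ) :
    ContDiff ℝ ((⊤ : ℕ∞) : WithTop ℕ∞) (fun p : Chart => conj (p 0 - z₀)) :=
  contDiff_conj.comp (contDiff_normal z₀)

/-- Multiplication by `p 0 - z₀`. -/
def mulNormal (z₀ : ℂ) : Dist →ₗ[ℂ] Dist := mulDist (fun p => p 0 - z₀) (contDiff_normal z₀)

/-- Multiplication by the complex conjugate of `p 0 - z₀`. -/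
def mulNormalBar (z₀ : ℂ) : Dist →ₗ[ℂ] Dist :=
  mulDist (fun p => conj (p 0 - z₀)) (contDiff_normalBar z₀)

lemma fderiv_coord (a : Fin 3) (p v : Chart) : fderiv ℝ (fun p : Chart => p a) p v = v a := by
  have h : HasFDerivAt (fun p : Chart => p a)
      (ContinuousLinearMap.proj (R := ℝ) (φ := fun _ : Fin 3 => ℂ) a) p :=
    (ContinuousLinearMap.proj (R := ℝ) (φ := fun _ : Fin 3 => ℂ) a).hasFDerivAt
  rw [h.fderiv]
  rfl

lemma fderiv_normal (z₀ : ℂ) (p v : Chart) :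
    fderiv ℝ (fun p : Chart => p 0 - z₀) p v = v 0 := by
  rw [fderiv_sub_const, fderiv_coord]

lemma fderiv_normalBar (z₀ : ℂ) (p v : Chart) :
    fderiv ℝ (fun p : Chart => conj (p 0 - z₀)) p v = conj (v 0) := by
  have h : HasFDerivAt (fun p : Chart => p 0 - z₀)
      (ContinuousLinearMap.proj (R := ℝ) (φ := fun _ : Fin 3 => ℂ) 0) p :=
    ((ContinuousLinearMap.proj (R := ℝ) (φ := fun _ : Fin 3 => ℂ) 0).hasFDerivAt).sub_const z₀
  have h2 : HasFDerivAt (fun p : Chart => conj (p 0 - z₀)) _ p :=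
    (Complex.conjCLE.hasFDerivAt (x := p 0 - z₀)).comp p h
  rw [h2.fderiv]
  rfl

lemma dist_zero_smul (T : Dist) : (0 : ℂ) • T = 0 := zero_smul ℂ T

section Commutators

variable (z₀ : ℂ) (T : Dist)

lemma del_mulCoord_self (a : Fin 3) : del a (mulCoord a T) = mulCoord a (del a T) + T := by
  rw [mulCoord, del_mulDist (c := 1) (d := Complex.I)
    (fun p => by rw [fderiv_coord]; simp) (fun p => by rw [fderiv_coord]; simp)]
  simp

lemma del_mulCoord {a b : Fin 3} (h : a ≠ b) : del a (mulCoord b T) = mulCoord b (del a T) := by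
  rw [mulCoord, del_mulDist (c := 0) (d := 0)
    (fun p => by rw [fderiv_coord]; simp [h.symm]) (fun p => by rw [fderiv_coord]; simp [h.symm])]
  simp [dist_zero_smul]

lemma delBar_mulCoord (a b : Fin 3) : delBar a (mulCoord b T) = mulCoord b (delBar a T) := by
  by_cases h : b = a
  · subst h
    rw [mulCoord, delBar_mulDist (c := 1) (d := Complex.I)
      (fun p => by rw [fderiv_coord]; simp) (fun p => by rw [fderiv_coord]; simp)]
    simp [dist_zero_smul]
  · rw [mulCoord, delBar_mulDist (c := 0) (d := 0)
      (fun p => by rw [fderiv_coord]; simp [h]) (fun p => by rw [fderiv_coord]; simp [h])]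
    simp [dist_zero_smul]

lemma del_mulNormal_self : del 0 (mulNormal z₀ T) = mulNormal z₀ (del 0 T) + T := by
  rw [mulNormal, del_mulDist (c := 1) (d := Complex.I)
    (fun p => by rw [fderiv_normal]; simp) (fun p => by rw [fderiv_normal]; simp)]
  simp

lemma del_mulNormal {a : Fin 3} (h : a ≠ 0) :
    del a (mulNormal z₀ T) = mulNormal z₀ (del a T) := by
  rw [mulNormal, del_mulDist (c := 0) (d := 0)
    (fun p => by rw [fderiv_normal]; simp [h.symm])
    (fun p => by rw [fderiv_normal]; simp [h.symm])]
  simp [dist_zero_smul]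

lemma delBar_mulNormal (a : Fin 3) :
    delBar a (mulNormal z₀ T) = mulNormal z₀ (delBar a T) := by
  by_cases h : (0 : Fin 3) = a
  · subst h
    rw [mulNormal, delBar_mulDist (c := 1) (d := Complex.I)
      (fun p => by rw [fderiv_normal]; simp) (fun p => by rw [fderiv_normal]; simp)]
    simp [dist_zero_smul]
  · rw [mulNormal, delBar_mulDist (c := 0) (d := 0)
      (fun p => by rw [fderiv_normal]; simp [h]) (fun p => by rw [fderiv_normal]; simp [h])]
    simp [dist_zero_smul]

lemma delBar_mulNormalBar_self :
    delBar 0 (mulNormalBar z₀ T) = mulNormalBar z₀ (delBar 0 T) + T := by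
  rw [mulNormalBar, delBar_mulDist (c := 1) (d := -Complex.I)
    (fun p => by rw [fderiv_normalBar]; simp) (fun p => by rw [fderiv_normalBar]; simp)]
  simp

lemma delBar_mulNormalBar {a : Fin 3} (h : a ≠ 0) :
    delBar a (mulNormalBar z₀ T) = mulNormalBar z₀ (delBar a T) := by
  rw [mulNormalBar, delBar_mulDist (c := 0) (d := 0)
    (fun p => by rw [fderiv_normalBar]; simp [h.symm])
    (fun p => by rw [fderiv_normalBar]; simp [h.symm])]
  simp [dist_zero_smul]

lemma del_mulNormalBar (a : Fin 3) :
    del a (mulNormalBar z₀ T) = mulNormalBar z₀ (del a T) := by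
  by_cases h : (0 : Fin 3) = a
  · subst h
    rw [mulNormalBar, del_mulDist (c := 1) (d := -Complex.I)
      (fun p => by rw [fderiv_normalBar]; simp) (fun p => by rw [fderiv_normalBar]; simp)]
    simp [dist_zero_smul]
  · rw [mulNormalBar, del_mulDist (c := 0) (d := 0)
      (fun p => by rw [fderiv_normalBar]; simp [h])
      (fun p => by rw [fderiv_normalBar]; simp [h])]
    simp [dist_zero_smul]

lemma mulNormal_mulCoord (a : Fin 3) :
    mulNormal z₀ (mulCoord a T) = mulCoord a (mulNormal z₀ T) := mulDist_comm T

lemma mulNormalBar_mulCoord (a : Fin 3) :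
    mulNormalBar z₀ (mulCoord a T) = mulCoord a (mulNormalBar z₀ T) := mulDist_comm T

lemma mulNormalBar_mulNormal :
    mulNormalBar z₀ (mulNormal z₀ T) = mulNormal z₀ (mulNormalBar z₀ T) := mulDist_comm T

lemma mulCoord_comm (a b : Fin 3) :
    mulCoord a (mulCoord b T) = mulCoord b (mulCoord a T) := mulDist_comm T

end Commutators

/-! ### Continuity estimates -/

/-- Continuity on the Fréchet space of test functions supported in `K`: the finitely many seminorms
that bound `T` are replaced by all derivatives up to their maximal order. -/
lemma exists_bound (T : Dist) {K : Set Chart} (hK : IsCompact K) :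
    ∃ N : ℕ, ∃ C : ℝ, 0 ≤ C ∧ ∀ f : Test, tsupport f ⊆ K → ∀ A : ℝ, 0 ≤ A →
      (∀ i ≤ N, ∀ p, ‖iteratedFDeriv ℝ i f p‖ ≤ A) → ‖T f‖ ≤ C * A := by
  let K' : TopologicalSpace.Compacts Chart := ⟨K, hK⟩
  have hsub : (K' : Set Chart) ⊆ (⊤ : TopologicalSpace.Opens Chart) := fun _ _ => trivial
  let L := T ∘L (TestFunction.ofSupportedInCLM ℂ (n := ⊤) hsub)
  let q : Seminorm ℂ 𝓓_{K'}(Chart, ℂ) := (normSeminorm ℂ ℂ).comp L.toLinearMap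
  have hq : Continuous q := L.continuous.norm
  obtain ⟨s, C, -, h⟩ := Seminorm.bound_of_continuous
    (ContDiffMapSupportedIn.withSeminorms ℂ Chart ℂ ⊤ K') q hq
  refine ⟨s.sup id, C, C.2, fun f hf A hA hb => ?_⟩
  let fK : 𝓓_{K'}(Chart, ℂ) := .of_support_subset f.contDiff (subset_closure.trans hf)
  have h1 : q fK ≤ C * s.sup (ContDiffMapSupportedIn.seminorm ℂ Chart ℂ ⊤ K') fK := h fK
  have h2 : s.sup (ContDiffMapSupportedIn.seminorm ℂ Chart ℂ ⊤ K') fK ≤ A := by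
    refine Seminorm.finset_sup_apply_le hA fun i hi => ?_
    rw [ContDiffMapSupportedIn.seminorm_top_le_iff ℂ hA]
    intro x _
    exact hb i (Finset.le_sup (f := id) hi) x
  have h3 : q fK = ‖T f‖ := rfl
  rw [← h3]
  exact h1.trans (by gcongr)

lemma norm_iteratedFDeriv_comp_affine_le {E F : Type*} [NormedAddCommGroup E] [NormedSpace ℝ E]
    [NormedAddCommGroup F] [NormedSpace ℝ F] {f : F → ℂ}
    (hf : ContDiff ℝ ((⊤ : ℕ∞) : WithTop ℕ∞) f) (L : E →L[ℝ] F) (b : F) (i : ℕ) (p : E) :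
    ‖iteratedFDeriv ℝ i (fun p => f (L p - b)) p‖
      ≤ ‖iteratedFDeriv ℝ i f (L p - b)‖ * ‖L‖ ^ i := by
  have hg : ContDiff ℝ ((⊤ : ℕ∞) : WithTop ℕ∞) (fun y => f (y - b)) := by fun_prop
  have h := L.iteratedFDeriv_comp_right hg p (i := i) (by exact_mod_cast le_top)
  have h2 : (fun y => f (y - b)) ∘ L = fun p => f (L p - b) := rfl
  rw [h2] at h
  rw [h, iteratedFDeriv_comp_sub]
  refine (ContinuousMultilinearMap.norm_compContinuousLinearMap_le _ _).trans ?_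
  simp

lemma exists_iteratedFDeriv_bound {E : Type*} [NormedAddCommGroup E] [NormedSpace ℝ E]
    {f : E → ℂ} (hf : ContDiff ℝ ((⊤ : ℕ∞) : WithTop ℕ∞) f) (hc : HasCompactSupport f) (N : ℕ) :
    ∃ A : ℝ, 0 ≤ A ∧ ∀ i ≤ N, ∀ p, ‖iteratedFDeriv ℝ i f p‖ ≤ A := by
  have h : ∀ i : ℕ, ∃ A, ∀ p, ‖iteratedFDeriv ℝ i f p‖ ≤ A := fun i =>
    (hf.continuous_iteratedFDeriv (by exact_mod_cast le_top)).bounded_above_of_compact_support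
      (hc.iteratedFDeriv i)
  choose A hA using h
  refine ⟨∑ i ∈ Finset.range (N + 1), |A i|, by positivity, fun i hi p => ?_⟩
  refine ((hA i p).trans (le_abs_self _)).trans ?_
  exact Finset.single_le_sum (f := fun i => |A i|) (fun j _ => abs_nonneg _)
    (Finset.mem_range.2 (by omega))

/-- The real-linear map `p ↦ k • p 0`. -/
def scaledNormal (k : ℝ) : Chart →L[ℝ] ℂ :=
  k • ContinuousLinearMap.proj (R := ℝ) (φ := fun _ : Fin 3 => ℂ) 0

lemma norm_scaledNormal_le {k : ℝ} (hk : 0 ≤ k) : ‖scaledNormal k‖ ≤ k := by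
  refine ContinuousLinearMap.opNorm_le_bound _ hk fun p => ?_
  simp only [scaledNormal, smul_apply, ContinuousLinearMap.proj_apply, norm_smul,
    Real.norm_eq_abs, abs_of_nonneg hk]
  exact mul_le_mul_of_nonneg_left (norm_le_pi_norm p 0) hk

/-- A distribution supported on `p 0 = z₀` is locally killed by functions of the normal coordinate
that vanish to sufficiently high order. -/
lemma exists_order {z₀ : ℂ} {T : Dist} (hT : T ∈ supportedOn z₀) {K : Set Chart}
    (hK : IsCompact K) : ∃ N : ℕ, ∀ q : ℂ → ℂ, ContDiff ℝ ((⊤ : ℕ∞) : WithTop ℕ∞) q →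
      (∀ (k : ℝ) w, q (k * w) = k ^ N * q w) → ∀ f : Test, tsupport f ⊆ K →
      T (toTest fun p => q (p 0 - z₀) * f p) = 0 := by
  obtain ⟨M, C, hC, hbound⟩ := exists_bound T hK
  refine ⟨M + 1, fun q hq hhom f hf => ?_⟩
  -- With `q` homogeneous of degree `M + 1`, rescaling `η = q χ` by `k` gives `k ^ (M+1) q` near the
  -- surface, cut off at distance of order `1/k`.
  let χ : ContDiffBump (0 : ℂ) := ⟨1, 2, one_pos, one_lt_two⟩
  let η : ℂ → ℂ := fun w => q w * (χ w : ℂ)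
  have hχ : ContDiff ℝ ((⊤ : ℕ∞) : WithTop ℕ∞) (fun w => (χ w : ℂ)) :=
    Complex.ofRealCLM.contDiff.comp χ.contDiff
  have hη : ContDiff ℝ ((⊤ : ℕ∞) : WithTop ℕ∞) η := hq.mul hχ
  have hηc : HasCompactSupport η := by
    have : HasCompactSupport fun w => (χ w : ℂ) :=
      χ.hasCompactSupport.comp_left (g := fun r : ℝ => (r : ℂ)) (by simp)
    exact this.mul_left
  obtain ⟨A₁, hA₁, h₁⟩ := exists_iteratedFDeriv_bound hη hηc M
  obtain ⟨A₂, hA₂, h₂⟩ := exists_iteratedFDeriv_bound f.contDiff f.hasCompactSupport M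
  have hqf : IsTest fun p => q (p 0 - z₀) * f p :=
    IsTest.mul_left (hq.comp (contDiff_normal z₀)) (isTest_coe f)
  have hsmooth : ∀ k : ℝ, ContDiff ℝ ((⊤ : ℕ∞) : WithTop ℕ∞)
      (fun p : Chart => η (scaledNormal k p - k * z₀)) := fun k =>
    hη.comp ((scaledNormal k).contDiff.sub contDiff_const)
  let F : ℝ → Chart → ℂ := fun k p => η (scaledNormal k p - k * z₀) * f p
  have hF : ∀ k, IsTest (F k) := fun k => IsTest.mul_left (hsmooth k) (isTest_coe f)
  have hFapp : ∀ k : ℝ, ∀ p, F k p = η (k * (p 0 - z₀)) * f p := by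
    intro k p
    simp only [F, scaledNormal, smul_apply, ContinuousLinearMap.proj_apply,
      Complex.real_smul]
    ring_nf
  -- comparison of `q f` with its localization near the surface
  have hloc : ∀ k : ℝ, 1 ≤ k → (k : ℂ) ^ (M + 1) * T (toTest fun p => q (p 0 - z₀) * f p)
      = T (toTest (F k)) := by
    intro k hk
    have hdiff : IsTest fun p => (k : ℂ) ^ (M + 1) * (q (p 0 - z₀) * f p) - F k p :=
      (IsTest.mul_left (f := fun _ => (k : ℂ) ^ (M + 1)) contDiff_const hqf).sub (hF k)
    have hz : T (toTest fun p => (k : ℂ) ^ (M + 1) * (q (p 0 - z₀) * f p) - F k p) = 0 := by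
      apply hT
      rw [coe_toTest hdiff]
      intro p hp hp0
      refine notMem_tsupport_iff_eventuallyEq.2 ?_ hp
      have hk0 : (0 : ℝ) < k := by linarith
      have hn : ∀ᶠ y : Chart in 𝓝 p, ‖(k : ℂ) * (y 0 - z₀)‖ < 1 := by
        have hcont : Continuous fun y : Chart => ‖(k : ℂ) * (y 0 - z₀)‖ := by fun_prop
        refine hcont.continuousAt.eventually_lt continuousAt_const ?_
        rw [hp0]; simp
      filter_upwards [hn] with y hy
      have : χ ((k : ℂ) * (y 0 - z₀)) = 1 := χ.one_of_mem_closedBall (by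
        rw [Metric.mem_closedBall, dist_zero_right]; exact hy.le)
      simp only [hFapp, η, this, hhom]
      simp
      ring
    rw [toTest_sub (IsTest.mul_left (f := fun _ => (k : ℂ) ^ (M + 1)) contDiff_const hqf) (hF k),
      toTest_const_mul _ hqf, map_sub, map_smul, smul_eq_mul] at hz
    exact sub_eq_zero.1 hz
  -- Each of at most `M` derivatives of the rescaled factor costs one power of `k`, so the right
  -- side grows like `k ^ M`, one power less than the left side of `hloc`.
  have hest : ∀ k : ℝ, 1 ≤ k → ‖T (toTest (F k))‖ ≤ C * (2 ^ M * k ^ M * A₁ * A₂) := by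
    intro k hk
    have hk0 : 0 ≤ k := by linarith
    refine hbound _ ?_ _ (by positivity) fun i hi p => ?_
    · rw [coe_toTest (hF k)]
      exact tsupport_mul_subset_right.trans hf
    · rw [coe_toTest (hF k)]
      refine (norm_iteratedFDeriv_mul_le (hsmooth k) f.contDiff p
        (by exact_mod_cast le_top)).trans ?_
      have hterm : ∀ j ∈ Finset.range (i + 1), (i.choose j : ℝ) *
          ‖iteratedFDeriv ℝ j (fun p : Chart => η (scaledNormal k p - k * z₀)) p‖ *
          ‖iteratedFDeriv ℝ (i - j) f p‖ ≤ (i.choose j : ℝ) * (k ^ M * A₁ * A₂) := by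
        intro j hj
        have hj' : j ≤ M := by have := Finset.mem_range.1 hj; omega
        have e1 := norm_iteratedFDeriv_comp_affine_le hη (scaledNormal k) (k * z₀) j p
        have e2 : ‖scaledNormal k‖ ^ j ≤ k ^ M :=
          (pow_le_pow_left₀ (norm_nonneg _) (norm_scaledNormal_le hk0) j).trans
            (pow_le_pow_right₀ hk hj')
        have e3 := h₁ j hj' (scaledNormal k p - k * z₀)
        have e4 := h₂ (i - j) (by omega) p
        have e5 : ‖iteratedFDeriv ℝ j (fun p : Chart => η (scaledNormal k p - k * z₀)) p‖
            ≤ k ^ M * A₁ := by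
          refine e1.trans ?_
          rw [mul_comm]
          exact mul_le_mul e2 e3 (norm_nonneg _) (by positivity)
        rw [mul_assoc]
        gcongr
      refine (Finset.sum_le_sum hterm).trans ?_
      rw [← Finset.sum_mul]
      have : ∑ j ∈ Finset.range (i + 1), (i.choose j : ℝ) = 2 ^ i := by
        exact_mod_cast Nat.sum_range_choose i
      rw [this]
      have e6 : (2 : ℝ) ^ i ≤ 2 ^ M := pow_le_pow_right₀ one_le_two hi
      calc (2 : ℝ) ^ i * (k ^ M * A₁ * A₂) ≤ 2 ^ M * (k ^ M * A₁ * A₂) := by gcongr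
        _ = _ := by ring
  have hfin : ∀ k : ℝ, 1 ≤ k →
      k * ‖T (toTest fun p => q (p 0 - z₀) * f p)‖ ≤ C * (2 ^ M * A₁ * A₂) := by
    intro k hk
    have hk0 : (0 : ℝ) < k := by linarith
    have := hest k hk
    rw [← hloc k hk, norm_mul, norm_pow, Complex.norm_real, Real.norm_eq_abs, abs_of_pos hk0]
      at this
    have hkM : (0 : ℝ) < k ^ M := by positivity
    refine le_of_mul_le_mul_left ?_ hkM
    calc k ^ M * (k * ‖T (toTest fun p => q (p 0 - z₀) * f p)‖)
        = k ^ (M + 1) * ‖T (toTest fun p => q (p 0 - z₀) * f p)‖ := by ring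
      _ ≤ _ := this
      _ = _ := by ring
  by_contra hne
  have hpos : 0 < ‖T (toTest fun p => q (p 0 - z₀) * f p)‖ := norm_pos_iff.2 hne
  set t := ‖T (toTest fun p => q (p 0 - z₀) * f p)‖
  have hB : 0 ≤ C * (2 ^ M * A₁ * A₂) := by positivity
  -- A value of `k` just beyond the one at which `k t` reaches the bound.
  have := hfin (C * (2 ^ M * A₁ * A₂) / t + 1) (by
    have : 0 ≤ C * (2 ^ M * A₁ * A₂) / t := by positivity
    linarith)
  rw [add_mul, div_mul_cancel₀ _ hpos.ne'] at this
  linarith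

lemma mulNormal_pow_toTest (z₀ : ℂ) (N : ℕ) (T : Dist) (f : Test) :
    (mulNormal z₀ ^ N) T f = T (toTest fun p => (p 0 - z₀) ^ N * f p) := by
  induction N generalizing f with
  | zero => simp [toTest_coe]
  | succ N ih =>
    rw [pow_succ', Module.End.mul_apply, mulNormal, mulDist_apply, ← mulNormal, ih]
    congr 2
    ext p
    simp
    ring

lemma mulNormalBar_pow_toTest (z₀ : ℂ) (N : ℕ) (T : Dist) (f : Test) :
    (mulNormalBar z₀ ^ N) T f = T (toTest fun p => conj (p 0 - z₀) ^ N * f p) := by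
  induction N generalizing f with
  | zero => simp [toTest_coe]
  | succ N ih =>
    rw [pow_succ', Module.End.mul_apply, mulNormalBar, mulDist_apply, ← mulNormalBar, ih]
    congr 2
    ext p
    simp
    ring

lemma exists_mulNormal_pow_mem {z₀ : ℂ} {T : Dist} (hT : T ∈ supportedOn z₀) {K : Set Chart}
    (hK : IsCompact K) : ∃ N : ℕ, (mulNormal z₀ ^ N) T ∈ vanishing K := by
  obtain ⟨N, hN⟩ := exists_order hT hK
  refine ⟨N, fun f hf => ?_⟩
  rw [mulNormal_pow_toTest]
  exact hN (fun w => w ^ N) (by fun_prop) (fun k w => mul_pow _ _ _) f hf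

lemma exists_mulNormalBar_pow_mem {z₀ : ℂ} {T : Dist} (hT : T ∈ supportedOn z₀) {K : Set Chart}
    (hK : IsCompact K) : ∃ N : ℕ, (mulNormalBar z₀ ^ N) T ∈ vanishing K := by
  obtain ⟨N, hN⟩ := exists_order hT hK
  refine ⟨N, fun f hf => ?_⟩
  rw [mulNormalBar_pow_toTest]
  exact hN (fun w => conj w ^ N) (contDiff_conj.pow N)
    (fun k w => by rw [map_mul, Complex.conj_ofReal, mul_pow]) f hf

/-! ### Algebra of operators with `[D, X] = 1` -/

section Weyl

variable {D X : Module.End ℂ Dist} {T : Dist} {S : Submodule ℂ Dist}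

lemma pow_apply_mem (hX : ∀ T ∈ S, X T ∈ S) (hT : T ∈ S) (N : ℕ) : (X ^ N) T ∈ S := by
  induction N with
  | zero => simpa
  | succ N ih => rw [pow_succ', Module.End.mul_apply]; exact hX _ ih

lemma weyl_comm_pow (h : ∀ T, D (X T) = X (D T) + T) (N : ℕ) (T : Dist) :
    D ((X ^ (N + 1)) T) = (X ^ (N + 1)) (D T) + ((N : ℂ) + 1) • (X ^ N) T := by
  induction N with
  | zero => simp [h]
  | succ N ih =>
    rw [pow_succ', Module.End.mul_apply, h, ih, map_add, map_smul, ← Module.End.mul_apply,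
      ← pow_succ', ← Module.End.mul_apply X, ← pow_succ']
    push_cast
    module

lemma weyl_comm_pow' (h : ∀ T, D (X T) = X (D T) + T) (N : ℕ) (T : Dist) :
    X ((D ^ (N + 1)) T) = (D ^ (N + 1)) (X T) - ((N : ℂ) + 1) • (D ^ N) T := by
  induction N with
  | zero => simp [h]
  | succ N ih =>
    have h' : ∀ T, X (D T) = D (X T) - T := fun T => by rw [h]; abel
    rw [pow_succ', Module.End.mul_apply, h', ih, map_sub, map_smul, ← Module.End.mul_apply,
      ← pow_succ', ← Module.End.mul_apply D, ← pow_succ']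
    push_cast
    module

/-- `X D` has no natural number as an eigenvalue on vectors killed by a power of `X`, modulo any
stable subspace. -/
lemma mem_of_pow_mem (h : ∀ T, D (X T) = X (D T) + T) (hD : ∀ T ∈ S, D T ∈ S) {k : ℕ}
    (hT : X (D T) = (k : ℂ) • T) (N : ℕ) (hN : (X ^ N) T ∈ S) : T ∈ S := by
  induction N with
  | zero => simpa using hN
  | succ N ih =>
    apply ih
    -- Apply `D` to `X ^ (N+1) T ∈ S`. The eigenvalue equation turns the result into `(k + N + 1) X
    -- ^ N T`. The factor is non-zero, so the exponent drops by one.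
    have e := weyl_comm_pow h N T
    have e2 : (X ^ (N + 1)) (D T) = (k : ℂ) • (X ^ N) T := by
      rw [pow_succ, Module.End.mul_apply, hT, map_smul]
    rw [e2] at e
    have h1 : ((k : ℂ) + ((N : ℂ) + 1)) • (X ^ N) T ∈ S := by
      have e3 : ((k : ℂ) + ((N : ℂ) + 1)) • (X ^ N) T = D ((X ^ (N + 1)) T) := by
        rw [e]; module
      rw [e3]
      exact hD _ hN
    have h2 : (k : ℂ) + ((N : ℂ) + 1) ≠ 0 := by exact_mod_cast (by omega : k + (N + 1) ≠ 0)
    exact (S.smul_mem_iff h2).1 h1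

/-- Since `X D ^ b = D ^ b X - b D ^ (b-1)`, consecutive terms cancel. The partial sums of `∑ D ^ b
X ^ b / b!` thus project onto the kernel of `X` once a power of `X` kills `T`. -/
lemma weyl_telescope (h : ∀ T, D (X T) = X (D T) + T) (n : ℕ) (T : Dist) :
    X (∑ b ∈ Finset.range (n + 1), ((b.factorial : ℂ)⁻¹) • (D ^ b) ((X ^ b) T))
      = ((n.factorial : ℂ)⁻¹) • (D ^ n) ((X ^ (n + 1)) T) := by
  induction n with
  | zero => simp
  | succ n ih =>
    rw [Finset.sum_range_succ, map_add, ih, map_smul, weyl_comm_pow' h, ← Module.End.mul_apply X,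
      ← pow_succ']
    have : ((n + 1).factorial : ℂ)⁻¹ * ((n : ℂ) + 1) = (n.factorial : ℂ)⁻¹ := by
      rw [Nat.factorial_succ]
      push_cast
      have h1 : ((n : ℂ) + 1) ≠ 0 := by exact_mod_cast Nat.succ_ne_zero n
      have h2 : (n.factorial : ℂ) ≠ 0 := by exact_mod_cast n.factorial_ne_zero
      field_simp
    rw [smul_sub, smul_smul, this]
    abel

end Weyl

/-! ### Distributions supported on a surface -/

section Supported

variable {z₀ : ℂ} {T : Dist}

lemma mulNormalBar_mem_vanishing {s : Set Chart} (hT : T ∈ vanishing s) :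
    mulNormalBar z₀ T ∈ vanishing s := mulDist_mem_vanishing hT _ _

lemma mulNormal_mem_vanishing {s : Set Chart} (hT : T ∈ vanishing s) :
    mulNormal z₀ T ∈ vanishing s := mulDist_mem_vanishing hT _ _

lemma eq_zero_of_mulNormalBar_delBar (hT : T ∈ supportedOn z₀) {k : ℕ}
    (h : mulNormalBar z₀ (delBar 0 T) = (k : ℂ) • T) : T = 0 := by
  refine eq_zero_of_forall_vanishing fun K hK => ?_
  obtain ⟨N, hN⟩ := exists_mulNormalBar_pow_mem hT hK
  exact mem_of_pow_mem (D := delBar 0) (X := mulNormalBar z₀) (delBar_mulNormalBar_self z₀)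
    (fun T hT => delBar_mem_vanishing hT 0) h N hN

lemma eq_zero_of_mulNormal_del (hT : T ∈ supportedOn z₀) {k : ℕ}
    (h : mulNormal z₀ (del 0 T) = (k : ℂ) • T) : T = 0 := by
  refine eq_zero_of_forall_vanishing fun K hK => ?_
  obtain ⟨N, hN⟩ := exists_mulNormal_pow_mem hT hK
  exact mem_of_pow_mem (D := del 0) (X := mulNormal z₀) (del_mulNormal_self z₀)
    (fun T hT => del_mem_vanishing hT 0) h N hN

/-- On each compact set only finitely many terms act, so the sum is a finite sum there and its
continuity is automatic. The order of a distribution need not be bounded globally, so a finite sum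
would not suffice. -/
lemma exists_sum_of_locally_finite (t : ℕ → Dist)
    (h : ∀ K : Set Chart, IsCompact K → ∃ N, ∀ n ≥ N, t n ∈ vanishing K) :
    ∃ S : Dist, ∀ K : Set Chart, IsCompact K → ∃ N, ∀ n ≥ N,
      S - ∑ i ∈ Finset.range n, t i ∈ vanishing K := by
  choose N hN using h
  have hstab : ∀ (f : Test) (a b : ℕ), (∀ n ≥ a, t n f = 0) → (∀ n ≥ b, t n f = 0) →
      ∑ i ∈ Finset.range a, t i f = ∑ i ∈ Finset.range b, t i f := by
    have aux : ∀ (f : Test) (a b : ℕ), a ≤ b → (∀ n ≥ a, t n f = 0) →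
        ∑ i ∈ Finset.range a, t i f = ∑ i ∈ Finset.range b, t i f := by
      intro f a b hab ha
      refine Finset.sum_subset (Finset.range_mono hab) fun i _ hi => ha i ?_
      simpa using hi
    intro f a b ha hb
    rcases le_total a b with hab | hab
    · exact aux f a b hab ha
    · exact (aux f b a hab hb).symm
  let S : Dist := TestFunction.limitCLM ℂ
    (fun f => ∑ i ∈ Finset.range (N (tsupport f) f.hasCompactSupport), t i f)
    (fun K hK => (∑ i ∈ Finset.range (N K K.isCompact), t i) ∘L
      TestFunction.ofSupportedInCLM ℂ hK)
    (fun K hK f => by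
      have := hstab (TestFunction.ofSupportedIn hK f) _ _
        (fun n hn => hN _ (TestFunction.ofSupportedIn hK f).hasCompactSupport n hn _ subset_rfl)
        (fun n hn => hN K K.isCompact n hn _ f.tsupport_subset)
      rw [this]
      simp)
  refine ⟨S, fun K hK => ⟨N K hK, fun n hn f hf => ?_⟩⟩
  have hS : S f = ∑ i ∈ Finset.range (N (tsupport f) f.hasCompactSupport), t i f := rfl
  rw [sub_apply, hS, hstab f _ n (fun n hn => hN _ f.hasCompactSupport n hn _ subset_rfl)
    (fun k hk => hN K hK k (hn.trans hk) _ hf)]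
  simp

/-- Modulo `∂/∂p̄₀`, a distribution supported on the surface is killed by the conjugate normal
coordinate. -/
lemma exists_mulNormalBar_sub_delBar_eq_zero (hT : T ∈ supportedOn z₀) :
    ∃ U ∈ supportedOn z₀, mulNormalBar z₀ (T - delBar 0 U) = 0 := by
  let D : Module.End ℂ Dist := delBar 0
  let X : Module.End ℂ Dist := mulNormalBar z₀
  have hDX : ∀ T, D (X T) = X (D T) + T := delBar_mulNormalBar_self z₀
  have hD : ∀ {s : Set Chart}, ∀ T ∈ vanishing s, D T ∈ vanishing s :=
    fun T hT => delBar_mem_vanishing hT 0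
  have hX : ∀ {s : Set Chart}, ∀ T ∈ vanishing s, X T ∈ vanishing s :=
    fun T hT => mulNormalBar_mem_vanishing hT
  -- Chosen so that `T - D ∑ t b` is the telescoping sum `∑ D ^ b X ^ b T / b!`. The term with `b =
  -- 0` is `T`, and every other term has a factor `D` on the left.
  let t : ℕ → Dist := fun b => -(((b + 1).factorial : ℂ)⁻¹ • (D ^ b) ((X ^ (b + 1)) T))
  have hfar : ∀ K : Set Chart, IsCompact K → ∃ N, ∀ n ≥ N, (X ^ n) T ∈ vanishing K := by
    intro K hK
    obtain ⟨N, hN⟩ := exists_mulNormalBar_pow_mem hT hK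
    refine ⟨N, fun n hn => ?_⟩
    obtain ⟨k, rfl⟩ := Nat.exists_eq_add_of_le hn
    rw [add_comm, pow_add, Module.End.mul_apply]
    exact pow_apply_mem hX hN k
  obtain ⟨U, hU⟩ := exists_sum_of_locally_finite t fun K hK => by
    obtain ⟨N, hN⟩ := hfar K hK
    exact ⟨N, fun n hn => Submodule.neg_mem _ (Submodule.smul_mem _ _
      (pow_apply_mem hD (hN _ (by omega)) _))⟩
  refine ⟨U, fun f hf => ?_, ?_⟩
  · obtain ⟨N, hN⟩ := hU _ f.hasCompactSupport
    have h1 := hN N le_rfl f subset_rfl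
    have h2 : (∑ i ∈ Finset.range N, t i) ∈ vanishing {p : Chart | p 0 ≠ z₀} :=
      Submodule.sum_mem _ fun i _ => Submodule.neg_mem _ (Submodule.smul_mem _ _
        (pow_apply_mem hD (pow_apply_mem hX hT _) _))
    rw [sub_apply, h2 f hf, sub_zero] at h1
    exact h1
  · refine eq_zero_of_forall_vanishing fun K hK => ?_
    obtain ⟨N₁, hN₁⟩ := hU K hK
    obtain ⟨N₂, hN₂⟩ := hfar K hK
    let n := max N₁ N₂
    have h1 := hN₁ n (le_max_left _ _)
    have hsum : T - D (∑ i ∈ Finset.range n, t i) =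
        ∑ b ∈ Finset.range (n + 1), ((b.factorial : ℂ)⁻¹) • (D ^ b) ((X ^ b) T) := by
      rw [Finset.sum_range_succ', map_sum]
      simp only [t, map_neg, map_smul, Finset.sum_neg_distrib, ← Module.End.mul_apply D,
        ← pow_succ']
      simp
      abel
    have h2 : mulNormalBar z₀ (T - delBar 0 U) = X (∑ b ∈ Finset.range (n + 1),
        ((b.factorial : ℂ)⁻¹) • (D ^ b) ((X ^ b) T)) - X (D (U - ∑ i ∈ Finset.range n, t i)) := by
      rw [← hsum, ← map_sub, map_sub D]
      congr 1
      change T - D U = _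
      abel
    rw [h2, weyl_telescope hDX]
    exact Submodule.sub_mem _ (Submodule.smul_mem _ _ (pow_apply_mem hD
      (hN₂ _ ((le_max_right N₁ N₂).trans (Nat.le_succ _))) _)) (hX _ (hD _ h1))

end Supported

/-! ### Normal forms of gauge classes -/

/-- The coefficients of the normal representatives `dz ⊗ B dz̄` of gauge classes. -/
structure IsNormalForm (z₀ : ℂ) (B : Dist) : Prop where
  mem : B ∈ supportedOn z₀
  mulNormalBar_eq : mulNormalBar z₀ B = 0
  delBar₁ : delBar 1 B = 0
  delBar₂ : delBar 2 B = 0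

/-- The Euler operator of the fibre coordinates. -/
def fibreEuler : Dist →ₗ[ℂ] Dist := mulCoord 1 ∘ₗ del 1 + mulCoord 2 ∘ₗ del 2

lemma fibreEuler_apply (T : Dist) :
    fibreEuler T = mulCoord 1 (del 1 T) + mulCoord 2 (del 2 T) := rfl

section NormalForm

variable {z₀ : ℂ} {B : Dist}

lemma dbar_apply (χ : Dist) (a : Fin 3) : dbar χ a = delBar a χ := rfl

/-- The eigenvalue zero case. Both existence and uniqueness of normal forms rest on it. -/
lemma eq_zero_of_mulNormalBar_delBar_eq_zero {C : Dist} (hC : C ∈ supportedOn z₀)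
    (h : mulNormalBar z₀ (delBar 0 C) = 0) : C = 0 :=
  eq_zero_of_mulNormalBar_delBar hC (k := 0) (by simpa [dist_zero_smul] using h)

/-- A gauge transformation makes the `dz̄` component killed by `X̄`. Closedness then gives `X̄ ∂̄₀ C
= X̄ ∂̄ₐ B = ∂̄ₐ X̄ B = 0` for each other component `C`, so `C = 0`; closedness once more makes `B`
holomorphic along the fibre. -/
lemma exists_normalForm {A : Current} (hA : A ∈ localizedFields z₀) :
    ∃ χ ∈ supportedOn z₀, ∃ B, IsNormalForm z₀ B ∧ A = Pi.single 0 B + dbar χ := by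
  obtain ⟨U, hU, hUA⟩ := exists_mulNormalBar_sub_delBar_eq_zero (hA.2 0)
  have hmem : ∀ a, A a - delBar a U ∈ supportedOn z₀ := fun a =>
    Submodule.sub_mem _ (hA.2 a) (delBar_mem_vanishing hU a)
  have hclosed : ∀ a, delBar 0 (A a - delBar a U) = delBar a (A 0 - delBar 0 U) := by
    intro a
    rw [map_sub, map_sub, hA.1 0 a, delBar_comm]
  have hzero : ∀ a, a ≠ 0 → A a - delBar a U = 0 := by
    intro a ha
    apply eq_zero_of_mulNormalBar_delBar_eq_zero (hmem a)
    rw [hclosed, ← delBar_mulNormalBar z₀ _ ha, hUA, map_zero]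
  have hdel : ∀ a, a ≠ 0 → delBar a (A 0 - delBar 0 U) = 0 := by
    intro a ha
    rw [← hclosed, hzero a ha, map_zero]
  refine ⟨U, hU, A 0 - delBar 0 U, ⟨hmem 0, hUA, hdel 1 (by decide), hdel 2 (by decide)⟩, ?_⟩
  funext a
  by_cases ha : a = 0
  · subst ha
    simp [dbar_apply]
  · rw [Pi.add_apply, Pi.single_eq_of_ne ha, zero_add, dbar_apply]
    exact sub_eq_zero.1 (hzero a ha)

/-- If `B = ∂̄₀χ` and `X̄ B = 0`, then `χ` is killed by `X̄ ∂̄₀`, hence is zero. Holomorphy along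
the fibre plays no role, so the lemma also applies to `L_k B`. -/
lemma IsNormalForm.eq_zero_of_mem_gaugeTrivial (hB : mulNormalBar z₀ B = 0)
    (h : Pi.single 0 B ∈ gaugeTrivial z₀) : B = 0 := by
  obtain ⟨χ, hχ, e⟩ := h
  have e0 : delBar 0 χ = B := by
    have := congrFun e 0
    rwa [Pi.single_eq_same] at this
  have : χ = 0 := eq_zero_of_mulNormalBar_delBar_eq_zero hχ (by rw [e0, hB])
  rw [← e0, this, map_zero]

lemma mulDist_zPow (k : ℕ) (T : Dist) :
    mulDist (zPow z₀ k) (contDiff_zPow z₀ k) T = (mulNormal z₀ ^ k) T := by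
  ext f
  rw [mulNormal_pow_toTest, mulDist_apply, mulTest_eq_toTest]
  rfl

lemma virasoroDist_apply (k : ℕ) (T : Dist) : virasoroDist z₀ k T =
    -(mulNormal z₀ ^ (k + 1)) (del 0 T) - ((k : ℂ) + 1) • (mulNormal z₀ ^ k) T
      - (((k : ℂ) + 1) / 2) • (mulNormal z₀ ^ k) (fibreEuler T) := by
  simp only [← mulDist_zPow]
  rfl

lemma virasoro_single (k : ℕ) (B : Dist) :
    virasoro z₀ k (Pi.single 0 B) = Pi.single 0 (virasoroDist z₀ k B) := by
  funext a
  by_cases ha : a = 0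
  · subst ha
    simp [virasoro]
  · simp [virasoro, Pi.single_eq_of_ne ha]

lemma mulNormalBar_pow_mulNormal (k : ℕ) (T : Dist) :
    mulNormalBar z₀ ((mulNormal z₀ ^ k) T) = (mulNormal z₀ ^ k) (mulNormalBar z₀ T) := by
  have h : Commute (mulNormalBar z₀ : Module.End ℂ Dist) (mulNormal z₀) :=
    LinearMap.ext fun T => mulNormalBar_mulNormal z₀ T
  exact LinearMap.congr_fun (h.pow_right k).eq T

/-- The action on a gauge-fixed field remains killed by `X̄`, so the primary conditions modulo gauge
can be read as exact equations. -/
lemma mulNormalBar_virasoroDist (k : ℕ) (T : Dist) :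
    mulNormalBar z₀ (virasoroDist z₀ k T) = virasoroDist z₀ k (mulNormalBar z₀ T) := by
  simp only [virasoroDist_apply, map_sub, map_neg, map_smul, mulNormalBar_pow_mulNormal,
    fibreEuler_apply, map_add, mulNormalBar_mulCoord, ← del_mulNormalBar]

lemma dbar_virasoroDist_mem (k : ℕ) {χ : Dist} (hχ : χ ∈ supportedOn z₀) :
    virasoroDist z₀ k χ ∈ supportedOn z₀ := by
  rw [virasoroDist_apply, fibreEuler_apply]
  have hW : ∀ T ∈ supportedOn z₀, (mulNormal z₀ : Module.End ℂ Dist) T ∈ supportedOn z₀ :=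
    fun T hT => mulNormal_mem_vanishing hT
  refine Submodule.sub_mem _ (Submodule.sub_mem _ (Submodule.neg_mem _ ?_)
    (Submodule.smul_mem _ _ ?_)) (Submodule.smul_mem _ _ ?_)
  · exact pow_apply_mem hW (del_mem_vanishing hχ 0) _
  · exact pow_apply_mem hW hχ _
  · exact pow_apply_mem hW (Submodule.add_mem _ (mulDist_mem_vanishing (del_mem_vanishing hχ 1) _ _)
      (mulDist_mem_vanishing (del_mem_vanishing hχ 2) _ _)) _

lemma delBar_virasoroDist (k : ℕ) (a : Fin 3) (T : Dist) :
    delBar a (virasoroDist z₀ k T) = virasoroDist z₀ k (delBar a T) := by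
  have h : Commute (delBar a : Module.End ℂ Dist) (mulNormal z₀) :=
    LinearMap.ext fun T => delBar_mulNormal z₀ T a
  have h' : ∀ k T, delBar a ((mulNormal z₀ ^ k) T) = (mulNormal z₀ ^ k) (delBar a T) :=
    fun k T => LinearMap.congr_fun (h.pow_right k).eq T
  simp only [virasoroDist_apply, map_sub, map_neg, map_smul, h',
    fibreEuler_apply, map_add, delBar_mulCoord, ← del_delBar_comm]

lemma virasoro_dbar (k : ℕ) (χ : Dist) :
    virasoro z₀ k (dbar χ) = dbar (virasoroDist z₀ k χ) := by
  funext a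
  rw [dbar_apply, delBar_virasoroDist]
  rfl

/-- A normal form of a primary class is an eigenvector of the Euler operator and is killed by the
normal coordinate. -/
lemma IsNormalForm.primary (hB : IsNormalForm z₀ B) {m : ℕ}
    (h₁ : virasoroDist z₀ 1 B = 0) (h₀ : virasoroDist z₀ 0 B = (-(m : ℂ) / 2) • B) :
    mulNormal z₀ B = 0 ∧ fibreEuler B = (m : ℂ) • B := by
  rw [virasoroDist_apply] at h₀ h₁
  simp only [zero_add, pow_one, pow_zero, Module.End.one_apply, Nat.cast_zero, Nat.cast_one,
    one_smul] at h₀ h₁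
  have hE : fibreEuler B = (-2 : ℂ) • mulNormal z₀ (del 0 B) - (2 : ℂ) • B + (m : ℂ) • B := by
    have : fibreEuler B = (-2 : ℂ) • ((-mulNormal z₀ (del 0 B) - B - (1 / 2 : ℂ) • fibreEuler B)
        + mulNormal z₀ (del 0 B) + B) := by module
    rw [this, h₀]
    module
  have hC : mulNormal z₀ B = 0 := by
    -- Eliminating the fibre Euler operator between the `L₀` and `L₁` equations gives `X² ∂B = m X
    -- B`, with `X` multiplication by `z - z₀` and `∂ = ∂_z`. Hence `X B` is an eigenvector of `X ∂`
    -- with eigenvalue `m + 1`, which support on the surface excludes unless `X B = 0`.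
    apply eq_zero_of_mulNormal_del (mulNormal_mem_vanishing hB.mem) (k := m + 1)
    rw [del_mulNormal_self, map_add]
    have h2 : ((mulNormal z₀ : Module.End ℂ Dist) ^ (1 + 1)) (del 0 B)
        = mulNormal z₀ (mulNormal z₀ (del 0 B)) := by
      rw [pow_succ, pow_one, Module.End.mul_apply]
    rw [h2, hE, map_add, map_sub, map_smul, map_smul, map_smul] at h₁
    have : mulNormal z₀ (mulNormal z₀ (del 0 B)) = (m : ℂ) • mulNormal z₀ B := by
      rw [← sub_eq_zero, ← h₁]
      module
    rw [this]
    push_cast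
    module
  refine ⟨hC, ?_⟩
  have h3 : mulNormal z₀ (del 0 B) = -B := by
    have := del_mulNormal_self z₀ B
    rw [hC, map_zero] at this
    exact eq_neg_of_add_eq_zero_left this.symm
  rw [hE, h3]
  module

end NormalForm

/-! ### Smooth families of test functions -/

/-- The integral is the value at `0` of the convolution of `φ` with `x ↦ G p (-x)`, so smoothness in
the parameter follows from that of convolutions. -/
lemma contDiffOn_integral_smul {P : Type*} [NormedAddCommGroup P] [NormedSpace ℝ P] {φ : ℝ → ℝ}
    (hφ : LocallyIntegrable φ) {G : P → ℝ → ℂ} {s : Set P} {k : Set ℝ} (hs : IsOpen s)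
    (hk : IsCompact k) (hzero : ∀ p x, p ∈ s → x ∉ k → G p x = 0)
    (hG : ContDiff ℝ ((⊤ : ℕ∞) : WithTop ℕ∞) fun q : P × ℝ => G q.1 q.2) :
    ContDiffOn ℝ ((⊤ : ℕ∞) : WithTop ℕ∞) (fun p => ∫ x, φ x • G p x) s := by
  have hg : ContDiff ℝ ((⊤ : ℕ∞) : WithTop ℕ∞) fun q : P × ℝ => G q.1 (-q.2) :=
    hG.comp (contDiff_fst.prodMk contDiff_snd.neg)
  have h := contDiffOn_convolution_right_with_param_comp (μ := volume) (n := ⊤)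
    (ContinuousLinearMap.lsmul ℝ ℝ) (v := fun _ : P => (0 : ℝ)) (s := s) contDiffOn_const
    (g := fun p x => G p (-x)) (k := -k) hs hk.neg (fun p x hp hx => hzero p _ hp (by simpa using hx))
    hφ hg.contDiffOn
  refine h.congr fun p _ => ?_
  simp [convolution]

lemma iteratedFDeriv_section {P : Type*} [NormedAddCommGroup P] [NormedSpace ℝ P]
    {H : P → Chart → ℂ} (hH : ContDiff ℝ ((⊤ : ℕ∞) : WithTop ℕ∞) fun q : P × Chart => H q.1 q.2)
    (i : ℕ) (t : P) (p : Chart) : iteratedFDeriv ℝ i (H t) p =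
      (iteratedFDeriv ℝ i (fun q : P × Chart => H q.1 q.2) (t, p)).compContinuousLinearMap
        fun _ => ContinuousLinearMap.inr ℝ P Chart := by
  have hg : ContDiff ℝ ((⊤ : ℕ∞) : WithTop ℕ∞)
      (fun q : P × Chart => H (q + (t, 0)).1 (q + (t, 0)).2) := by
    exact hH.comp (contDiff_id.add contDiff_const)
  have h := (ContinuousLinearMap.inr ℝ P Chart).iteratedFDeriv_comp_right hg p (i := i)
    (by exact_mod_cast le_top)
  have h2 : (fun q : P × Chart => H (q + (t, 0)).1 (q + (t, 0)).2) ∘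
      (ContinuousLinearMap.inr ℝ P Chart) = H t := by
    ext p; simp
  rw [h2, iteratedFDeriv_comp_add_right (f := fun q : P × Chart => H q.1 q.2)] at h
  rw [h]
  simp

lemma continuous_iteratedFDeriv_section {P : Type*} [NormedAddCommGroup P] [NormedSpace ℝ P]
    {H : P → Chart → ℂ} (hH : ContDiff ℝ ((⊤ : ℕ∞) : WithTop ℕ∞) fun q : P × Chart => H q.1 q.2)
    (i : ℕ) : Continuous fun q : P × Chart => iteratedFDeriv ℝ i (H q.1) q.2 := by
  simp only [iteratedFDeriv_section hH]
  have h1 := hH.continuous_iteratedFDeriv (m := i) (by exact_mod_cast le_top)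
  exact (ContinuousMultilinearMap.compContinuousLinearMapL (𝕜 := ℝ) (F := ℂ)
    (fun _ : Fin i => ContinuousLinearMap.inr ℝ P Chart)).continuous.comp h1

lemma isTest_of_section {P : Type*} [NormedAddCommGroup P] [NormedSpace ℝ P] {H : P → Chart → ℂ}
    (hH : ContDiff ℝ ((⊤ : ℕ∞) : WithTop ℕ∞) fun q : P × Chart => H q.1 q.2) {t : P}
    {K : Set Chart} (hK : IsCompact K) (h0 : ∀ p ∉ K, H t p = 0) : IsTest (H t) :=
  ⟨hH.comp (contDiff_const.prodMk contDiff_id), HasCompactSupport.intro hK h0⟩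

/-- On the common compact support, the finitely many derivatives that control `T` converge uniformly
as `t → t₀`. -/
lemma continuousAt_apply_family (T : Dist) {P : Type*} [NormedAddCommGroup P] [NormedSpace ℝ P]
    {H : P → Chart → ℂ} (hH : ContDiff ℝ ((⊤ : ℕ∞) : WithTop ℕ∞) fun q : P × Chart => H q.1 q.2)
    {t₀ : P} {K : Set Chart} (hK : IsCompact K) (h0 : ∀ᶠ t in 𝓝 t₀, ∀ p ∉ K, H t p = 0) :
    ContinuousAt (fun t => T (toTest (H t))) t₀ := by
  obtain ⟨N, C, hC, hbound⟩ := exists_bound T hK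
  rw [Metric.continuousAt_iff']
  intro ε hε
  let ε' := ε / (C + 1)
  have hε' : 0 < ε' := by positivity
  have hev : ∀ i : ℕ, ∀ᶠ t in 𝓝 t₀, ∀ p ∈ K,
      ‖iteratedFDeriv ℝ i (H t) p - iteratedFDeriv ℝ i (H t₀) p‖ < ε' := by
    intro i
    refine hK.eventually_forall_of_forall_eventually fun p _ => ?_
    have hc : Continuous fun q : P × Chart =>
        ‖iteratedFDeriv ℝ i (H q.1) q.2 - iteratedFDeriv ℝ i (H t₀) q.2‖ :=
      ((continuous_iteratedFDeriv_section hH i).sub ((continuous_iteratedFDeriv_section hH i).comp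
        (continuous_const.prodMk continuous_snd))).norm
    refine hc.continuousAt.eventually_lt continuousAt_const ?_
    simpa using hε'
  have hev' : ∀ᶠ t in 𝓝 t₀, ∀ i ∈ Finset.range (N + 1), ∀ p ∈ K,
      ‖iteratedFDeriv ℝ i (H t) p - iteratedFDeriv ℝ i (H t₀) p‖ < ε' :=
    (Filter.eventually_all_finset _).2 fun i _ => hev i
  have h00 := h0.self_of_nhds
  have ht₀ := isTest_of_section hH hK h00
  filter_upwards [h0, hev'] with t ht hder
  have htt := isTest_of_section hH hK ht
  rw [dist_eq_norm, ← map_sub, ← toTest_sub htt ht₀]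
  have hsupp : tsupport (toTest fun p => H t p - H t₀ p) ⊆ K := by
    rw [coe_toTest (htt.sub ht₀)]
    refine closure_minimal (fun p hp => ?_) hK.isClosed
    by_contra hpK
    exact hp (by simp [ht p hpK, h00 p hpK])
  have hlt : C * ε' < ε := by
    have : C * ε' = C / (C + 1) * ε := by simp only [ε']; ring
    rw [this]
    have h1 : C / (C + 1) < 1 := by rw [div_lt_one (by positivity)]; linarith
    calc C / (C + 1) * ε < 1 * ε := by gcongr
      _ = ε := one_mul ε
  refine (hbound _ hsupp ε' hε'.le fun i hi p => ?_).trans_lt hlt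
  by_cases hp : p ∈ K
  · have hadd : iteratedFDeriv ℝ i (toTest fun p => H t p - H t₀ p) p =
        iteratedFDeriv ℝ i (H t) p - iteratedFDeriv ℝ i (H t₀) p := by
      rw [coe_toTest (htt.sub ht₀)]
      have hle : (i : WithTop ℕ∞) ≤ ((⊤ : ℕ∞) : WithTop ℕ∞) := by exact_mod_cast le_top
      exact iteratedFDeriv_sub_apply (htt.contDiff.contDiffAt.of_le hle)
        (ht₀.contDiff.contDiffAt.of_le hle)
    rw [hadd]
    exact (hder i (Finset.mem_range.2 (by omega)) p hp).le
  · have : iteratedFDeriv ℝ i (toTest fun p => H t p - H t₀ p) p = 0 := by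
      by_contra hne
      exact hp (hsupp (support_iteratedFDeriv_subset i hne))
    rw [this, norm_zero]
    exact hε'.le

/-- A distribution may be differentiated along a smooth family of test functions. -/
lemma hasDerivAt_apply_family (T : Dist) {G : ℝ → Chart → ℂ}
    (hG : ContDiff ℝ ((⊤ : ℕ∞) : WithTop ℕ∞) fun q : ℝ × Chart => G q.1 q.2)
    {t₀ : ℝ} {K : Set Chart} (hK : IsCompact K) (h0 : ∀ᶠ t in 𝓝 t₀, ∀ p ∉ K, G t p = 0)
    {G' : Chart → ℂ} (hG' : ∀ p, HasDerivAt (fun t => G t p) (G' p) t₀) :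
    HasDerivAt (fun t => T (toTest (G t))) (T (toTest G')) t₀ := by
  let dG : ℝ × Chart → ℂ := fun q => fderiv ℝ (fun q : ℝ × Chart => G q.1 q.2) q (1, 0)
  have hdG : ContDiff ℝ ((⊤ : ℕ∞) : WithTop ℕ∞) dG :=
    (hG.fderiv_right (m := ((⊤ : ℕ∞) : WithTop ℕ∞)) (by simp)).clm_apply contDiff_const
  have hder : ∀ t p, HasDerivAt (fun t => G t p) (dG (t, p)) t := by
    intro t p
    have h1 : HasDerivAt (fun t : ℝ => (t, p)) ((1 : ℝ), (0 : Chart)) t :=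
      (hasDerivAt_id t).prodMk (hasDerivAt_const t p)
    exact ((hG.differentiable (by simp)) (t, p)).hasFDerivAt.comp_hasDerivAt t h1
  have hdG0 : ∀ p, dG (t₀, p) = G' p := fun p => (hder t₀ p).unique (hG' p)
  -- This bump is one on `[0, 1]`. It only makes the integrand compactly supported in `s`.
  let χ : ContDiffBump (0 : ℝ) := ⟨2, 3, two_pos, by norm_num⟩
  let φ : ℝ → ℝ := Set.indicator (Set.Ioc 0 1) 1
  have hφ : LocallyIntegrable φ :=
    (integrable_indicator_iff measurableSet_Ioc |>.2
      (by simp [Pi.one_def])).locallyIntegrable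
  -- Hadamard's lemma: `H t` is the mean of `∂G/∂t` over the segment from `t₀` to `t`, so `G t - G
  -- t₀ = (t - t₀) H t`. The difference quotient of `T (G t)` is then `T (H t)`, and continuity of
  -- this smooth family suffices.
  let H : ℝ → Chart → ℂ := fun t p => ∫ s, φ s • ((χ s : ℂ) * dG (t₀ + s * (t - t₀), p))
  have hHval : ∀ t p, H t p = ∫ s in (0 : ℝ)..1, dG (t₀ + s * (t - t₀), p) := by
    intro t p
    rw [intervalIntegral.integral_of_le zero_le_one, ← integral_indicator measurableSet_Ioc]
    refine integral_congr_ae (Filter.Eventually.of_forall fun s => ?_)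
    by_cases hs : s ∈ Set.Ioc (0 : ℝ) 1
    · have : χ s = 1 := χ.one_of_mem_closedBall (by
        rw [Metric.mem_closedBall, dist_zero_right, Real.norm_eq_abs, abs_of_pos hs.1]
        exact hs.2.trans one_le_two)
      simp [φ, hs, this]
    · simp [φ, hs]
  have hH : ContDiff ℝ ((⊤ : ℕ∞) : WithTop ℕ∞) fun q : ℝ × Chart => H q.1 q.2 := by
    rw [← contDiffOn_univ]
    refine contDiffOn_integral_smul hφ (G := fun (q : ℝ × Chart) s =>
      (χ s : ℂ) * dG (t₀ + s * (q.1 - t₀), q.2)) (k := Metric.closedBall 0 3) isOpen_univ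
      (isCompact_closedBall _ _) (fun q s _ hs => ?_) ?_
    · have : χ s = 0 := χ.zero_of_le_dist (by
        rw [Metric.mem_closedBall, not_le] at hs; exact hs.le)
      simp [this]
    · refine ContDiff.mul ?_ ?_
      · exact Complex.ofRealCLM.contDiff.comp (χ.contDiff.comp contDiff_snd)
      · refine hdG.comp ?_
        fun_prop
  have hFTC : ∀ t p, G t p - G t₀ p = ((t - t₀ : ℝ) : ℂ) * H t p := by
    intro t p
    have hline : ∀ s : ℝ, HasDerivAt (fun s : ℝ => G (t₀ + s * (t - t₀)) p)
        ((t - t₀) • dG (t₀ + s * (t - t₀), p)) s := by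
      intro s
      have h1 : HasDerivAt (fun s : ℝ => t₀ + s * (t - t₀)) (t - t₀) s := by
        simpa using ((hasDerivAt_id s).mul_const (t - t₀)).const_add t₀
      exact (hder _ p).scomp s h1
    have hline' : Continuous fun s : ℝ => dG (t₀ + s * (t - t₀), p) :=
      hdG.continuous.comp (by fun_prop)
    have hcont : Continuous fun s : ℝ => (t - t₀) • dG (t₀ + s * (t - t₀), p) :=
      by fun_prop
    have h := intervalIntegral.integral_eq_sub_of_hasDerivAt (a := 0) (b := 1)
      (fun s _ => hline s) (hcont.intervalIntegrable _ _)
    rw [intervalIntegral.integral_smul, ← hHval, Complex.real_smul] at h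
    rw [h]
    simp
  have hHt₀ : H t₀ = G' := by
    ext p
    rw [hHval]
    simp [hdG0]
  obtain ⟨r, hr, hball⟩ := Metric.eventually_nhds_iff_ball.1 h0
  have hH0 : ∀ t ∈ Metric.ball t₀ r, ∀ p ∉ K, H t p = 0 := by
    intro t ht p hp
    have hz : ∀ t' ∈ Metric.ball t₀ r, dG (t', p) = 0 := by
      intro t' ht'
      refine (hder t' p).unique ((hasDerivAt_const t' (0 : ℂ)).congr_of_eventuallyEq ?_)
      filter_upwards [Metric.isOpen_ball.mem_nhds ht'] with t'' ht''
      exact hball t'' ht'' p hp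
    rw [hHval]
    rw [intervalIntegral.integral_congr (g := fun _ => 0) (fun s hs => ?_)]
    · simp
    · rw [Set.uIcc_of_le zero_le_one] at hs
      apply hz
      rw [Metric.mem_ball, Real.dist_eq] at ht ⊢
      rw [add_sub_cancel_left, abs_mul, abs_of_nonneg hs.1]
      calc s * |t - t₀| ≤ 1 * |t - t₀| := by gcongr; exact hs.2
        _ < r := by rwa [one_mul]
  have hHev : ∀ᶠ t in 𝓝 t₀, ∀ p ∉ K, H t p = 0 := by
    filter_upwards [Metric.ball_mem_nhds t₀ hr] with t ht using hH0 t ht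
  have hcont := continuousAt_apply_family T hH hK hHev
  rw [hasDerivAt_iff_tendsto_slope]
  have hlim : Filter.Tendsto (fun t => T (toTest (H t))) (𝓝[≠] t₀) (𝓝 (T (toTest G'))) := by
    have := hcont.tendsto.mono_left (nhdsWithin_le_nhds (s := {t₀}ᶜ))
    rwa [hHt₀] at this
  refine hlim.congr' ?_
  filter_upwards [self_mem_nhdsWithin, nhdsWithin_le_nhds (Metric.ball_mem_nhds t₀ hr)]
    with t hne ht
  have hGt := isTest_of_section hG hK (hball t ht)
  have hGt₀ := isTest_of_section hG hK (hball t₀ (Metric.mem_ball_self hr))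
  have hHt := isTest_of_section hH hK (hH0 t ht)
  have hne' : ((t - t₀ : ℝ) : ℂ) ≠ 0 := by exact_mod_cast sub_ne_zero.2 hne
  have e : T (toTest (G t)) - T (toTest (G t₀)) = ((t - t₀ : ℝ) : ℂ) * T (toTest (H t)) := by
    rw [← map_sub, ← toTest_sub hGt hGt₀, ← smul_eq_mul, ← map_smul, ← toTest_const_mul _ hHt]
    simp only [hFTC]
  rw [slope_def_module, e, Complex.real_smul]
  push_cast at hne' ⊢
  field_simp

/-! ### Distributions without derivatives transverse to a surface -/

/-- A smooth cutoff function on `ℂ`. -/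
def cutoff (z : ℂ) : ℂ := ((⟨1, 2, one_pos, one_lt_two⟩ : ContDiffBump (0 : ℂ)) z : ℝ)

lemma contDiff_cutoff : ContDiff ℝ ((⊤ : ℕ∞) : WithTop ℕ∞) cutoff :=
  Complex.ofRealCLM.contDiff.comp (ContDiffBump.contDiff _)

lemma cutoff_eq_one {z : ℂ} (hz : ‖z‖ ≤ 1) : cutoff z = 1 := by
  rw [cutoff, ContDiffBump.one_of_mem_closedBall _ (by simpa using hz), Complex.ofReal_one]

lemma cutoff_eq_zero {z : ℂ} (hz : 2 ≤ ‖z‖) : cutoff z = 0 := by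
  rw [cutoff, ContDiffBump.zero_of_le_dist _ (by simpa using hz), Complex.ofReal_zero]

lemma IsTest.exists_radius {f : Chart → ℂ} (hf : IsTest f) :
    ∃ R : ℝ, 0 ≤ R ∧ ∀ p, f p ≠ 0 → ‖p‖ ≤ R := by
  obtain ⟨R, hR⟩ := hf.compact.isBounded.subset_closedBall (0 : Chart)
  refine ⟨max R 0, le_max_right _ _, fun p hp => ?_⟩
  have := hR (subset_tsupport f hp)
  rw [mem_closedBall_zero_iff] at this
  exact this.trans (le_max_left _ _)

lemma chart_norm_le {p : Chart} {r : ℝ} (h0 : ‖p 0‖ ≤ r) (h1 : ‖p 1‖ ≤ r) (h2 : ‖p 2‖ ≤ r) :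
    ‖p‖ ≤ r := by
  rw [pi_norm_le_iff_of_nonneg ((norm_nonneg _).trans h0)]
  intro a
  fin_cases a
  exacts [h0, h1, h2]

/-- The contraction of the chart towards the surface `p 0 = z₀`. -/
def squeeze (z₀ : ℂ) (t : ℝ) (p : Chart) : Chart := ![z₀ + t * (p 0 - z₀), p 1, p 2]

lemma contDiff_squeeze (z₀ : ℂ) :
    ContDiff ℝ ((⊤ : ℕ∞) : WithTop ℕ∞) fun q : ℝ × Chart => squeeze z₀ q.1 q.2 := by
  have h : ContDiff ℝ ((⊤ : ℕ∞) : WithTop ℕ∞) fun t : ℝ => (t : ℂ) := Complex.ofRealCLM.contDiff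
  have hc (a : Fin 3) : ContDiff ℝ ((⊤ : ℕ∞) : WithTop ℕ∞) fun q : ℝ × Chart => q.2 a := by
    fun_prop
  unfold squeeze
  rw [contDiff_pi]
  intro a
  fin_cases a
  · exact contDiff_const.add ((h.comp contDiff_fst).mul (((contDiff_coord 0).comp
      contDiff_snd).sub contDiff_const))
  · exact hc 1
  · exact hc 2

lemma contDiff_cutoff_mul_squeeze (z₀ : ℂ) {g : Chart → ℂ} (hg : IsTest g) :
    ContDiff ℝ ((⊤ : ℕ∞) : WithTop ℕ∞) fun q : ℝ × Chart =>
      cutoff (q.2 0 - z₀) * g (squeeze z₀ q.1 q.2) :=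
  (contDiff_cutoff.comp ((contDiff_normal z₀).comp contDiff_snd)).mul
    (hg.contDiff.comp (contDiff_squeeze z₀))

lemma exists_compact_cutoff_mul_squeeze (z₀ : ℂ) {g : Chart → ℂ} (hg : IsTest g) :
    ∃ K : Set Chart, IsCompact K ∧ ∀ (t : ℝ), ∀ p ∉ K,
      cutoff (p 0 - z₀) * g (squeeze z₀ t p) = 0 := by
  obtain ⟨R, hR, hg0⟩ := hg.exists_radius
  refine ⟨Metric.closedBall 0 (max R (‖z₀‖ + 2)), isCompact_closedBall _ _, fun t p hp => ?_⟩
  by_contra hne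
  have h1 : ‖p 0 - z₀‖ < 2 := by
    by_contra h
    exact hne (by rw [cutoff_eq_zero (not_lt.1 h), zero_mul])
  have h2 := hg0 _ (right_ne_zero_of_mul hne)
  apply hp
  rw [mem_closedBall_zero_iff]
  refine chart_norm_le ?_ ?_ ?_
  · calc ‖p 0‖ = ‖z₀ + (p 0 - z₀)‖ := by ring_nf
      _ ≤ ‖z₀‖ + ‖p 0 - z₀‖ := norm_add_le _ _
      _ ≤ ‖z₀‖ + 2 := by gcongr
      _ ≤ _ := le_max_right _ _
  · exact ((norm_le_pi_norm (squeeze z₀ t p) 1).trans h2).trans (le_max_left _ _)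
  · exact ((norm_le_pi_norm (squeeze z₀ t p) 2).trans h2).trans (le_max_left _ _)

lemma isTest_cutoff_mul_squeeze (z₀ : ℂ) {g : Chart → ℂ} (hg : IsTest g) (t : ℝ) :
    IsTest fun p => cutoff (p 0 - z₀) * g (squeeze z₀ t p) := by
  obtain ⟨K, hK, h0⟩ := exists_compact_cutoff_mul_squeeze z₀ hg
  exact isTest_of_section (H := fun t p => cutoff (p 0 - z₀) * g (squeeze z₀ t p))
    (contDiff_cutoff_mul_squeeze z₀ hg) hK (h0 t)

/-- The distributions that are multiples of the delta function transversely to `p 0 = z₀`. -/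
structure IsTransverse (z₀ : ℂ) (D : Dist) : Prop where
  mem : D ∈ supportedOn z₀
  mulNormal_eq : mulNormal z₀ D = 0
  mulNormalBar_eq : mulNormalBar z₀ D = 0

section IsTransverse

variable {z₀ : ℂ} {D : Dist}

lemma eq_of_mem_supportedOn (hD : D ∈ supportedOn z₀) {f g : Chart → ℂ} (hf : IsTest f)
    (hg : IsTest g) (h : f =ᶠ[𝓝ˢ {p | p 0 = z₀}] g) : D (toTest f) = D (toTest g) := by
  rw [← sub_eq_zero, ← map_sub, ← toTest_sub hf hg]
  refine hD _ fun p hp hp0 => ?_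
  rw [coe_toTest (hf.sub hg)] at hp
  refine notMem_tsupport_iff_eventuallyEq.2 ?_ hp
  have h2 : f =ᶠ[𝓝 p] g :=
    h.filter_mono (nhds_le_nhdsSet (s := {p : Chart | p 0 = z₀}) hp0)
  filter_upwards [h2] with q hq
  simp [hq]

/-- Contract `f` onto its values on the surface by `z ↦ z₀ + t (z - z₀)`. The `t`-derivative is a
combination of `z - z₀` and its conjugate with test coefficients, hence is killed by `D`. So the
pairing is the same at `t = 1`, where it is `D f`, and at `t = 0`, where the function is zero. -/
lemma IsTransverse.apply_eq_zero (hD : IsTransverse z₀ D) {f : Chart → ℂ} (hf : IsTest f)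
    (h0 : ∀ p : Chart, p 0 = z₀ → f p = 0) : D (toTest f) = 0 := by
  let G : ℝ → Chart → ℂ := fun t p => cutoff (p 0 - z₀) * f (squeeze z₀ t p)
  obtain ⟨K, hK, hG0⟩ := exists_compact_cutoff_mul_squeeze z₀ hf
  let a : Chart → ℂ := fun p =>
    1 / 2 * (fderiv ℝ f p (Pi.single 0 1) - Complex.I * fderiv ℝ f p (Pi.single 0 Complex.I))
  let b : Chart → ℂ := fun p =>
    1 / 2 * (fderiv ℝ f p (Pi.single 0 1) + Complex.I * fderiv ℝ f p (Pi.single 0 Complex.I))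
  have ha : IsTest a := IsTest.mul_left contDiff_const
    ((hf.fderiv _).sub (IsTest.mul_left contDiff_const (hf.fderiv _)))
  have hb : IsTest b := IsTest.mul_left contDiff_const
    ((hf.fderiv _).add (IsTest.mul_left contDiff_const (hf.fderiv _)))
  let A : ℝ → Chart → ℂ := fun t p => cutoff (p 0 - z₀) * a (squeeze z₀ t p)
  let B : ℝ → Chart → ℂ := fun t p => cutoff (p 0 - z₀) * b (squeeze z₀ t p)
  have hA : ∀ t, IsTest (A t) := isTest_cutoff_mul_squeeze z₀ ha
  have hB : ∀ t, IsTest (B t) := isTest_cutoff_mul_squeeze z₀ hb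
  have hder : ∀ t p, HasDerivAt (fun t => G t p)
      ((p 0 - z₀) * A t p + conj (p 0 - z₀) * B t p) t := by
    intro t p
    have h1 : HasDerivAt (fun t : ℝ => squeeze z₀ t p) (Pi.single 0 (p 0 - z₀)) t := by
      rw [hasDerivAt_pi]
      intro i
      fin_cases i
      · simpa [squeeze] using ((Complex.ofRealCLM.hasDerivAt (x := t)).mul_const
          (p 0 - z₀)).const_add z₀
      · simpa [squeeze] using hasDerivAt_const t (p 1)
      · simpa [squeeze] using hasDerivAt_const t (p 2)
    have h2 := ((hf.contDiff.differentiable (by simp)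
      (squeeze z₀ t p)).hasFDerivAt.comp_hasDerivAt t h1).const_mul (cutoff (p 0 - z₀))
    refine h2.congr_deriv ?_
    have hw : (Pi.single 0 (p 0 - z₀) : Chart) = (p 0 - z₀).re • (Pi.single 0 1 : Chart)
        + (p 0 - z₀).im • (Pi.single 0 Complex.I : Chart) := by
      funext i
      by_cases hi : i = 0
      · subst hi
        simp only [Pi.add_apply, Pi.smul_apply, Pi.single_eq_same, Complex.real_smul, mul_one]
        exact (Complex.re_add_im _).symm
      · simp [hi]
    have e1 : ∀ w x y : ℂ, (w.re : ℂ) * x + (w.im : ℂ) * y =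
        w * (1 / 2 * (x - Complex.I * y)) + conj w * (1 / 2 * (x + Complex.I * y)) := by
      intro w x y
      conv_rhs => rw [← Complex.re_add_im w]
      simp only [map_add, map_mul, Complex.conj_ofReal, Complex.conj_I]
      linear_combination ((w.im : ℂ) * y) * Complex.I_sq
    rw [hw, map_add, map_smul, map_smul, Complex.real_smul, Complex.real_smul, e1]
    simp only [A, B, a, b]
    ring
  have hder' : ∀ t, HasDerivAt (fun t => D (toTest (G t))) 0 t := by
    intro t
    have h := hasDerivAt_apply_family D (contDiff_cutoff_mul_squeeze z₀ hf) hK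
      (Filter.Eventually.of_forall hG0) (hder t)
    refine h.congr_deriv ?_
    rw [toTest_add (IsTest.mul_left (contDiff_normal z₀) (hA t))
      (IsTest.mul_left (contDiff_normalBar z₀) (hB t)), map_add,
      ← mulDist_toTest _ (contDiff_normal z₀) D (hA t),
      ← mulDist_toTest _ (contDiff_normalBar z₀) D (hB t)]
    have e1 : mulDist (fun p => p 0 - z₀) (contDiff_normal z₀) D = 0 := hD.mulNormal_eq
    have e2 : mulDist (fun p => conj (p 0 - z₀)) (contDiff_normalBar z₀) D = 0 :=
      hD.mulNormalBar_eq
    rw [e1, e2]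
    simp
  have hconst := is_const_of_deriv_eq_zero (fun t => (hder' t).differentiableAt)
    (fun t => (hder' t).deriv) 1 0
  have hG0' : toTest (G 0) = 0 := by
    have : G 0 = fun _ => 0 := by
      funext p
      simp only [G]
      rw [h0 _ (by simp [squeeze]), mul_zero]
    rw [this]
    exact toTest_coe 0
  rw [hG0', map_zero] at hconst
  rw [← hconst]
  refine eq_of_mem_supportedOn hD.mem hf (isTest_cutoff_mul_squeeze z₀ hf 1) ?_
  have hopen : {p : Chart | ‖p 0 - z₀‖ < 1} ∈ 𝓝ˢ {p : Chart | p 0 = z₀} := by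
    refine (IsOpen.mem_nhdsSet (isOpen_lt (by fun_prop) continuous_const)).2 fun p hp => ?_
    have hp' : p 0 = z₀ := hp
    simp [hp']
  filter_upwards [hopen] with p hp
  have hp' : ‖p 0 - z₀‖ < 1 := hp
  simp only [G]
  rw [cutoff_eq_one hp'.le, one_mul]
  congr 1
  funext i
  fin_cases i <;> simp [squeeze]

lemma IsTransverse.congr (hD : IsTransverse z₀ D) {f g : Chart → ℂ} (hf : IsTest f)
    (hg : IsTest g) (h0 : ∀ p : Chart, p 0 = z₀ → f p = g p) :
    D (toTest f) = D (toTest g) := by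
  rw [← sub_eq_zero, ← map_sub, ← toTest_sub hf hg]
  exact hD.apply_eq_zero (hf.sub hg) fun p hp => by rw [h0 p hp, sub_self]

end IsTransverse

/-! ### Translation and homogeneity -/

/-- The translate of `g` by `ζ` in the direction of the coordinate `p j`. -/
def translate (j : Fin 3) (ζ : ℂ) (g : Chart → ℂ) : Chart → ℂ := fun p => g (p - Pi.single j ζ)

lemma contDiff_single (j : Fin 3) :
    ContDiff ℝ ((⊤ : ℕ∞) : WithTop ℕ∞) fun ζ : ℂ => (Pi.single j ζ : Chart) := by
  rw [contDiff_pi]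
  intro i
  by_cases h : i = j
  · subst h
    simp only [Pi.single_eq_same]
    exact contDiff_id
  · simpa [h] using contDiff_const

lemma contDiff_translate (j : Fin 3) {g : Chart → ℂ} (hg : IsTest g) :
    ContDiff ℝ ((⊤ : ℕ∞) : WithTop ℕ∞) fun q : ℂ × Chart => translate j q.1 g q.2 :=
  hg.contDiff.comp (contDiff_snd.sub ((contDiff_single j).comp contDiff_fst))

lemma norm_single_le (j : Fin 3) (ζ : ℂ) : ‖(Pi.single j ζ : Chart)‖ ≤ ‖ζ‖ := by
  rw [Pi.norm_single]

lemma translate_eq_zero (j : Fin 3) {g : Chart → ℂ} {R : ℝ} (hR : ∀ p, g p ≠ 0 → ‖p‖ ≤ R)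
    {ζ : ℂ} {M : ℝ} (hM : ‖ζ‖ ≤ M) {p : Chart} (hp : p ∉ Metric.closedBall (0 : Chart) (R + M)) :
    translate j ζ g p = 0 := by
  by_contra hne
  apply hp
  rw [mem_closedBall_zero_iff]
  calc ‖p‖ = ‖(p - Pi.single j ζ) + Pi.single j ζ‖ := by rw [sub_add_cancel]
    _ ≤ ‖p - Pi.single j ζ‖ + ‖(Pi.single j ζ : Chart)‖ := norm_add_le _ _
    _ ≤ R + M := add_le_add (hR _ hne) ((norm_single_le j ζ).trans hM)

lemma isTest_translate (j : Fin 3) {g : Chart → ℂ} (hg : IsTest g) (ζ : ℂ) :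
    IsTest (translate j ζ g) := by
  obtain ⟨R, -, hR⟩ := hg.exists_radius
  exact isTest_of_section (H := fun ζ => translate j ζ g) (contDiff_translate j hg) (isCompact_closedBall _ _)
    (fun p hp => translate_eq_zero j hR le_rfl hp)

lemma continuous_apply_translate (T : Dist) (j : Fin 3) {g : Chart → ℂ} (hg : IsTest g) :
    Continuous fun ζ => T (toTest (translate j ζ g)) := by
  obtain ⟨R, -, hR⟩ := hg.exists_radius
  rw [continuous_iff_continuousAt]
  intro ζ₀
  refine continuousAt_apply_family T (H := fun ζ => translate j ζ g) (contDiff_translate j hg)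
    (isCompact_closedBall (0 : Chart) (R + (‖ζ₀‖ + 1))) ?_
  filter_upwards [Metric.ball_mem_nhds ζ₀ one_pos] with ζ hζ p hp
  refine translate_eq_zero j hR ?_ hp
  rw [mem_ball_iff_norm] at hζ
  calc ‖ζ‖ = ‖ζ₀ + (ζ - ζ₀)‖ := by ring_nf
    _ ≤ ‖ζ₀‖ + ‖ζ - ζ₀‖ := norm_add_le _ _
    _ ≤ ‖ζ₀‖ + 1 := by gcongr

section Holomorphic

variable {T : Dist} {j : Fin 3}

lemma derivDist_add_smul (a b : ℝ) (v w : Chart) (T : Dist) :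
    derivDist (a • v + b • w) T = (a : ℂ) • derivDist v T + (b : ℂ) • derivDist w T := by
  ext f
  have : (TestFunction.lineDerivCLM ℂ (a • v + b • w) f : Test)
      = (a : ℂ) • (TestFunction.lineDerivCLM ℂ v f : Test) + (b : ℂ) • (TestFunction.lineDerivCLM ℂ w f : Test) := by
    ext p
    have e : ∀ (x y : Test) (p : Chart), ((a : ℂ) • x + (b : ℂ) • y) p = a * x p + b * y p :=
      fun _ _ _ => rfl
    rw [e, lineDeriv_apply, lineDeriv_apply, lineDeriv_apply]
    simp
  rw [derivDist_apply, this]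
  simp only [derivDist_apply, map_add, map_smul, add_apply, smul_apply, smul_eq_mul]
  ring

lemma dist_smul_zero (c : ℂ) : c • (0 : Dist) = 0 := by
  ext f
  exact mul_zero c

lemma derivDist_I (hT : delBar j T = 0) :
    derivDist (Pi.single j Complex.I) T = Complex.I • derivDist (Pi.single j 1) T := by
  rw [delBar_apply] at hT
  have h : derivDist (Pi.single j 1) T + Complex.I • derivDist (Pi.single j Complex.I) T = 0 := by
    have e : derivDist (Pi.single j 1) T + Complex.I • derivDist (Pi.single j Complex.I) T
        = (2 : ℂ) • ((1 / 2 : ℂ) • (derivDist (Pi.single j 1) T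
          + Complex.I • derivDist (Pi.single j Complex.I) T)) := by module
    rw [e, hT, dist_smul_zero]
  have h2 : derivDist (Pi.single j 1) T = -(Complex.I • derivDist (Pi.single j Complex.I) T) :=
    eq_neg_of_add_eq_zero_left h
  rw [h2]
  ext f
  simp only [neg_apply, smul_apply, smul_eq_mul]
  linear_combination (derivDist (Pi.single j Complex.I) T f) * Complex.I_sq

lemma derivDist_one (hT : delBar j T = 0) : derivDist (Pi.single j 1) T = del j T := by
  rw [del_apply, derivDist_I hT]
  ext f
  simp only [sub_apply, smul_apply, smul_eq_mul]
  linear_combination (1 / 2 * derivDist (Pi.single j 1) T f) * Complex.I_sq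

lemma derivDist_single (hT : delBar j T = 0) (η : ℂ) :
    derivDist (Pi.single j η) T = η • del j T := by
  have : (Pi.single j η : Chart) = η.re • (Pi.single j 1 : Chart)
      + η.im • (Pi.single j Complex.I : Chart) := by
    funext i
    by_cases hi : i = j
    · subst hi
      simp only [Pi.add_apply, Pi.smul_apply, Pi.single_eq_same, Complex.real_smul, mul_one]
      exact (Complex.re_add_im _).symm
    · simp [hi]
  rw [this, derivDist_add_smul, derivDist_I hT, derivDist_one hT]
  conv_rhs => rw [← Complex.re_add_im η]
  module

lemma hasDerivAt_apply_translate_line (hT : delBar j T = 0) {g : Chart → ℂ} (hg : IsTest g)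
    (ζ η : ℂ) (s : ℝ) :
    HasDerivAt (fun s : ℝ => T (toTest (translate j (ζ + s * η) g)))
      (η * del j T (toTest (translate j (ζ + s * η) g))) s := by
  obtain ⟨R, -, hR⟩ := hg.exists_radius
  have hline : ContDiff ℝ ((⊤ : ℕ∞) : WithTop ℕ∞) fun s : ℝ => ζ + s * η :=
    contDiff_const.add (Complex.ofRealCLM.contDiff.mul contDiff_const)
  have hsm : ContDiff ℝ ((⊤ : ℕ∞) : WithTop ℕ∞) fun q : ℝ × Chart =>
      translate j (ζ + q.1 * η) g q.2 :=
    (contDiff_translate j hg).comp ((hline.comp contDiff_fst).prodMk contDiff_snd)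
  have ht := isTest_translate j hg (ζ + s * η)
  have h := hasDerivAt_apply_family T (G := fun s : ℝ => translate j (ζ + s * η) g) (t₀ := s) hsm
    (isCompact_closedBall (0 : Chart) (R + (‖ζ‖ + (|s| + 1) * ‖η‖))) ?_
    (G' := fun p => -fderiv ℝ (translate j (ζ + s * η) g) p (Pi.single j η)) ?_
  · refine h.congr_deriv ?_
    have h1 : derivDist (Pi.single j η) T (toTest (translate j (ζ + s * η) g))
        = η * del j T (toTest (translate j (ζ + s * η) g)) := by
      rw [derivDist_single hT]; rfl
    rw [← h1, derivDist_toTest _ _ ht]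
    have e := congrArg T (toTest_const_mul (-1) (ht.fderiv (Pi.single j η)))
    rw [map_smul, smul_eq_mul, neg_one_mul] at e
    simpa only [neg_one_mul] using e
  · filter_upwards [Metric.ball_mem_nhds s one_pos] with t htt p hp
    refine translate_eq_zero j hR ?_ hp
    rw [Metric.mem_ball, Real.dist_eq] at htt
    have h2 : |t| ≤ |s| + 1 := by
      calc |t| = |s + (t - s)| := by ring_nf
        _ ≤ |s| + |t - s| := abs_add_le _ _
        _ ≤ |s| + 1 := by gcongr
    calc ‖ζ + t * η‖ ≤ ‖ζ‖ + ‖(t : ℂ) * η‖ := norm_add_le _ _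
      _ = ‖ζ‖ + |t| * ‖η‖ := by rw [norm_mul, Complex.norm_real, Real.norm_eq_abs]
      _ ≤ _ := by gcongr
  · intro p
    have h1 : HasDerivAt (fun t : ℝ => p - (Pi.single j (ζ + t * η) : Chart))
        (-(Pi.single j η : Chart)) s := by
      refine HasDerivAt.const_sub p ?_
      rw [hasDerivAt_pi]
      intro i
      by_cases hi : i = j
      · subst hi
        simpa using ((Complex.ofRealCLM.hasDerivAt (x := s)).mul_const η).const_add ζ
      · simpa [hi] using hasDerivAt_const s (0 : ℂ)
    have h2 := (hg.contDiff.differentiable (by simp)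
      (p - (Pi.single j (ζ + s * η) : Chart))).hasFDerivAt.comp_hasDerivAt s h1
    refine h2.congr_deriv ?_
    rw [map_neg]
    congr 1
    unfold translate
    rw [fderiv_comp_sub (f := g)]

/-- Translating a test function in a holomorphic direction of a distribution is holomorphic. -/
lemma hasDerivAt_apply_translate (hT : delBar j T = 0) {g : Chart → ℂ} (hg : IsTest g) (ζ₀ : ℂ) :
    HasDerivAt (fun ζ => T (toTest (translate j ζ g)))
      (del j T (toTest (translate j ζ₀ g))) ζ₀ := by
  rw [hasDerivAt_iff_isLittleO, Asymptotics.isLittleO_iff]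
  intro ε hε
  have hcont := (continuous_apply_translate (del j T) j hg).continuousAt (x := ζ₀)
  obtain ⟨r, hr, hball⟩ := Metric.continuousAt_iff.1 hcont ε hε
  filter_upwards [Metric.ball_mem_nhds ζ₀ hr] with ζ hζ
  rw [mem_ball_iff_norm] at hζ
  -- Real derivatives along segments are known and depend complex-linearly on the direction. The
  -- mean value inequality on `[0, 1]`, with continuity of the candidate derivative, upgrades them
  -- to a complex derivative.
  have h := norm_image_sub_le_of_norm_deriv_le_segment_01'
    (f := fun s : ℝ => T (toTest (translate j (ζ₀ + s * (ζ - ζ₀)) g))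
      - s * ((ζ - ζ₀) * del j T (toTest (translate j ζ₀ g))))
    (f' := fun s : ℝ => (ζ - ζ₀) * del j T (toTest (translate j (ζ₀ + s * (ζ - ζ₀)) g))
      - (ζ - ζ₀) * del j T (toTest (translate j ζ₀ g))) (C := ε * ‖ζ - ζ₀‖)
    (fun s _ => ?_) (fun s hs => ?_)
  · simp only [Complex.ofReal_one, one_mul, Complex.ofReal_zero, zero_mul, add_zero, sub_zero,
      add_sub_cancel] at h
    rw [smul_eq_mul]
    convert h using 2
    ring
  · refine HasDerivAt.hasDerivWithinAt (HasDerivAt.sub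
      (hasDerivAt_apply_translate_line hT hg ζ₀ (ζ - ζ₀) s) ?_)
    simpa using (Complex.ofRealCLM.hasDerivAt (x := s)).mul_const
      ((ζ - ζ₀) * del j T (toTest (translate j ζ₀ g)))
  · rw [← mul_sub, norm_mul, mul_comm]
    refine mul_le_mul_of_nonneg_right ?_ (norm_nonneg _)
    have hin : dist (ζ₀ + s * (ζ - ζ₀)) ζ₀ < r := by
      rw [dist_eq_norm, add_sub_cancel_left, norm_mul, Complex.norm_real, Real.norm_eq_abs,
        abs_of_nonneg hs.1]
      calc s * ‖ζ - ζ₀‖ ≤ 1 * ‖ζ - ζ₀‖ := by gcongr; exact hs.2.le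
        _ < r := by rwa [one_mul]
    have := hball hin
    rw [dist_eq_norm] at this
    exact this.le

lemma delBar_del_pow (hT : delBar j T = 0) (n : ℕ) :
    delBar j (((del j : Module.End ℂ Dist) ^ n) T) = 0 := by
  induction n with
  | zero => simpa
  | succ n ih => rw [pow_succ', Module.End.mul_apply, ← del_delBar_comm, ih, map_zero]

lemma iteratedDeriv_apply_translate (hT : delBar j T = 0) {g : Chart → ℂ} (hg : IsTest g) (n : ℕ) :
    iteratedDeriv n (fun ζ => T (toTest (translate j ζ g))) =
      fun ζ => ((del j : Module.End ℂ Dist) ^ n) T (toTest (translate j ζ g)) := by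
  induction n with
  | zero => simp
  | succ n ih =>
    rw [iteratedDeriv_succ, ih, pow_succ']
    funext ζ
    exact (hasDerivAt_apply_translate (delBar_del_pow hT n) hg ζ).deriv

/-- Integration by parts of the real radial field in one complex coordinate. Its real divergence
contributes the `2`, and for a holomorphic `T` the radial derivative is `p_j ∂_j`. -/
lemma apply_fderiv_single (hT : delBar j T = 0) {f : Chart → ℂ} (hf : IsTest f) :
    T (toTest fun p => fderiv ℝ f p (Pi.single j (p j))) =
      -(mulCoord j (del j T) (toTest f) + 2 * T (toTest f)) := by
  have hre : ContDiff ℝ ((⊤ : ℕ∞) : WithTop ℕ∞) fun p : Chart => ((p j).re : ℂ) :=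
    Complex.ofRealCLM.contDiff.comp (Complex.reCLM.contDiff.comp (contDiff_coord j))
  have him : ContDiff ℝ ((⊤ : ℕ∞) : WithTop ℕ∞) fun p : Chart => ((p j).im : ℂ) :=
    Complex.ofRealCLM.contDiff.comp (Complex.imCLM.contDiff.comp (contDiff_coord j))
  have hcoord : ∀ p : Chart, HasFDerivAt (fun p : Chart => p j)
      (ContinuousLinearMap.proj (R := ℝ) (φ := fun _ : Fin 3 => ℂ) j) p := fun p =>
    (ContinuousLinearMap.proj (R := ℝ) (φ := fun _ : Fin 3 => ℂ) j).hasFDerivAt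
  have hre' : ∀ p, fderiv ℝ (fun p : Chart => ((p j).re : ℂ)) p (Pi.single j 1) = 1 := by
    intro p
    have h := (Complex.ofRealCLM.hasFDerivAt (x := (p j).re)).comp p
      ((Complex.reCLM.hasFDerivAt (x := p j)).comp p (hcoord p))
    have h' : HasFDerivAt (fun p : Chart => ((p j).re : ℂ)) _ p := h
    rw [h'.fderiv]
    simp
  have him' : ∀ p, fderiv ℝ (fun p : Chart => ((p j).im : ℂ)) p (Pi.single j Complex.I) = 1 := by
    intro p
    have h := (Complex.ofRealCLM.hasFDerivAt (x := (p j).im)).comp p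
      ((Complex.imCLM.hasFDerivAt (x := p j)).comp p (hcoord p))
    have h' : HasFDerivAt (fun p : Chart => ((p j).im : ℂ)) _ p := h
    rw [h'.fderiv]
    simp
  have hsplit : (fun p => fderiv ℝ f p (Pi.single j (p j))) = fun p =>
      ((p j).re : ℂ) * fderiv ℝ f p (Pi.single j 1)
        + ((p j).im : ℂ) * fderiv ℝ f p (Pi.single j Complex.I) := by
    funext p
    have : (Pi.single j (p j) : Chart) = (p j).re • (Pi.single j 1 : Chart)
        + (p j).im • (Pi.single j Complex.I : Chart) := by
      funext i
      by_cases hi : i = j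
      · subst hi
        simp only [Pi.add_apply, Pi.smul_apply, Pi.single_eq_same, Complex.real_smul, mul_one]
        exact (Complex.re_add_im _).symm
      · simp [hi]
    rw [this, map_add, map_smul, map_smul, Complex.real_smul, Complex.real_smul]
  rw [hsplit, toTest_add (IsTest.mul_left hre (hf.fderiv _)) (IsTest.mul_left him (hf.fderiv _)),
    map_add, ← mulDist_toTest _ hre T (hf.fderiv _), ← mulDist_toTest _ him T (hf.fderiv _),
    ← neg_eq_iff_eq_neg.2 (derivDist_toTest (Pi.single j 1) (mulDist _ hre T) hf),
    ← neg_eq_iff_eq_neg.2 (derivDist_toTest (Pi.single j Complex.I) (mulDist _ him T) hf),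
    derivDist_mulDist hre', derivDist_mulDist him', derivDist_I hT, derivDist_one hT, mulCoord]
  simp only [map_smul, add_apply, smul_apply, smul_eq_mul, mulDist_toTest _ _ _ hf]
  have e : (fun p : Chart => p j * f p) = fun p =>
      ((p j).re : ℂ) * f p + Complex.I * (((p j).im : ℂ) * f p) := by
    funext p
    conv_lhs => rw [← Complex.re_add_im (p j)]
    ring
  rw [e, toTest_add (IsTest.mul_left hre hf) (IsTest.mul_left contDiff_const (IsTest.mul_left him hf)),
    toTest_const_mul _ (IsTest.mul_left him hf), map_add, map_smul, smul_eq_mul]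
  ring

end Holomorphic

/-! ### Homogeneous distributions -/

/-- The dilation of the fibre coordinates. -/
def dilate (r : ℝ) : Chart →L[ℝ] Chart :=
  ContinuousLinearMap.pi fun i =>
    (if i = 0 then 1 else r) • ContinuousLinearMap.proj (R := ℝ) (φ := fun _ : Fin 3 => ℂ) i

lemma dilate_apply (r : ℝ) (p : Chart) (i : Fin 3) :
    dilate r p i = (if i = 0 then 1 else r : ℝ) * p i := by
  rw [← Complex.real_smul]
  rfl

lemma norm_dilate_le {r : ℝ} (hr : 1 ≤ r) : ‖dilate r‖ ≤ r := by
  refine ContinuousLinearMap.opNorm_le_bound _ (zero_le_one.trans hr) fun p => ?_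
  rw [pi_norm_le_iff_of_nonneg (by positivity)]
  intro i
  rw [dilate_apply, norm_mul, Complex.norm_real, Real.norm_eq_abs]
  refine mul_le_mul ?_ (norm_le_pi_norm p i) (norm_nonneg _) (zero_le_one.trans hr)
  split_ifs
  · simpa using hr
  · exact (abs_of_nonneg (zero_le_one.trans hr)).le

lemma dilate_eq_zero {g : Chart → ℂ} {R : ℝ} (hR0 : 0 ≤ R) (hR : ∀ p, g p ≠ 0 → ‖p‖ ≤ R) {c r : ℝ}
    (hc : 0 < c) (hr : c ≤ r) {p : Chart} (hp : p ∉ Metric.closedBall (0 : Chart) (R + R / c)) :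
    g (dilate r p) = 0 := by
  by_contra hne
  apply hp
  have h := hR _ hne
  have h0 : 0 ≤ R / c := by positivity
  have hi : ∀ i, i ≠ 0 → ‖p i‖ ≤ R + R / c := by
    intro i hi
    have h1 := (norm_le_pi_norm _ i).trans h
    rw [dilate_apply, if_neg hi, norm_mul, Complex.norm_real, Real.norm_eq_abs,
      abs_of_pos (hc.trans_le hr)] at h1
    have h2 : c * ‖p i‖ ≤ R := (mul_le_mul_of_nonneg_right hr (norm_nonneg _)).trans h1
    have h3 : ‖p i‖ ≤ R / c := by rw [le_div_iff₀ hc]; linarith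
    linarith
  rw [mem_closedBall_zero_iff]
  refine chart_norm_le ?_ (hi 1 (by decide)) (hi 2 (by decide))
  have h1 := (norm_le_pi_norm _ 0).trans h
  rw [dilate_apply] at h1
  simp only [if_true, Complex.ofReal_one, one_mul] at h1
  linarith

lemma contDiff_dilate :
    ContDiff ℝ ((⊤ : ℕ∞) : WithTop ℕ∞) fun q : ℝ × Chart => dilate q.1 q.2 := by
  rw [contDiff_pi]
  intro i
  have h : ContDiff ℝ ((⊤ : ℕ∞) : WithTop ℕ∞) fun q : ℝ × Chart => q.2 i := by fun_prop
  by_cases hi : i = 0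
  · simpa only [dilate_apply, hi, if_true, Complex.ofReal_one, one_mul] using h
  · simp only [dilate_apply, hi, if_false]
    exact (Complex.ofRealCLM.contDiff.comp contDiff_fst).mul h

lemma isTest_dilate {g : Chart → ℂ} (hg : IsTest g) {r : ℝ} (hr : 0 < r) :
    IsTest fun p => g (dilate r p) := by
  obtain ⟨R, hR0, hR⟩ := hg.exists_radius
  exact isTest_of_section (H := fun (r : ℝ) p => g (dilate r p)) (hg.contDiff.comp contDiff_dilate)
    (isCompact_closedBall _ _) (fun p hp => dilate_eq_zero hR0 hR hr le_rfl hp)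

/-- Distributions that are holomorphic and homogeneous of degree zero in the fibre coordinates. -/
structure IsHomogeneous (D : Dist) : Prop where
  delBar₁ : delBar 1 D = 0
  delBar₂ : delBar 2 D = 0
  fibreEuler_eq : fibreEuler D = 0

section IsHomogeneous

variable {D : Dist}

/-- Infinitesimal invariance under fibre dilations; the `4` is the real dimension of the fibre. -/
lemma IsHomogeneous.apply_fderiv (hD : IsHomogeneous D) {f : Chart → ℂ} (hf : IsTest f) :
    D (toTest fun p => 4 * f p + (fderiv ℝ f p (Pi.single 1 (p 1))
      + fderiv ℝ f p (Pi.single 2 (p 2)))) = 0 := by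
  have hi : ∀ i, IsTest fun p => fderiv ℝ f p (Pi.single i (p i)) := by
    intro i
    refine ⟨(hf.contDiff.fderiv_right (m := ((⊤ : ℕ∞) : WithTop ℕ∞)) (by simp)).clm_apply
      ((contDiff_single i).comp (contDiff_coord i)), ?_⟩
    refine (hf.compact.fderiv ℝ).mono fun p hp => ?_
    intro h0
    exact hp (by simp [h0])
  have hE : mulCoord 1 (del 1 D) (toTest f) + mulCoord 2 (del 2 D) (toTest f) = 0 := by
    have := congrArg (fun S : Dist => S (toTest f)) hD.fibreEuler_eq
    rw [fibreEuler_apply] at this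
    simpa using this
  rw [toTest_add (IsTest.mul_left contDiff_const hf) ((hi 1).add (hi 2)), toTest_add (hi 1) (hi 2),
    toTest_const_mul _ hf, map_add, map_add, map_smul, apply_fderiv_single hD.delBar₁ hf,
    apply_fderiv_single hD.delBar₂ hf, smul_eq_mul]
  linear_combination -hE

/-- The pull-back of `f dv₁ dv̄₁ dv₂ dv̄₂` along a fibre dilation. -/
def expDilate (f : Chart → ℂ) (t : ℝ) (p : Chart) : ℂ :=
  ((Real.exp t : ℝ) : ℂ) ^ 4 * f (dilate (Real.exp t) p)

lemma contDiff_expDilate {f : Chart → ℂ} (hf : IsTest f) :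
    ContDiff ℝ ((⊤ : ℕ∞) : WithTop ℕ∞) fun q : ℝ × Chart => expDilate f q.1 q.2 := by
  have h1 : ContDiff ℝ ((⊤ : ℕ∞) : WithTop ℕ∞) fun q : ℝ × Chart =>
      dilate (Real.exp q.1) q.2 :=
    contDiff_dilate.comp (f := fun q : ℝ × Chart => (Real.exp q.1, q.2))
      ((Real.contDiff_exp.comp contDiff_fst).prodMk contDiff_snd)
  have h2 : ContDiff ℝ ((⊤ : ℕ∞) : WithTop ℕ∞) fun q : ℝ × Chart => ((Real.exp q.1 : ℝ) : ℂ) :=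
    Complex.ofRealCLM.contDiff.comp (Real.contDiff_exp.comp contDiff_fst)
  exact (h2.pow 4).mul (hf.contDiff.comp h1)

lemma isTest_expDilate {f : Chart → ℂ} (hf : IsTest f) (t : ℝ) : IsTest (expDilate f t) :=
  IsTest.mul_left contDiff_const (isTest_dilate hf (Real.exp_pos t))

lemma fderiv_expDilate {f : Chart → ℂ} (hf : IsTest f) (t : ℝ) (p v : Chart) :
    fderiv ℝ (expDilate f t) p v = ((Real.exp t : ℝ) : ℂ) ^ 4 *
      fderiv ℝ f (dilate (Real.exp t) p) (dilate (Real.exp t) v) := by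
  have hfd := (hf.contDiff.differentiable (by simp) (dilate (Real.exp t) p)).hasFDerivAt
  have h3 := (hfd.comp p (dilate (Real.exp t)).hasFDerivAt).const_mul (((Real.exp t : ℝ) : ℂ) ^ 4)
  have h4 : HasFDerivAt (expDilate f t) _ p := h3
  rw [h4.fderiv]
  rfl

lemma hasDerivAt_expDilate {f : Chart → ℂ} (hf : IsTest f) (t : ℝ) (p : Chart) :
    HasDerivAt (fun t => expDilate f t p) (4 * expDilate f t p
      + (fderiv ℝ (expDilate f t) p (Pi.single 1 (p 1))
        + fderiv ℝ (expDilate f t) p (Pi.single 2 (p 2)))) t := by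
  have he : HasDerivAt (fun t : ℝ => ((Real.exp t : ℝ) : ℂ)) (Real.exp t : ℝ) t :=
    (Real.hasDerivAt_exp t).ofReal_comp
  have h1 : HasDerivAt (fun t : ℝ => dilate (Real.exp t) p)
      (dilate (Real.exp t) (Pi.single 1 (p 1)) + dilate (Real.exp t) (Pi.single 2 (p 2))) t := by
    rw [hasDerivAt_pi]
    intro i
    simp only [dilate_apply, Pi.add_apply]
    fin_cases i
    · simpa using hasDerivAt_const t (p 0)
    · simpa using he.mul_const (p 1)
    · simpa using he.mul_const (p 2)
  have hfd := (hf.contDiff.differentiable (by simp) (dilate (Real.exp t) p)).hasFDerivAt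
  have h2 := (he.fun_pow 4).fun_mul (hfd.comp_hasDerivAt t h1)
  rw [fderiv_expDilate hf, fderiv_expDilate hf]
  refine h2.congr_deriv ?_
  rw [map_add, Function.comp_apply, expDilate]
  push_cast
  ring

lemma IsHomogeneous.hasDerivAt_apply_expDilate (hD : IsHomogeneous D) {f : Chart → ℂ}
    (hf : IsTest f) (t : ℝ) : HasDerivAt (fun t => D (toTest (expDilate f t))) 0 t := by
  obtain ⟨R, hR0, hR⟩ := hf.exists_radius
  have h := hasDerivAt_apply_family D (contDiff_expDilate hf) (t₀ := t)
    (isCompact_closedBall (0 : Chart) (R + R / Real.exp (t - 1))) ?_ (hasDerivAt_expDilate hf t)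
  · rwa [hD.apply_fderiv (isTest_expDilate hf t)] at h
  · filter_upwards [Metric.ball_mem_nhds t one_pos] with s hs p hp
    rw [expDilate, dilate_eq_zero hR0 hR (Real.exp_pos (t - 1)) ?_ hp, mul_zero]
    rw [Metric.mem_ball, Real.dist_eq, abs_lt] at hs
    exact Real.exp_le_exp.2 (by linarith [hs.1])

lemma expDilate_zero (f : Chart → ℂ) : expDilate f 0 = f := by
  funext p
  rw [expDilate, Real.exp_zero, Complex.ofReal_one, one_pow, one_mul]
  congr 1
  funext i
  rw [dilate_apply]
  simp

/-- The infinitesimal identity makes the pairing with `expDilate f t` constant in `t`; compare `t =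
0` with `t = log r`. -/
lemma IsHomogeneous.apply_dilate (hD : IsHomogeneous D) {f : Chart → ℂ} (hf : IsTest f) {r : ℝ}
    (hr : 0 < r) : D (toTest f) = (r : ℂ) ^ 4 * D (toTest fun p => f (dilate r p)) := by
  have hconst := is_const_of_deriv_eq_zero
    (fun t => (hD.hasDerivAt_apply_expDilate hf t).differentiableAt)
    (fun t => (hD.hasDerivAt_apply_expDilate hf t).deriv) 0 (Real.log r)
  have e : expDilate f (Real.log r) = fun p => (r : ℂ) ^ 4 * f (dilate r p) := by
    funext p
    rw [expDilate, Real.exp_log hr]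
  rw [expDilate_zero, e, toTest_const_mul _ (isTest_dilate hf hr), map_smul, smul_eq_mul] at hconst
  exact hconst

/-- Dilating by `‖ζ‖` brings a translate by `ζ` back into a fixed ball, where `D` has some finite
order `N`. The rescaled function has derivatives up to order `N` bounded by a multiple of `‖ζ‖ ^ N`,
and the Jacobian adds the exponent `4`. The exponent depends only on the radius `R`. -/
lemma IsHomogeneous.exists_growth (hD : IsHomogeneous D) {j : Fin 3} (hj : j ≠ 0) {R : ℝ}
    (hR0 : 0 ≤ R) : ∃ N : ℕ, ∀ g : Chart → ℂ, IsTest g → (∀ p, g p ≠ 0 → ‖p‖ ≤ R) →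
      ∃ C : ℝ, ∀ ζ : ℂ, 1 ≤ ‖ζ‖ → ‖D (toTest (translate j ζ g))‖ ≤ C * ‖ζ‖ ^ (N + 4) := by
  obtain ⟨N, C, hC, hbound⟩ := exists_bound D (isCompact_closedBall (0 : Chart) (R + 1))
  refine ⟨N, fun g hg hR => ?_⟩
  obtain ⟨A, hA, hgA⟩ := exists_iteratedFDeriv_bound hg.contDiff hg.compact N
  refine ⟨C * A, fun ζ hζ => ?_⟩
  have hpos : 0 < ‖ζ‖ := zero_lt_one.trans_le hζ
  have ht := isTest_dilate (isTest_translate j hg ζ) hpos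
  rw [hD.apply_dilate (isTest_translate j hg ζ) hpos, norm_mul, norm_pow, Complex.norm_real,
    Real.norm_eq_abs, abs_of_pos hpos]
  have key : ‖D (toTest fun p => translate j ζ g (dilate ‖ζ‖ p))‖ ≤ C * (A * ‖ζ‖ ^ N) := by
    refine hbound _ ?_ _ (by positivity) fun i hi p => ?_
    · rw [coe_toTest ht]
      refine closure_minimal (fun p hp => ?_) Metric.isClosed_closedBall
      have h := hR _ hp
      rw [mem_closedBall_zero_iff]
      have hcoord : ∀ i, i ≠ 0 → ‖p i‖ ≤ R + 1 := by
        intro i hi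
        have h1 := (norm_le_pi_norm _ i).trans h
        rw [Pi.sub_apply, dilate_apply, if_neg hi] at h1
        have h2 : ‖(Pi.single j ζ : Chart) i‖ ≤ ‖ζ‖ :=
          (norm_le_pi_norm _ i).trans (norm_single_le j ζ)
        have h3 : ‖ζ‖ * ‖p i‖ ≤ R + ‖ζ‖ := by
          calc ‖ζ‖ * ‖p i‖ = ‖((‖ζ‖ : ℝ) * p i - (Pi.single j ζ : Chart) i)
                + (Pi.single j ζ : Chart) i‖ := by
                rw [sub_add_cancel, norm_mul, Complex.norm_real, Real.norm_eq_abs, abs_of_pos hpos]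
            _ ≤ _ := norm_add_le _ _
            _ ≤ R + ‖ζ‖ := add_le_add h1 h2
        have h4 : ‖ζ‖ * ‖p i‖ ≤ ‖ζ‖ * (R + 1) := by nlinarith
        exact le_of_mul_le_mul_left h4 hpos
      refine chart_norm_le ?_ (hcoord 1 (by decide)) (hcoord 2 (by decide))
      have h1 := (norm_le_pi_norm _ 0).trans h
      rw [Pi.sub_apply, dilate_apply, Pi.single_eq_of_ne hj.symm] at h1
      simp only [if_true, Complex.ofReal_one, one_mul, sub_zero] at h1
      linarith
    · rw [coe_toTest ht]
      refine (norm_iteratedFDeriv_comp_affine_le hg.contDiff (dilate ‖ζ‖) _ i p).trans ?_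
      refine mul_le_mul (hgA i hi _) ?_ (by positivity) hA
      calc ‖dilate ‖ζ‖‖ ^ i ≤ ‖ζ‖ ^ i := by gcongr; exact norm_dilate_le hζ
        _ ≤ ‖ζ‖ ^ N := pow_le_pow_right₀ hζ hi
  calc ‖ζ‖ ^ 4 * ‖D (toTest fun p => translate j ζ g (dilate ‖ζ‖ p))‖
      ≤ ‖ζ‖ ^ 4 * (C * (A * ‖ζ‖ ^ N)) := by gcongr
    _ = C * A * ‖ζ‖ ^ (N + 4) := by ring

/-- Cauchy's estimate on circles of radius `r → ∞`, as in Liouville's theorem. -/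
lemma iteratedDeriv_eq_zero_of_growth {F : ℂ → ℂ} (hF : Differentiable ℂ F) {C : ℝ} {N : ℕ}
    (hC : ∀ ζ : ℂ, 1 ≤ ‖ζ‖ → ‖F ζ‖ ≤ C * ‖ζ‖ ^ N) : iteratedDeriv (N + 1) F 0 = 0 := by
  have hlim : Filter.Tendsto (fun r : ℝ => ((N + 1).factorial * C) * r⁻¹) Filter.atTop (𝓝 0) := by
    simpa using tendsto_inv_atTop_zero.const_mul (((N + 1).factorial : ℝ) * C)
  have hle : ‖iteratedDeriv (N + 1) F 0‖ ≤ 0 := by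
    refine ge_of_tendsto hlim ?_
    filter_upwards [Filter.eventually_ge_atTop 1] with r hr
    have hpos : 0 < r := zero_lt_one.trans_le hr
    refine (Complex.norm_iteratedDeriv_le_of_forall_mem_sphere_norm_le (C := C * r ^ N) (N + 1) hpos
      hF.diffContOnCl fun ζ hζ => ?_).trans_eq ?_
    · rw [mem_sphere_zero_iff_norm] at hζ
      rw [← hζ]
      exact hC ζ (by rwa [hζ])
    · field_simp
      ring
  exact norm_le_zero_iff.1 hle

lemma IsHomogeneous.exists_del_pow_mem (hD : IsHomogeneous D) {j : Fin 3} (hj : j ≠ 0)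
    {K : Set Chart} (hK : IsCompact K) :
    ∃ M : ℕ, ((del j : Module.End ℂ Dist) ^ M) D ∈ vanishing K := by
  have hbar : delBar j D = 0 := by
    fin_cases j
    exacts [absurd rfl hj, hD.delBar₁, hD.delBar₂]
  obtain ⟨R, hR⟩ := hK.isBounded.subset_closedBall (0 : Chart)
  obtain ⟨N, hN⟩ := hD.exists_growth hj (le_max_right R 0)
  -- One more than the growth exponent. This derivative of the entire function `ζ ↦ D (translate j ζ
  -- f)` at `0` is the pairing of `∂_j ^ (N+5) D` with `f`.
  refine ⟨N + 4 + 1, fun f hf => ?_⟩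
  obtain ⟨C, hC⟩ := hN f (isTest_coe f) fun p hp => by
    have := hR (hf (subset_tsupport f hp))
    rw [mem_closedBall_zero_iff] at this
    exact this.trans (le_max_left _ _)
  have h := iteratedDeriv_eq_zero_of_growth
    (fun ζ => (hasDerivAt_apply_translate hbar (isTest_coe f) ζ).differentiableAt) hC
  rw [iteratedDeriv_apply_translate hbar (isTest_coe f)] at h
  have e : translate j 0 f = f := by
    funext p
    simp [translate]
  simpa only [e, toTest_coe] using h

lemma fibreEuler_del₁ (T : Dist) : fibreEuler (del 1 T) = del 1 (fibreEuler T) - del 1 T := by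
  rw [fibreEuler_apply, fibreEuler_apply, map_add, del_mulCoord_self,
    del_mulCoord _ (by decide : (1 : Fin 3) ≠ 2), del_comm 1 2]
  abel

lemma fibreEuler_del₂ (T : Dist) : fibreEuler (del 2 T) = del 2 (fibreEuler T) - del 2 T := by
  rw [fibreEuler_apply, fibreEuler_apply, map_add, del_mulCoord_self,
    del_mulCoord _ (by decide : (2 : Fin 3) ≠ 1), del_comm 2 1]
  abel

/-- Each fibre derivative lowers the homogeneity degree by one, so mixed derivatives of positive
order have a non-zero degree. -/
lemma fibreEuler_del_pow (h : fibreEuler D = 0) (a b : ℕ) :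
    fibreEuler (((del 1 : Module.End ℂ Dist) ^ a) (((del 2 : Module.End ℂ Dist) ^ b) D)) =
      (-((a : ℂ) + b)) • ((del 1 : Module.End ℂ Dist) ^ a) (((del 2 : Module.End ℂ Dist) ^ b) D) := by
  induction a with
  | zero =>
    simp only [pow_zero, Module.End.one_apply]
    induction b with
    | zero => simp [h, dist_zero_smul]
    | succ b ih =>
      rw [pow_succ', Module.End.mul_apply, fibreEuler_del₂, ih, map_smul]
      push_cast
      module
  | succ a ih =>
    rw [pow_succ', Module.End.mul_apply, fibreEuler_del₁, ih, map_smul]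
    push_cast
    module

/-- A distribution that is homogeneous of degree zero and holomorphic in the fibre coordinates does
not depend on them. -/
lemma IsHomogeneous.del_eq_zero (hD : IsHomogeneous D) : del 1 D = 0 ∧ del 2 D = 0 := by
  have key : ∀ K : Set Chart, IsCompact K → ∀ a b : ℕ, 1 ≤ a + b →
      ((del 1 : Module.End ℂ Dist) ^ a) (((del 2 : Module.End ℂ Dist) ^ b) D) ∈ vanishing K := by
    intro K hK
    obtain ⟨M₁, h₁⟩ := hD.exists_del_pow_mem (by decide : (1 : Fin 3) ≠ 0) hK
    obtain ⟨M₂, h₂⟩ := hD.exists_del_pow_mem (by decide : (2 : Fin 3) ≠ 0) hK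
    have hcomm : Commute (del 1 : Module.End ℂ Dist) (del 2) := by
      ext T : 1
      exact del_comm 1 2 T
    have hpow : ∀ (j : Fin 3) {T : Dist} (n : ℕ), T ∈ vanishing K →
        ((del j : Module.End ℂ Dist) ^ n) T ∈ vanishing K := fun j T n hT =>
      pow_apply_mem (fun T hT => del_mem_vanishing hT j) hT n
    -- Downward induction on the order `a + b`. At order `M₁ + M₂` one exponent is large enough.
    -- Below it, Euler's identity writes `-(a + b)` times the derivative through derivatives of
    -- order one higher, so the descent stops at order one.
    have hind : ∀ k a b : ℕ, 1 ≤ a + b → M₁ + M₂ ≤ a + b + k →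
        ((del 1 : Module.End ℂ Dist) ^ a) (((del 2 : Module.End ℂ Dist) ^ b) D) ∈ vanishing K := by
      intro k
      induction k with
      | zero =>
        intro a b _ hab
        by_cases ha : M₁ ≤ a
        · rw [← Module.End.mul_apply, (hcomm.pow_pow a b).eq, Module.End.mul_apply,
            ← Nat.sub_add_cancel ha, pow_add, Module.End.mul_apply]
          exact hpow 2 b (hpow 1 _ h₁)
        · have hb : M₂ ≤ b := by omega
          rw [← Nat.sub_add_cancel hb, pow_add, Module.End.mul_apply]
          exact hpow 1 a (hpow 2 _ h₂)
      | succ k ih =>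
        intro a b h1 hab
        have h3 := ih (a + 1) b (by omega) (by omega)
        have h4 := ih a (b + 1) (by omega) (by omega)
        have hE := fibreEuler_del_pow hD.fibreEuler_eq a b
        have e1 (T : Dist) : del 1 (((del 1 : Module.End ℂ Dist) ^ a) T)
            = ((del 1 : Module.End ℂ Dist) ^ (a + 1)) T := by
          rw [pow_succ', Module.End.mul_apply]
        have e2 : del 2 (((del 1 : Module.End ℂ Dist) ^ a) (((del 2 : Module.End ℂ Dist) ^ b) D))
            = ((del 1 : Module.End ℂ Dist) ^ a) (((del 2 : Module.End ℂ Dist) ^ (b + 1)) D) := by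
          have := congrArg (fun L : Module.End ℂ Dist => L (((del 2 : Module.End ℂ Dist) ^ b) D))
            (hcomm.symm.pow_right a).eq
          rw [pow_succ']
          exact this
        rw [fibreEuler_apply, e1, e2] at hE
        have h5 : (-((a : ℂ) + b)) • ((del 1 : Module.End ℂ Dist) ^ a)
            (((del 2 : Module.End ℂ Dist) ^ b) D) ∈ vanishing K := by
          rw [← hE]
          exact Submodule.add_mem _ (mulDist_mem_vanishing h3 _ _) (mulDist_mem_vanishing h4 _ _)
        have hne : (-((a : ℂ) + b)) ≠ 0 := by
          rw [neg_ne_zero]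
          exact_mod_cast (by omega : a + b ≠ 0)
        exact (Submodule.smul_mem_iff _ hne).1 h5
    exact fun a b h => hind (M₁ + M₂) a b h (by omega)
  exact ⟨eq_zero_of_forall_vanishing fun K hK => by simpa using key K hK 1 0 (by norm_num),
    eq_zero_of_forall_vanishing fun K hK => by simpa using key K hK 0 1 (by norm_num)⟩

end IsHomogeneous

/-! ### Distributions invariant under translations along the fibres -/

section Primitive

variable {e : Chart} {f : Chart → ℂ}

lemma norm_le_of_line_ne_zero (he : ‖e‖ = 1) {R : ℝ} (hR : ∀ p, f p ≠ 0 → ‖p‖ ≤ R) {p : Chart}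
    {s : ℝ} (h : f (p + s • e) ≠ 0) : |s| ≤ ‖p‖ + R := by
  have h1 := hR _ h
  calc |s| = ‖s • e‖ := by rw [norm_smul, he, mul_one, Real.norm_eq_abs]
    _ = ‖(p + s • e) - p‖ := by rw [add_sub_cancel_left]
    _ ≤ ‖p + s • e‖ + ‖p‖ := norm_sub_le _ _
    _ ≤ ‖p‖ + R := by linarith

lemma contDiff_line_integral (he : ‖e‖ = 1) (hf : IsTest f) {φ : ℝ → ℝ} (hφ : LocallyIntegrable φ) :
    ContDiff ℝ ((⊤ : ℕ∞) : WithTop ℕ∞) fun p => ∫ s, φ s • f (p + s • e) := by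
  obtain ⟨R, hR0, hR⟩ := hf.exists_radius
  rw [contDiff_iff_contDiffAt]
  intro p
  have h := contDiffOn_integral_smul hφ (G := fun p s => f (p + s • e))
    (s := Metric.ball (0 : Chart) (‖p‖ + 1)) (k := Metric.closedBall 0 (‖p‖ + 1 + R))
    Metric.isOpen_ball (isCompact_closedBall _ _) (fun q s hq hs => ?_)
    (hf.contDiff.comp (contDiff_fst.add (contDiff_snd.smul contDiff_const)))
  · exact h.contDiffAt (Metric.isOpen_ball.mem_nhds (by simp))
  · by_contra hne
    apply hs
    rw [mem_closedBall_zero_iff, Real.norm_eq_abs]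
    rw [mem_ball_zero_iff] at hq
    linarith [norm_le_of_line_ne_zero he hR hne]

lemma integrable_line (he : ‖e‖ = 1) (hf : IsTest f) (p : Chart) :
    Integrable fun s : ℝ => f (p + s • e) := by
  obtain ⟨R, hR0, hR⟩ := hf.exists_radius
  have hc : Continuous fun s : ℝ => f (p + s • e) := hf.contDiff.continuous.comp (by fun_prop)
  refine hc.integrable_of_hasCompactSupport
    (HasCompactSupport.intro (isCompact_closedBall 0 (‖p‖ + R)) fun s hs => ?_)
  by_contra hne
  apply hs
  rw [mem_closedBall_zero_iff, Real.norm_eq_abs]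
  exact norm_le_of_line_ne_zero he hR hne

/-- The primitive of `f` in the direction `e`. -/
def primitive (e : Chart) (f : Chart → ℂ) (p : Chart) : ℂ :=
  ∫ s, Set.indicator (Set.Iic 0) (1 : ℝ → ℝ) s • f (p + s • e)

lemma primitive_eq (e : Chart) (f : Chart → ℂ) (p : Chart) :
    primitive e f p = ∫ s in Set.Iic (0 : ℝ), f (p + s • e) := by
  rw [primitive, ← integral_indicator measurableSet_Iic]
  congr 1
  funext s
  by_cases hs : s ∈ Set.Iic (0 : ℝ)
  · simp [hs]
  · simp [hs]

lemma contDiff_primitive (he : ‖e‖ = 1) (hf : IsTest f) :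
    ContDiff ℝ ((⊤ : ℕ∞) : WithTop ℕ∞) (primitive e f) := by
  refine contDiff_line_integral he hf ?_
  refine LocallyIntegrable.indicator ?_ measurableSet_Iic
  exact continuous_const.locallyIntegrable

/-- A non-zero primitive at `p` requires a point of the support of `f` behind `p`. As the full line
integral is zero, it also requires one ahead of `p`. Then `p` lies on a segment between two points
of a ball, which is convex. -/
lemma isTest_primitive (he : ‖e‖ = 1) (hf : IsTest f) (h0 : ∀ p, ∫ s : ℝ, f (p + s • e) = 0) :
    IsTest (primitive e f) := by
  obtain ⟨R, hR0, hR⟩ := hf.exists_radius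
  refine ⟨contDiff_primitive he hf,
    HasCompactSupport.intro (isCompact_closedBall (0 : Chart) R) fun p hp => ?_⟩
  by_contra hne
  rw [primitive_eq] at hne
  have h1 : ∃ s ≤ (0 : ℝ), f (p + s • e) ≠ 0 := by
    by_contra! h
    exact hne (setIntegral_eq_zero_of_forall_eq_zero h)
  have h2 : ∃ s > (0 : ℝ), f (p + s • e) ≠ 0 := by
    by_contra! h
    apply hne
    rw [← h0 p, ← integral_add_compl (measurableSet_Iic (a := (0 : ℝ))) (integrable_line he hf p),
      Set.compl_Iic, setIntegral_eq_zero_of_forall_eq_zero (t := Set.Ioi 0) h, add_zero]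
  obtain ⟨s, hs, hfs⟩ := h1
  obtain ⟨t, ht, hft⟩ := h2
  apply hp
  have hseg : p ∈ segment ℝ (p + s • e) (p + t • e) := by
    refine ⟨t / (t - s), -s / (t - s), div_nonneg ht.le (by linarith), div_nonneg (by linarith)
      (by linarith), ?_, ?_⟩
    · rw [← add_div, ← sub_eq_add_neg, div_self (by linarith)]
    · have hne' : t - s ≠ 0 := by linarith
      have e1 : t / (t - s) + -s / (t - s) = 1 := by
        rw [← add_div, ← sub_eq_add_neg, div_self hne']
      have e2 : t / (t - s) * s + -s / (t - s) * t = 0 := by ring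
      calc (t / (t - s)) • (p + s • e) + (-s / (t - s)) • (p + t • e)
          = (t / (t - s) + -s / (t - s)) • p + (t / (t - s) * s + -s / (t - s) * t) • e := by
            module
        _ = p := by rw [e1, e2, one_smul, zero_smul, add_zero]
  exact (convex_closedBall (0 : Chart) R).segment_subset
    (mem_closedBall_zero_iff.2 (hR _ hfs)) (mem_closedBall_zero_iff.2 (hR _ hft)) hseg

lemma fderiv_primitive (he : ‖e‖ = 1) (hf : IsTest f) (p : Chart) :
    fderiv ℝ (primitive e f) p e = f p := by
  have hint := integrable_line he hf p
  have hline : ∀ t : ℝ, primitive e f (p + t • e) =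
      (∫ s in Set.Iic (0 : ℝ), f (p + s • e)) + ∫ s in (0 : ℝ)..t, f (p + s • e) := by
    intro t
    rw [← intervalIntegral.integral_Iic_sub_Iic hint.integrableOn hint.integrableOn,
      add_sub_cancel, primitive_eq]
    have := MeasurePreserving.setIntegral_preimage_emb
      (measurePreserving_add_right (volume : Measure ℝ) t)
      (measurableEmbedding_addRight t) (fun s => f (p + s • e)) (Set.Iic t)
    rw [← this]
    congr 1
    · congr 1
      ext s
      simp
    · funext s
      congr 1
      module
  have hc : Continuous fun s : ℝ => f (p + s • e) := hf.contDiff.continuous.comp (by fun_prop)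
  have h1 : HasDerivAt (fun t : ℝ => primitive e f (p + t • e)) (f (p + (0 : ℝ) • e)) 0 := by
    simp only [hline]
    exact (intervalIntegral.integral_hasDerivAt_right (hc.intervalIntegrable _ _)
      (hc.stronglyMeasurableAtFilter _ _) hc.continuousAt).const_add _
  have h2 : HasDerivAt (fun t : ℝ => p + t • e) e 0 := by
    simpa using ((hasDerivAt_id (0 : ℝ)).smul_const e).const_add p
  have h3 := ((contDiff_primitive he hf).differentiable (by simp)
    (p + (0 : ℝ) • e)).hasFDerivAt.comp_hasDerivAt (0 : ℝ) h2
  have h4 := h3.unique h1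
  simpa using h4

/-- Such an `f` is the derivative along `e` of a test function, and `D` annihilates these
derivatives. -/
lemma apply_eq_zero_of_line_integral {D : Dist} (he : ‖e‖ = 1) (hD : derivDist e D = 0)
    (hf : IsTest f) (h0 : ∀ p, ∫ s : ℝ, f (p + s • e) = 0) : D (toTest f) = 0 := by
  have h := derivDist_toTest e D (isTest_primitive he hf h0)
  rw [hD] at h
  simp only [fderiv_primitive he hf] at h
  exact neg_eq_zero.1 h.symm

end Primitive

/-- A smooth real function with compact support and integral one. -/
def unitBump : ℝ → ℝ := (⟨1, 2, one_pos, one_lt_two⟩ : ContDiffBump (0 : ℝ)).normed volume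

lemma contDiff_unitBump : ContDiff ℝ ((⊤ : ℕ∞) : WithTop ℕ∞) unitBump :=
  ContDiffBump.contDiff_normed _

lemma integral_unitBump : ∫ s, unitBump s = 1 := ContDiffBump.integral_normed _

lemma unitBump_eq_zero {s : ℝ} (hs : 2 ≤ |s|) : unitBump s = 0 := by
  by_contra h
  have : s ∈ Function.support unitBump := h
  rw [unitBump, ContDiffBump.support_normed_eq, mem_ball_zero_iff, Real.norm_eq_abs] at this
  exact absurd this (not_lt.2 hs)

/-- The average of `f` along `e`, localized again by a bump function of `l`. -/
def average (e : Chart) (l : Chart →L[ℝ] ℝ) (f : Chart → ℂ) (p : Chart) : ℂ :=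
  (unitBump (l p) : ℂ) * ∫ s : ℝ, f (p + s • e)

section Average

variable {e : Chart} {l : Chart →L[ℝ] ℝ} {f : Chart → ℂ}

lemma isTest_average (he : ‖e‖ = 1) (hle : l e = 1) (hl : ∀ p, |l p| ≤ ‖p‖) (hf : IsTest f) :
    IsTest (average e l f) := by
  obtain ⟨R, hR0, hR⟩ := hf.exists_radius
  refine ⟨(Complex.ofRealCLM.contDiff.comp (contDiff_unitBump.comp l.contDiff)).mul ?_,
    HasCompactSupport.intro (isCompact_closedBall (0 : Chart) (2 * R + 2)) fun p hp => ?_⟩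
  · simpa using contDiff_line_integral he hf (φ := fun _ => 1) continuous_const.locallyIntegrable
  · by_contra hne
    have h1 : |l p| < 2 := by
      by_contra h
      exact hne (by rw [average, unitBump_eq_zero (not_lt.1 h), Complex.ofReal_zero, zero_mul])
    obtain ⟨s, hs⟩ : ∃ s : ℝ, f (p + s • e) ≠ 0 := by
      by_contra! h
      exact hne (by simp [average, h])
    have h2 := hR _ hs
    have h3 := hl (p + s • e)
    rw [map_add, map_smul, hle, smul_eq_mul, mul_one] at h3
    have h4 : |s| ≤ R + 2 := by
      calc |s| = |(l p + s) - l p| := by rw [add_sub_cancel_left]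
        _ ≤ |l p + s| + |l p| := abs_sub _ _
        _ ≤ R + 2 := by linarith
    apply hp
    rw [mem_closedBall_zero_iff]
    calc ‖p‖ = ‖(p + s • e) - s • e‖ := by rw [add_sub_cancel_right]
      _ ≤ ‖p + s • e‖ + ‖s • e‖ := norm_sub_le _ _
      _ = ‖p + s • e‖ + |s| := by rw [norm_smul, he, mul_one, Real.norm_eq_abs]
      _ ≤ 2 * R + 2 := by linarith

lemma line_integral_add_smul (f : Chart → ℂ) (p : Chart) (t : ℝ) :
    ∫ s : ℝ, f (p + t • e + s • e) = ∫ s : ℝ, f (p + s • e) := by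
  rw [← integral_add_left_eq_self (fun s : ℝ => f (p + s • e)) t]
  congr 1
  funext s
  congr 1
  module

/-- The unit bump has integral one and `l` grows at unit speed along `e`, so `f` and its average
have equal integrals over every line in the direction `e`. -/
lemma apply_average {D : Dist} (he : ‖e‖ = 1) (hle : l e = 1) (hl : ∀ p, |l p| ≤ ‖p‖)
    (hD : derivDist e D = 0) (hf : IsTest f) : D (toTest f) = D (toTest (average e l f)) := by
  have ha := isTest_average he hle hl hf
  rw [← sub_eq_zero, ← map_sub, ← toTest_sub hf ha]
  refine apply_eq_zero_of_line_integral he hD (hf.sub ha) fun p => ?_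
  rw [integral_sub (integrable_line he hf p) (integrable_line he ha p)]
  simp only [average, line_integral_add_smul, map_add, map_smul, hle, smul_eq_mul, mul_one]
  have h1 : ∫ s : ℝ, (unitBump (l p + s) : ℂ) = 1 := by
    have := integral_ofReal (μ := volume) (𝕜 := ℂ) (f := fun s => unitBump (l p + s))
    rw [integral_add_left_eq_self unitBump, integral_unitBump] at this
    simpa using this
  rw [integral_mul_const, h1]
  simp

end Average

/-- The real fibre directions. -/
def fibreDir : Fin 4 → Chart :=
  ![Pi.single 1 1, Pi.single 1 Complex.I, Pi.single 2 1, Pi.single 2 Complex.I]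

/-- The real fibre coordinates. -/
def fibreCoord : Fin 4 → Chart →L[ℝ] ℝ :=
  ![Complex.reCLM ∘L ContinuousLinearMap.proj (R := ℝ) (φ := fun _ : Fin 3 => ℂ) 1,
    Complex.imCLM ∘L ContinuousLinearMap.proj (R := ℝ) (φ := fun _ : Fin 3 => ℂ) 1,
    Complex.reCLM ∘L ContinuousLinearMap.proj (R := ℝ) (φ := fun _ : Fin 3 => ℂ) 2,
    Complex.imCLM ∘L ContinuousLinearMap.proj (R := ℝ) (φ := fun _ : Fin 3 => ℂ) 2]

lemma norm_fibreDir (i : Fin 4) : ‖fibreDir i‖ = 1 := by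
  fin_cases i <;> simp [fibreDir, Pi.norm_single]

lemma fibreCoord_fibreDir (i j : Fin 4) : fibreCoord i (fibreDir j) = if i = j then 1 else 0 := by
  fin_cases i <;> fin_cases j <;> simp [fibreDir, fibreCoord]

lemma abs_fibreCoord_le (i : Fin 4) (p : Chart) : |fibreCoord i p| ≤ ‖p‖ := by
  fin_cases i
  exacts [(Complex.abs_re_le_norm _).trans (norm_le_pi_norm p 1),
    (Complex.abs_im_le_norm _).trans (norm_le_pi_norm p 1),
    (Complex.abs_re_le_norm _).trans (norm_le_pi_norm p 2),
    (Complex.abs_im_le_norm _).trans (norm_le_pi_norm p 2)]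

lemma chart_eq_add_sum (p : Chart) :
    p = Pi.single 0 (p 0) + ∑ i, fibreCoord i p • fibreDir i := by
  funext a
  rw [Fin.sum_univ_four]
  fin_cases a
  · simp [fibreDir]
  · simp [fibreDir, fibreCoord, Complex.re_add_im]
  · simp [fibreDir, fibreCoord, Complex.re_add_im]

/-- `f` is a product of bump functions of the fibre coordinates in `S`, and of a function that does
not depend on these coordinates. -/
def IsSeparated (S : Finset (Fin 4)) (f : Chart → ℂ) : Prop :=
  ∃ Q : Chart → ℂ, (∀ p, f p = (∏ i ∈ S, (unitBump (fibreCoord i p) : ℂ)) * Q p) ∧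
    ∀ i ∈ S, ∀ p, ∀ s : ℝ, Q (p + s • fibreDir i) = Q p

lemma IsSeparated.average {S : Finset (Fin 4)} {f : Chart → ℂ} (hf : IsSeparated S f) {j : Fin 4}
    (hj : j ∉ S) : IsSeparated (insert j S) (average (fibreDir j) (fibreCoord j) f) := by
  obtain ⟨Q, hQ, hinv⟩ := hf
  refine ⟨fun p => ∫ s : ℝ, Q (p + s • fibreDir j), fun p => ?_, fun i hi p s => ?_⟩
  · have h1 : ∀ s : ℝ, f (p + s • fibreDir j) =
        (∏ i ∈ S, (unitBump (fibreCoord i p) : ℂ)) * Q (p + s • fibreDir j) := by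
      intro s
      rw [hQ]
      congr 1
      refine Finset.prod_congr rfl fun i hi => ?_
      have hij : i ≠ j := fun h => hj (h ▸ hi)
      rw [map_add, map_smul, fibreCoord_fibreDir, if_neg hij, smul_zero, add_zero]
    rw [Twistor.average, Finset.prod_insert hj, mul_assoc]
    simp only [h1]
    rw [integral_const_mul]
  · rcases Finset.mem_insert.1 hi with rfl | hi'
    · exact line_integral_add_smul Q p s
    · have h1 : ∀ t : ℝ, Q (p + s • fibreDir i + t • fibreDir j) = Q (p + t • fibreDir j) := by
        intro t
        rw [add_right_comm, hinv i hi']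
      simp only [h1]

lemma exists_isSeparated {D : Dist} (hD : ∀ i, derivDist (fibreDir i) D = 0) {f : Chart → ℂ}
    (hf : IsTest f) (S : Finset (Fin 4)) :
    ∃ g, IsTest g ∧ IsSeparated S g ∧ D (toTest f) = D (toTest g) := by
  induction S using Finset.induction_on with
  | empty => exact ⟨f, hf, ⟨f, by simp, by simp⟩, rfl⟩
  | insert j S hj ih =>
    obtain ⟨g, hg, hgS, e⟩ := ih
    have hle : fibreCoord j (fibreDir j) = 1 := by rw [fibreCoord_fibreDir, if_pos rfl]
    exact ⟨_, isTest_average (norm_fibreDir j) hle (abs_fibreCoord_le j) hg, hgS.average hj,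
      e.trans (apply_average (norm_fibreDir j) hle (abs_fibreCoord_le j) (hD j) hg)⟩

/-- A test function that is a product of bump functions of the coordinates. -/
def productBump (z₀ : ℂ) (p : Chart) : ℂ :=
  cutoff (p 0 - z₀) * ∏ i, (unitBump (fibreCoord i p) : ℂ)

lemma isTest_productBump (z₀ : ℂ) : IsTest (productBump z₀) := by
  refine ⟨(contDiff_cutoff.comp (contDiff_normal z₀)).mul (contDiff_prod fun i _ =>
    Complex.ofRealCLM.contDiff.comp (contDiff_unitBump.comp (fibreCoord i).contDiff)),
    HasCompactSupport.intro (isCompact_closedBall (0 : Chart) (‖z₀‖ + 8)) fun p hp => ?_⟩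
  by_contra hne
  have h0 : ‖p 0 - z₀‖ < 2 := by
    by_contra h
    exact hne (by rw [productBump, cutoff_eq_zero (not_lt.1 h), zero_mul])
  have hi : ∀ i, |fibreCoord i p| < 2 := by
    intro i
    by_contra h
    apply hne
    rw [productBump, Finset.prod_eq_zero (Finset.mem_univ i), mul_zero]
    rw [unitBump_eq_zero (not_lt.1 h), Complex.ofReal_zero]
  have hz : ‖p 0‖ < ‖z₀‖ + 2 := by
    calc ‖p 0‖ = ‖z₀ + (p 0 - z₀)‖ := by ring_nf
      _ ≤ ‖z₀‖ + ‖p 0 - z₀‖ := norm_add_le _ _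
      _ < _ := by gcongr
  have hn := norm_nonneg z₀
  apply hp
  rw [mem_closedBall_zero_iff]
  refine chart_norm_le (by linarith) ?_ ?_
  · have h1 : |(p 1).re| < 2 := hi 0
    have h2 : |(p 1).im| < 2 := hi 1
    linarith [Complex.norm_le_abs_re_add_abs_im (p 1)]
  · have h1 : |(p 2).re| < 2 := hi 2
    have h2 : |(p 2).im| < 2 := hi 3
    linarith [Complex.norm_le_abs_re_add_abs_im (p 2)]

/-- A distribution on the surface `p 0 = z₀` that is invariant under translations of the fibre
coordinates is determined by its value on one test function. -/
lemma IsTransverse.eq_zero_of_invariant {z₀ : ℂ} {D : Dist} (hD : IsTransverse z₀ D)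
    (hinv : ∀ i, derivDist (fibreDir i) D = 0) (h0 : D (toTest (productBump z₀)) = 0) : D = 0 := by
  ext f
  rw [← toTest_coe f]
  -- Averaging in all four fibre directions leaves the product of bumps times a function of `z`
  -- alone. On the surface this is a constant multiple of `productBump`, and a transverse
  -- distribution sees no more than that.
  obtain ⟨g, hg, ⟨Q, hQ, hQinv⟩, e⟩ := exists_isSeparated hinv (isTest_coe f) Finset.univ
  rw [e, hD.congr hg (IsTest.mul_left (f := fun _ => Q (Pi.single 0 z₀)) contDiff_const
    (isTest_productBump z₀)) fun p hp => ?_, toTest_const_mul _ (isTest_productBump z₀), map_smul,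
    h0, smul_zero]
  · rfl
  · rw [hQ, productBump, hp, sub_self, cutoff_eq_one (by simp), one_mul, mul_comm]
    congr 1
    conv_lhs => rw [chart_eq_add_sum p, hp, Fin.sum_univ_four, ← add_assoc, ← add_assoc,
      ← add_assoc]
    simp only [hQinv _ (Finset.mem_univ _)]

/-! ### Distributions with a density on a surface -/

/-- The inclusion of the surface `p 0 = z₀`. -/
def surfaceEmb (z₀ : ℂ) (v : ℂ × ℂ) : Chart := ![z₀, v.1, v.2]

lemma continuous_surfaceEmb (z₀ : ℂ) : Continuous (surfaceEmb z₀) := by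
  refine continuous_pi fun a => ?_
  fin_cases a
  exacts [continuous_const, continuous_fst, continuous_snd]

lemma norm_le_surfaceEmb (z₀ : ℂ) (v : ℂ × ℂ) : ‖v‖ ≤ ‖surfaceEmb z₀ v‖ :=
  max_le (norm_le_pi_norm (surfaceEmb z₀ v) 1) (norm_le_pi_norm (surfaceEmb z₀ v) 2)

/-- Makes continuous densities locally integrable; otherwise the distribution they define would take
its default value. -/
instance isLocallyFiniteMeasure_surfaceMeasure (z₀ : ℂ) :
    IsLocallyFiniteMeasure (surfaceMeasure z₀) := by
  refine ⟨fun p => ⟨Metric.ball p 1, Metric.ball_mem_nhds p one_pos, ?_⟩⟩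
  have hm : Measurable (surfaceEmb z₀) := (continuous_surfaceEmb z₀).measurable
  have : surfaceMeasure z₀ = Measure.map (surfaceEmb z₀) volume := rfl
  rw [this, Measure.map_apply hm Metric.isOpen_ball.measurableSet]
  refine (measure_mono (t := Metric.closedBall (0 : ℂ × ℂ) (‖p‖ + 1)) fun v hv => ?_).trans_lt
    (isCompact_closedBall _ _).measure_lt_top
  rw [mem_closedBall_zero_iff]
  have hv' : ‖surfaceEmb z₀ v - p‖ < 1 := by
    rw [← dist_eq_norm]; exact hv
  calc ‖v‖ ≤ ‖surfaceEmb z₀ v‖ := norm_le_surfaceEmb z₀ v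
    _ = ‖p + (surfaceEmb z₀ v - p)‖ := by rw [add_sub_cancel]
    _ ≤ ‖p‖ + ‖surfaceEmb z₀ v - p‖ := norm_add_le _ _
    _ ≤ ‖p‖ + 1 := by gcongr

/-- The distribution with density `f` on the surface `p 0 = z₀`. -/
def surfaceDist (z₀ : ℂ) (f : Chart → ℂ) : Dist :=
  TestFunction.integralAgainstBilinCLM (ContinuousLinearMap.mul ℂ ℂ) (surfaceMeasure z₀) f

lemma surfaceDist_apply (z₀ : ℂ) {f : Chart → ℂ} (hf : Continuous f) (g : Test) :
    surfaceDist z₀ f g = ∫ v, g (surfaceEmb z₀ v) * f (surfaceEmb z₀ v) := by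
  rw [surfaceDist, TestFunction.integralAgainstBilinCLM_eq_integral
    (hf.locallyIntegrable.locallyIntegrableOn _)]
  simp only [ContinuousLinearMap.mul_apply']
  have : surfaceMeasure z₀ = Measure.map (surfaceEmb z₀) volume := rfl
  rw [this, integral_map (continuous_surfaceEmb z₀).measurable.aemeasurable]
  exact (g.contDiff.continuous.mul hf).aestronglyMeasurable

lemma mulDist_surfaceDist (z₀ : ℂ) {f : Chart → ℂ} (hf : Continuous f) (g : Chart → ℂ)
    (hg : ContDiff ℝ ((⊤ : ℕ∞) : WithTop ℕ∞) g) :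
    mulDist g hg (surfaceDist z₀ f) = surfaceDist z₀ fun p => g p * f p := by
  ext h
  have hc : Continuous fun p => g p * f p := hg.continuous.mul hf
  rw [mulDist_apply, surfaceDist_apply z₀ hf, surfaceDist_apply z₀ hc]
  simp only [mulTest_apply, mul_assoc]

lemma hasCompactSupport_surface {g : Chart → ℂ} (hg : IsTest g) (z₀ : ℂ) :
    HasCompactSupport fun v => g (surfaceEmb z₀ v) := by
  obtain ⟨R, -, hR⟩ := hg.exists_radius
  refine HasCompactSupport.intro (isCompact_closedBall 0 R) fun v hv => ?_
  by_contra hne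
  exact hv (mem_closedBall_zero_iff.2 ((norm_le_surfaceEmb z₀ v).trans (hR _ hne)))

lemma integrable_surface {g : Chart → ℂ} (hg : IsTest g) (z₀ : ℂ) :
    Integrable fun v => g (surfaceEmb z₀ v) :=
  (hg.contDiff.continuous.comp (continuous_surfaceEmb z₀)).integrable_of_hasCompactSupport
    (hasCompactSupport_surface hg z₀)

/-- The delta distribution of the surface `p 0 = z₀`. -/
def surfaceDelta (z₀ : ℂ) : Dist := surfaceDist z₀ fun _ => 1

lemma surfaceDelta_apply (z₀ : ℂ) (g : Test) :
    surfaceDelta z₀ g = ∫ v, g (surfaceEmb z₀ v) := by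
  rw [surfaceDelta, surfaceDist_apply z₀ continuous_const]
  simp

lemma surfaceDelta_mem (z₀ : ℂ) : surfaceDelta z₀ ∈ supportedOn z₀ := by
  intro g hg
  rw [surfaceDelta_apply, integral_eq_zero_of_ae]
  refine Filter.Eventually.of_forall fun v => ?_
  by_contra hne
  exact hg (subset_tsupport _ hne) rfl

lemma mulNormal_surfaceDelta (z₀ : ℂ) : mulNormal z₀ (surfaceDelta z₀) = 0 := by
  ext g
  rw [mulNormal, mulDist_apply, surfaceDelta_apply]
  simp [surfaceEmb]

lemma mulNormalBar_surfaceDelta (z₀ : ℂ) : mulNormalBar z₀ (surfaceDelta z₀) = 0 := by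
  ext g
  rw [mulNormalBar, mulDist_apply, surfaceDelta_apply]
  simp [surfaceEmb]

lemma isTransverse_surfaceDelta (z₀ : ℂ) : IsTransverse z₀ (surfaceDelta z₀) :=
  ⟨surfaceDelta_mem z₀, mulNormal_surfaceDelta z₀, mulNormalBar_surfaceDelta z₀⟩

/-- Integration by parts on the surface against the constant function `1`. -/
lemma derivDist_surfaceDelta (z₀ : ℂ) (w : ℂ × ℂ) :
    derivDist (![0, w.1, w.2]) (surfaceDelta z₀) = 0 := by
  ext g
  rw [derivDist_apply, surfaceDelta_apply]
  simp only [lineDeriv_apply]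
  have hline : ∀ v, HasLineDerivAt ℝ (fun v => g (surfaceEmb z₀ v))
      (fderiv ℝ g (surfaceEmb z₀ v) ![0, w.1, w.2]) v w := by
    intro v
    have h1 : HasDerivAt (fun t : ℝ => surfaceEmb z₀ (v + t • w)) ![0, w.1, w.2] 0 := by
      rw [hasDerivAt_pi]
      intro a
      fin_cases a
      · exact hasDerivAt_const _ _
      · simpa [surfaceEmb] using ((Complex.ofRealCLM.hasDerivAt (x := 0)).mul_const w.1).const_add v.1
      · simpa [surfaceEmb] using ((Complex.ofRealCLM.hasDerivAt (x := 0)).mul_const w.2).const_add v.2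
    have h2 := (differentiable_test g (surfaceEmb z₀ (v + (0 : ℝ) • w))).hasFDerivAt.comp_hasDerivAt
      (0 : ℝ) h1
    rw [zero_smul, add_zero] at h2
    exact h2
  have : (volume : Measure (ℂ × ℂ)).IsAddHaarMeasure :=
    Measure.prod.instIsAddHaarMeasure volume volume
  have h := integral_bilinear_hasLineDerivAt_right_eq_neg_left_of_integrable (μ := volume)
    (f := fun _ : ℂ × ℂ => (1 : ℂ)) (f' := fun _ => 0) (B := ContinuousLinearMap.mul ℝ ℂ)
    (by simp)
    (by simpa using integrable_surface ((isTest_coe g).fderiv ![0, w.1, w.2]) z₀)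
    (by simpa using integrable_surface (isTest_coe g) z₀)
    (fun v _ => hasDerivAt_const (0 : ℝ) (1 : ℂ)) (v := w) fun v _ => hline v
  simp only [ContinuousLinearMap.mul_apply', one_mul, zero_mul, integral_zero, neg_zero] at h
  rw [h]
  simp

lemma derivDist_single_surfaceDelta (z₀ : ℂ) {j : Fin 3} (hj : j ≠ 0) (η : ℂ) :
    derivDist (Pi.single j η) (surfaceDelta z₀) = 0 := by
  fin_cases j
  · exact absurd rfl hj
  · convert derivDist_surfaceDelta z₀ (η, 0) using 2
    congr 1
    funext a; fin_cases a <;> simp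
  · convert derivDist_surfaceDelta z₀ (0, η) using 2
    congr 1
    funext a; fin_cases a <;> simp

lemma del_surfaceDelta (z₀ : ℂ) {j : Fin 3} (hj : j ≠ 0) : del j (surfaceDelta z₀) = 0 := by
  rw [del_apply, derivDist_single_surfaceDelta z₀ hj, derivDist_single_surfaceDelta z₀ hj]
  simp [dist_smul_zero]

lemma delBar_surfaceDelta (z₀ : ℂ) {j : Fin 3} (hj : j ≠ 0) :
    delBar j (surfaceDelta z₀) = 0 := by
  rw [delBar_apply, derivDist_single_surfaceDelta z₀ hj, derivDist_single_surfaceDelta z₀ hj]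
  simp [dist_smul_zero]

lemma surfaceDelta_productBump_ne_zero (z₀ : ℂ) :
    surfaceDelta z₀ (toTest (productBump z₀)) ≠ 0 := by
  have hb := isTest_productBump z₀
  let r : ℂ × ℂ → ℝ := fun v => ∏ i, unitBump (fibreCoord i (surfaceEmb z₀ v))
  have hr : ∀ v, productBump z₀ (surfaceEmb z₀ v) = (r v : ℂ) := by
    intro v
    have : surfaceEmb z₀ v 0 = z₀ := rfl
    rw [productBump, this, sub_self, cutoff_eq_one (by simp), one_mul, Complex.ofReal_prod]
  rw [surfaceDelta_apply, coe_toTest hb]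
  simp only [hr]
  have hre : ∫ v, (r v : ℂ) = ((∫ v, r v : ℝ) : ℂ) := integral_ofReal
  rw [hre, Complex.ofReal_ne_zero]
  have hcont : Continuous r := continuous_finsetProd _ fun i _ =>
    contDiff_unitBump.continuous.comp ((fibreCoord i).continuous.comp (continuous_surfaceEmb z₀))
  have hnonneg : 0 ≤ r := fun v => Finset.prod_nonneg fun i _ => ContDiffBump.nonneg_normed _ _
  have hne : r 0 ≠ 0 := by
    refine Finset.prod_ne_zero_iff.2 fun i _ => ?_
    have h0 : fibreCoord i (surfaceEmb z₀ 0) = 0 := by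
      fin_cases i <;> simp [fibreCoord, surfaceEmb]
    rw [h0]
    have : (0 : ℝ) ∈ Function.support unitBump := by
      rw [unitBump, ContDiffBump.support_normed_eq]
      simp
    exact this
  exact (hcont.integral_pos_of_hasCompactSupport_nonneg_nonzero
    ((hasCompactSupport_surface hb z₀).mono fun v hv => by
      rw [Function.mem_support, hr]
      exact Complex.ofReal_ne_zero.2 hv) hnonneg hne).ne'

/-- A distribution on a surface that is holomorphic and homogeneous of degree zero along the fibre
is a multiple of the delta distribution. -/
lemma IsTransverse.exists_smul_surfaceDelta {z₀ : ℂ} {D : Dist} (hD : IsTransverse z₀ D)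
    (hH : IsHomogeneous D) : ∃ c : ℂ, D = c • surfaceDelta z₀ := by
  obtain ⟨h1, h2⟩ := hH.del_eq_zero
  have hne := surfaceDelta_productBump_ne_zero z₀
  -- The constant that makes the difference vanish on the one test function that detects
  -- translation-invariant transverse distributions.
  let c := D (toTest (productBump z₀)) / surfaceDelta z₀ (toTest (productBump z₀))
  refine ⟨c, ?_⟩
  rw [← sub_eq_zero]
  have hδ := isTransverse_surfaceDelta z₀
  have ht : IsTransverse z₀ (D - c • surfaceDelta z₀) :=
    ⟨Submodule.sub_mem _ hD.mem (Submodule.smul_mem _ _ hδ.mem),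
      by rw [map_sub, map_smul, hD.mulNormal_eq, hδ.mulNormal_eq]; simp [dist_smul_zero],
      by rw [map_sub, map_smul, hD.mulNormalBar_eq, hδ.mulNormalBar_eq]; simp [dist_smul_zero]⟩
  have hsingle : ∀ j : Fin 3, j ≠ 0 → ∀ η, derivDist (Pi.single j η) (D - c • surfaceDelta z₀) = 0 := by
    intro j hj η
    have hDj : derivDist (Pi.single j η) D = 0 := by
      fin_cases j
      · exact absurd rfl hj
      · have := derivDist_single hH.delBar₁ η
        rw [h1] at this
        simpa [dist_smul_zero] using this
      · have := derivDist_single hH.delBar₂ η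
        rw [h2] at this
        simpa [dist_smul_zero] using this
    rw [map_sub, map_smul, hDj, derivDist_single_surfaceDelta z₀ hj]
    simp [dist_smul_zero]
  refine ht.eq_zero_of_invariant (fun i => ?_) ?_
  · fin_cases i
    exacts [hsingle 1 (by decide) _, hsingle 1 (by decide) _, hsingle 2 (by decide) _,
      hsingle 2 (by decide) _]
  · simp only [sub_apply, smul_apply, smul_eq_mul, c]
    rw [div_mul_cancel₀ _ hne, sub_self]

/-! ### Polynomial densities -/

/-- The distribution with density `v₁ ^ i * v₂ ^ j` on the surface `p 0 = z₀`. -/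
def monomialDist (z₀ : ℂ) (i j : ℕ) : Dist := surfaceDist z₀ fun p => p 1 ^ i * p 2 ^ j

lemma monomialDist_zero (z₀ : ℂ) : monomialDist z₀ 0 0 = surfaceDelta z₀ := by
  simp [monomialDist, surfaceDelta]

lemma continuous_monomial (i j : ℕ) : Continuous fun p : Chart => p 1 ^ i * p 2 ^ j := by
  fun_prop

lemma mulCoord_one_monomialDist (z₀ : ℂ) (i j : ℕ) :
    mulCoord 1 (monomialDist z₀ i j) = monomialDist z₀ (i + 1) j := by
  rw [mulCoord, monomialDist, mulDist_surfaceDist z₀ (continuous_monomial i j), monomialDist]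
  congr 1
  funext p
  ring

lemma mulCoord_two_monomialDist (z₀ : ℂ) (i j : ℕ) :
    mulCoord 2 (monomialDist z₀ i j) = monomialDist z₀ i (j + 1) := by
  rw [mulCoord, monomialDist, mulDist_surfaceDist z₀ (continuous_monomial i j), monomialDist]
  congr 1
  funext p
  ring

/-- The distributions on a surface whose densities are homogeneous polynomials of degree `m`. -/
def polynomialDists (z₀ : ℂ) (m : ℕ) : Submodule ℂ Dist :=
  Submodule.span ℂ {T | ∃ i j, i + j = m ∧ T = monomialDist z₀ i j}

/-- Distributions on a surface that are holomorphic along the fibre, without transverse derivatives,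
and homogeneous of degree `m`. -/
structure IsPrimary (z₀ : ℂ) (m : ℂ) (D : Dist) : Prop extends IsTransverse z₀ D where
  delBar₁ : delBar 1 D = 0
  delBar₂ : delBar 2 D = 0
  fibreEuler_eq : fibreEuler D = m • D

lemma isPrimary_surfaceDelta (z₀ : ℂ) : IsPrimary z₀ 0 (surfaceDelta z₀) :=
  ⟨isTransverse_surfaceDelta z₀, delBar_surfaceDelta z₀ (by decide),
    delBar_surfaceDelta z₀ (by decide), by
    rw [fibreEuler_apply, del_surfaceDelta z₀ (by decide), del_surfaceDelta z₀ (by decide)]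
    simp [dist_zero_smul]⟩

lemma dist_add_smul (a b : ℂ) (T : Dist) : (a + b) • T = a • T + b • T := by module

lemma IsPrimary.mulCoord {z₀ m : ℂ} {D : Dist} (hD : IsPrimary z₀ m D) {j : Fin 3} (hj : j ≠ 0) :
    IsPrimary z₀ (m + 1) (mulCoord j D) := by
  refine ⟨⟨mulDist_mem_vanishing hD.mem _ _, ?_, ?_⟩, ?_, ?_, ?_⟩
  · rw [mulNormal_mulCoord, hD.mulNormal_eq, map_zero]
  · rw [mulNormalBar_mulCoord, hD.mulNormalBar_eq, map_zero]
  · rw [delBar_mulCoord, hD.delBar₁, map_zero]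
  · rw [delBar_mulCoord, hD.delBar₂, map_zero]
  · have h := hD.fibreEuler_eq
    rw [fibreEuler_apply] at h ⊢
    have key : Twistor.mulCoord j (Twistor.mulCoord 1 (del 1 D) + Twistor.mulCoord 2 (del 2 D))
        = m • Twistor.mulCoord j D := by rw [h, map_smul]
    rw [map_add] at key
    fin_cases j
    · exact absurd rfl hj
    · simp only [Fin.mk_one] at key ⊢
      rw [del_mulCoord_self, del_mulCoord _ (by decide : (2 : Fin 3) ≠ 1), map_add,
        mulCoord_comm _ 2 1, dist_add_smul, ← key]
      module
    · simp only [Fin.reduceFinMk] at key ⊢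
      rw [del_mulCoord_self, del_mulCoord _ (by decide : (1 : Fin 3) ≠ 2), map_add,
        mulCoord_comm _ 1 2, dist_add_smul, ← key]
      module

lemma isPrimary_monomialDist (z₀ : ℂ) (i j : ℕ) :
    IsPrimary z₀ ((i + j : ℕ) : ℂ) (monomialDist z₀ i j) := by
  induction i with
  | zero =>
    induction j with
    | zero =>
      rw [monomialDist_zero]
      simpa using isPrimary_surfaceDelta z₀
    | succ j ih =>
      rw [← mulCoord_two_monomialDist]
      have := ih.mulCoord (by decide : (2 : Fin 3) ≠ 0)
      push_cast at this ⊢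
      rwa [← add_assoc]
  | succ i ih =>
    rw [← mulCoord_one_monomialDist]
    have := ih.mulCoord (by decide : (1 : Fin 3) ≠ 0)
    push_cast at this ⊢
    rwa [add_right_comm]

lemma IsPrimary.add {z₀ m : ℂ} {D D' : Dist} (h : IsPrimary z₀ m D) (h' : IsPrimary z₀ m D') :
    IsPrimary z₀ m (D + D') :=
  ⟨⟨Submodule.add_mem _ h.mem h'.mem, by rw [map_add, h.mulNormal_eq, h'.mulNormal_eq, add_zero],
    by rw [map_add, h.mulNormalBar_eq, h'.mulNormalBar_eq, add_zero]⟩,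
    by rw [map_add, h.delBar₁, h'.delBar₁, add_zero], by rw [map_add, h.delBar₂, h'.delBar₂, add_zero],
    by rw [map_add, h.fibreEuler_eq, h'.fibreEuler_eq]; module⟩

lemma IsPrimary.smul {z₀ m : ℂ} {D : Dist} (h : IsPrimary z₀ m D) (c : ℂ) :
    IsPrimary z₀ m (c • D) :=
  ⟨⟨Submodule.smul_mem _ _ h.mem, by rw [map_smul, h.mulNormal_eq, dist_smul_zero],
    by rw [map_smul, h.mulNormalBar_eq, dist_smul_zero]⟩,
    by rw [map_smul, h.delBar₁, dist_smul_zero], by rw [map_smul, h.delBar₂, dist_smul_zero],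
    by rw [map_smul, h.fibreEuler_eq]; module⟩

lemma mulCoord_mem_polynomialDists {z₀ : ℂ} {m : ℕ} {T : Dist} (hT : T ∈ polynomialDists z₀ m)
    {a : Fin 3} (ha : a ≠ 0) : mulCoord a T ∈ polynomialDists z₀ (m + 1) := by
  have h : polynomialDists z₀ m ≤ (polynomialDists z₀ (m + 1)).comap (mulCoord a) := by
    refine Submodule.span_le.2 ?_
    rintro _ ⟨i, j, rfl, rfl⟩
    refine Submodule.subset_span ?_
    fin_cases a
    · exact absurd rfl ha
    · exact ⟨i + 1, j, by ring, mulCoord_one_monomialDist z₀ i j⟩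
    · exact ⟨i, j + 1, by ring, mulCoord_two_monomialDist z₀ i j⟩
  exact h hT

lemma IsPrimary.del {z₀ m : ℂ} {D : Dist} (hD : IsPrimary z₀ (m + 1) D) {j : Fin 3} (hj : j ≠ 0) :
    IsPrimary z₀ m (del j D) := by
  refine ⟨⟨del_mem_vanishing hD.mem j, ?_, ?_⟩, ?_, ?_, ?_⟩
  · rw [← del_mulNormal z₀ D hj, hD.mulNormal_eq, map_zero]
  · rw [← del_mulNormalBar, hD.mulNormalBar_eq, map_zero]
  · rw [← del_delBar_comm, hD.delBar₁, map_zero]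
  · rw [← del_delBar_comm, hD.delBar₂, map_zero]
  · have h := hD.fibreEuler_eq
    fin_cases j
    · exact absurd rfl hj
    · refine (fibreEuler_del₁ D).trans ?_
      rw [h, map_smul]
      simp only [Fin.mk_one]
      module
    · refine (fibreEuler_del₂ D).trans ?_
      rw [h, map_smul]
      simp only [Fin.reduceFinMk]
      module

/-- Induction on the degree: Euler's identity writes `(m + 1) D` as `p₁ ∂₁D + p₂ ∂₂D`, with `∂₁D`
and `∂₂D` primary of degree `m`. Degree zero is the multiple of the surface delta. -/
lemma IsPrimary.mem_polynomialDists {z₀ : ℂ} {m : ℕ} {D : Dist} (hD : IsPrimary z₀ m D) :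
    D ∈ polynomialDists z₀ m := by
  induction m generalizing D with
  | zero =>
    obtain ⟨c, rfl⟩ := hD.toIsTransverse.exists_smul_surfaceDelta ⟨hD.delBar₁, hD.delBar₂, by
      rw [hD.fibreEuler_eq, Nat.cast_zero, dist_zero_smul]⟩
    exact Submodule.smul_mem _ _ (Submodule.subset_span ⟨0, 0, rfl, (monomialDist_zero z₀).symm⟩)
  | succ m ih =>
    have hD' : IsPrimary z₀ ((m : ℂ) + 1) D := by exact_mod_cast hD
    have h := hD'.fibreEuler_eq
    rw [fibreEuler_apply] at h
    have hne : (m : ℂ) + 1 ≠ 0 := by exact_mod_cast Nat.succ_ne_zero m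
    rw [← Submodule.smul_mem_iff _ hne, ← h]
    exact Submodule.add_mem _
      (mulCoord_mem_polynomialDists (ih (hD'.del (by decide))) (by decide))
      (mulCoord_mem_polynomialDists (ih (hD'.del (by decide))) (by decide))

/-! ### The projection to space-time -/

/-- The factor `1 / (1 + |z|²)`. -/
def fubini (p : Chart) : ℂ := (1 + (‖p 0‖ : ℂ) ^ 2)⁻¹

lemma one_add_norm_sq_ne_zero (p : Chart) : (1 + (‖p 0‖ : ℂ) ^ 2) ≠ 0 := by
  have : (1 + (‖p 0‖ : ℂ) ^ 2) = ((1 + ‖p 0‖ ^ 2 : ℝ) : ℂ) := by push_cast; rfl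
  rw [this, Complex.ofReal_ne_zero]
  positivity

lemma contDiff_norm_sq : ContDiff ℝ ((⊤ : ℕ∞) : WithTop ℕ∞) fun p : Chart => (‖p 0‖ : ℂ) ^ 2 := by
  simp only [← Complex.mul_conj']
  exact (contDiff_coord 0).mul (contDiff_conj.comp (contDiff_coord 0))

lemma contDiff_fubini : ContDiff ℝ ((⊤ : ℕ∞) : WithTop ℕ∞) fubini :=
  (contDiff_const.add contDiff_norm_sq).inv one_add_norm_sq_ne_zero

lemma contDiff_alpha : ContDiff ℝ ((⊤ : ℕ∞) : WithTop ℕ∞) alpha :=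
  ((contDiff_coord 1).sub ((contDiff_coord 0).mul (contDiff_conj.comp (contDiff_coord 2)))).mul
    contDiff_fubini

lemma contDiff_beta : ContDiff ℝ ((⊤ : ℕ∞) : WithTop ℕ∞) beta :=
  ((contDiff_coord 2).add ((contDiff_coord 0).mul (contDiff_conj.comp (contDiff_coord 1)))).mul
    contDiff_fubini

lemma contDiff_toSpacetime : ContDiff ℝ ((⊤ : ℕ∞) : WithTop ℕ∞) toSpacetime := by
  rw [contDiff_euclidean]
  intro i
  fin_cases i
  exacts [Complex.reCLM.contDiff.comp contDiff_alpha, Complex.imCLM.contDiff.comp contDiff_alpha,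
    Complex.reCLM.contDiff.comp contDiff_beta, Complex.imCLM.contDiff.comp contDiff_beta]

/-- The direction of the line through a twistor. -/
def lineDirection (p : Chart) : Chart := fun a => conj (lineSlope p a)

lemma lineDirection_zero (p : Chart) : lineDirection p 0 = 1 := by
  simp [lineDirection, lineSlope]

lemma lineDirection_one (p : Chart) : lineDirection p 1 = conj (beta p) := by
  simp [lineDirection, lineSlope]

lemma lineDirection_two (p : Chart) : lineDirection p 2 = -conj (alpha p) := by
  simp [lineDirection, lineSlope]

lemma alpha_mul (p : Chart) : alpha p * (1 + p 0 * conj (p 0)) = p 1 - p 0 * conj (p 2) := by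
  rw [Complex.mul_conj', alpha, div_mul_cancel₀ _ (one_add_norm_sq_ne_zero p)]

lemma beta_mul (p : Chart) : beta p * (1 + p 0 * conj (p 0)) = p 2 + p 0 * conj (p 1) := by
  rw [Complex.mul_conj', beta, div_mul_cancel₀ _ (one_add_norm_sq_ne_zero p)]

lemma conj_alpha_mul (p : Chart) :
    conj (alpha p) * (1 + p 0 * conj (p 0)) = conj (p 1) - conj (p 0) * p 2 := by
  have := congrArg conj (alpha_mul p)
  simpa [mul_comm (conj (p 0))] using this

lemma conj_beta_mul (p : Chart) :
    conj (beta p) * (1 + p 0 * conj (p 0)) = conj (p 2) + conj (p 0) * p 1 := by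
  have := congrArg conj (beta_mul p)
  simpa [mul_comm (conj (p 0))] using this

lemma coord_one_eq (p : Chart) : p 1 = alpha p + p 0 * conj (beta p) := by
  have hne := one_add_norm_sq_ne_zero p
  rw [← Complex.mul_conj'] at hne
  apply mul_right_cancel₀ hne
  linear_combination -alpha_mul p - p 0 * conj_beta_mul p

lemma coord_two_eq (p : Chart) : p 2 = beta p - p 0 * conj (alpha p) := by
  have hne := one_add_norm_sq_ne_zero p
  rw [← Complex.mul_conj'] at hne
  apply mul_right_cancel₀ hne
  linear_combination -beta_mul p + p 0 * conj_alpha_mul p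

lemma alpha_eq_of {p : Chart} {a b : ℂ} (h1 : p 1 = a + p 0 * conj b) (h2 : p 2 = b - p 0 * conj a) :
    alpha p = a := by
  have hne := one_add_norm_sq_ne_zero p
  rw [← Complex.mul_conj'] at hne
  apply mul_right_cancel₀ hne
  rw [alpha_mul, h1, h2]
  simp only [map_sub, map_mul, Complex.conj_conj]
  ring

lemma beta_eq_of {p : Chart} {a b : ℂ} (h1 : p 1 = a + p 0 * conj b) (h2 : p 2 = b - p 0 * conj a) :
    beta p = b := by
  have hne := one_add_norm_sq_ne_zero p
  rw [← Complex.mul_conj'] at hne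
  apply mul_right_cancel₀ hne
  rw [beta_mul, h1, h2]
  simp only [map_add, map_mul, Complex.conj_conj]
  ring

/-- With `α, β` fixed, the points `(z, α + z β̄, β - z ᾱ)` form one twistor line, and its direction
is `(1, β̄, -ᾱ)`. -/
lemma toSpacetime_add_smul (p : Chart) (c : ℂ) :
    toSpacetime (p + c • lineDirection p) = toSpacetime p := by
  have h1 : (p + c • lineDirection p) 1
      = alpha p + (p + c • lineDirection p) 0 * conj (beta p) := by
    simp only [Pi.add_apply, Pi.smul_apply, smul_eq_mul, lineDirection_zero, lineDirection_one]
    linear_combination coord_one_eq p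
  have h2 : (p + c • lineDirection p) 2
      = beta p - (p + c • lineDirection p) 0 * conj (alpha p) := by
    simp only [Pi.add_apply, Pi.smul_apply, smul_eq_mul, lineDirection_zero, lineDirection_two]
    linear_combination coord_two_eq p
  rw [toSpacetime, toSpacetime, alpha_eq_of h1 h2, beta_eq_of h1 h2]

lemma fderiv_toSpacetime_lineDirection (p : Chart) (c : ℂ) :
    fderiv ℝ toSpacetime p (c • lineDirection p) = 0 := by
  have h1 : HasDerivAt (fun t : ℝ => p + t • c • lineDirection p) (c • lineDirection p) 0 := by
    simpa using ((hasDerivAt_id (0 : ℝ)).smul_const (c • lineDirection p)).const_add p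
  have h2 := (contDiff_toSpacetime.differentiable (by simp)
    (p + (0 : ℝ) • c • lineDirection p)).hasFDerivAt.comp_hasDerivAt (0 : ℝ) h1
  have h3 : toSpacetime ∘ (fun t : ℝ => p + t • c • lineDirection p) = fun _ => toSpacetime p := by
    funext t
    have := toSpacetime_add_smul p (t * c)
    simp only [Function.comp_apply]
    rw [← this, ← Complex.real_smul, smul_assoc]
  rw [h3, zero_smul, add_zero] at h2
  exact h2.unique (hasDerivAt_const _ _)

/-! ### The antiholomorphic derivatives of functions -/

/-- The function `∂f/∂p̄ₐ`. -/
def funDelBar (a : Fin 3) (f : Chart → ℂ) (p : Chart) : ℂ :=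
  1 / 2 * (fderiv ℝ f p (Pi.single a 1) + Complex.I * fderiv ℝ f p (Pi.single a Complex.I))

lemma isTest_funDelBar (a : Fin 3) {f : Chart → ℂ} (hf : IsTest f) : IsTest (funDelBar a f) :=
  IsTest.mul_left contDiff_const ((hf.fderiv _).add (IsTest.mul_left contDiff_const (hf.fderiv _)))

lemma delBar_toTest (a : Fin 3) (T : Dist) {f : Chart → ℂ} (hf : IsTest f) :
    delBar a T (toTest f) = -T (toTest (funDelBar a f)) := by
  have h1 := hf.fderiv (Pi.single a 1)
  have h2 := hf.fderiv (Pi.single a Complex.I)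
  have h3 := IsTest.mul_left (f := fun _ => Complex.I) contDiff_const h2
  have e : toTest (funDelBar a f) = (1 / 2 : ℂ) • (toTest (fun p => fderiv ℝ f p (Pi.single a 1))
      + Complex.I • toTest (fun p => fderiv ℝ f p (Pi.single a Complex.I))) := by
    rw [← toTest_const_mul _ h2, ← toTest_add h1 h3, ← toTest_const_mul _ (h1.add h3)]
    rfl
  rw [delBar_apply, e, map_smul, map_add, map_smul]
  simp only [smul_apply, add_apply, derivDist_toTest _ _ hf, smul_eq_mul]
  ring

lemma funDelBar_mul (a : Fin 3) {f g : Chart → ℂ} {p : Chart} (hf : DifferentiableAt ℝ f p)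
    (hg : DifferentiableAt ℝ g p) : funDelBar a (fun p => f p * g p) p =
      f p * funDelBar a g p + g p * funDelBar a f p := by
  simp only [funDelBar, fderiv_fun_mul hf hg, add_apply, smul_apply, smul_eq_mul]
  ring

lemma fderiv_single_eq {f : Chart → ℂ} {p : Chart} (hf : DifferentiableAt ℝ f p) {a : Fin 3} {η d : ℂ}
    (h : HasDerivAt (fun t : ℝ => f (p + t • (Pi.single a η : Chart))) d 0) :
    fderiv ℝ f p (Pi.single a η) = d := by
  have h1 : HasDerivAt (fun t : ℝ => p + t • (Pi.single a η : Chart)) (Pi.single a η) 0 := by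
    simpa using ((hasDerivAt_id (0 : ℝ)).smul_const (Pi.single a η : Chart)).const_add p
  have hf' : DifferentiableAt ℝ f (p + (0 : ℝ) • (Pi.single a η : Chart)) := by simpa using hf
  have h2 := (hf'.hasFDerivAt.comp_hasDerivAt (0 : ℝ) h1).unique h
  simpa using h2

lemma differentiable_fubini : Differentiable ℝ fubini := contDiff_fubini.differentiable (by simp)

lemma differentiable_alpha : Differentiable ℝ alpha := contDiff_alpha.differentiable (by simp)

lemma differentiable_beta : Differentiable ℝ beta := contDiff_beta.differentiable (by simp)

lemma fubini_eq (p : Chart) : fubini p = (1 + p 0 * conj (p 0))⁻¹ := by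
  rw [fubini, Complex.mul_conj']

lemma funDelBar_zero_fubini (p : Chart) : funDelBar 0 fubini p = -(p 0 * fubini p ^ 2) := by
  have hne := one_add_norm_sq_ne_zero p
  rw [← Complex.mul_conj'] at hne
  have key : ∀ η : ℂ, fderiv ℝ fubini p (Pi.single 0 η)
      = -((η * conj (p 0) + p 0 * conj η) * fubini p ^ 2) := by
    intro η
    refine fderiv_single_eq (differentiable_fubini p) ?_
    simp only [fubini_eq]
    have h1 : HasDerivAt (fun t : ℝ => (p + t • (Pi.single 0 η : Chart)) 0) η 0 := by
      simpa using ((Complex.ofRealCLM.hasDerivAt (x := 0)).mul_const η).const_add (p 0)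
    have h2 : HasDerivAt (fun t : ℝ => conj ((p + t • (Pi.single 0 η : Chart)) 0)) (conj η) 0 :=
      Complex.conjCLE.toContinuousLinearMap.hasFDerivAt.comp_hasDerivAt (0 : ℝ) h1
    have h3 := ((h1.fun_mul h2).const_add 1).fun_inv (by simpa using hne)
    refine h3.congr_deriv ?_
    simp only [zero_smul, add_zero]
    field_simp
  rw [funDelBar, key, key]
  simp only [map_one, Complex.conj_I]
  linear_combination (-(1 / 2) * (conj (p 0) - p 0) * fubini p ^ 2) * Complex.I_sq

lemma funDelBar_fubini {a : Fin 3} (ha : a ≠ 0) (p : Chart) : funDelBar a fubini p = 0 := by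
  have key : ∀ η : ℂ, fderiv ℝ fubini p (Pi.single a η) = 0 := by
    intro η
    refine fderiv_single_eq (differentiable_fubini p) ?_
    have : (fun t : ℝ => fubini (p + t • (Pi.single a η : Chart))) = fun _ => fubini p := by
      funext t
      simp [fubini, ha.symm]
    rw [this]
    exact hasDerivAt_const _ _
  rw [funDelBar, key, key]
  ring

lemma funDelBar_one_beta (p : Chart) : funDelBar 1 beta p = p 0 * fubini p := by
  have key : ∀ η : ℂ, fderiv ℝ beta p (Pi.single 1 η) = p 0 * conj η * fubini p := by
    intro η
    refine fderiv_single_eq (differentiable_beta p) ?_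
    have : (fun t : ℝ => beta (p + t • (Pi.single 1 η : Chart)))
        = fun t : ℝ => beta p + t * (p 0 * conj η * fubini p) := by
      funext t
      simp [beta, fubini]
      ring
    rw [this]
    simpa using ((Complex.ofRealCLM.hasDerivAt (x := 0)).mul_const
      (p 0 * conj η * fubini p)).const_add (beta p)
  rw [funDelBar, key, key]
  simp only [map_one, Complex.conj_I]
  linear_combination (-(1 / 2) * p 0 * fubini p) * Complex.I_sq

lemma funDelBar_two_alpha (p : Chart) : funDelBar 2 alpha p = -(p 0 * fubini p) := by
  have key : ∀ η : ℂ, fderiv ℝ alpha p (Pi.single 2 η) = -(p 0 * conj η * fubini p) := by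
    intro η
    refine fderiv_single_eq (differentiable_alpha p) ?_
    have : (fun t : ℝ => alpha (p + t • (Pi.single 2 η : Chart)))
        = fun t : ℝ => alpha p + t * -(p 0 * conj η * fubini p) := by
      funext t
      simp [alpha, fubini]
      ring
    rw [this]
    simpa using ((Complex.ofRealCLM.hasDerivAt (x := 0)).mul_const
      (-(p 0 * conj η * fubini p))).const_add (alpha p)
  rw [funDelBar, key, key]
  simp only [map_one, Complex.conj_I]
  linear_combination ((1 / 2) * p 0 * fubini p) * Complex.I_sq

lemma fderiv_eq_sum_single (L : Chart →L[ℝ] ℂ) (v : Chart) : L v = ∑ a,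
    (((v a).re : ℂ) * L (Pi.single a 1) + ((v a).im : ℂ) * L (Pi.single a Complex.I)) := by
  have : v = ∑ a, ((v a).re • (Pi.single a 1 : Chart) + (v a).im • (Pi.single a Complex.I : Chart)) := by
    funext b
    rw [Finset.sum_apply, Finset.sum_eq_single b]
    · simp [Complex.re_add_im]
    · intro c _ hc
      simp [hc.symm]
    · simp
  conv_lhs => rw [this]
  simp only [map_sum, map_add, map_smul, Complex.real_smul]

/-- A function pulled back from `ℝ⁴` is constant on twistor lines. Its real derivatives along the
line direction and `i` times that direction combine into the antiholomorphic derivative along the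
line. -/
lemma sum_lineSlope_mul_funDelBar {ψ : Spacetime → ℂ} (hψ : Differentiable ℝ ψ) (p : Chart) :
    ∑ a, lineSlope p a * funDelBar a (fun p => ψ (toSpacetime p)) p = 0 := by
  have hX := contDiff_toSpacetime.differentiable (by simp)
  have hcomp : fderiv ℝ (fun p => ψ (toSpacetime p)) p
      = (fderiv ℝ ψ (toSpacetime p)).comp (fderiv ℝ toSpacetime p) :=
    ((hψ _).hasFDerivAt.comp p (hX p).hasFDerivAt).fderiv
  set L := fderiv ℝ (fun p => ψ (toSpacetime p)) p with hL
  have h : ∀ c : ℂ, L (c • lineDirection p) = 0 := by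
    intro c
    rw [hcomp, ContinuousLinearMap.comp_apply, fderiv_toSpacetime_lineDirection, map_zero]
  have h1 := h 1
  have h2 := h Complex.I
  rw [fderiv_eq_sum_single] at h1 h2
  have e : ∀ a, lineSlope p a * funDelBar a (fun p => ψ (toSpacetime p)) p =
      1 / 2 * ((((1 : ℂ) • lineDirection p) a).re * L (Pi.single a 1)
        + (((1 : ℂ) • lineDirection p) a).im * L (Pi.single a Complex.I))
      + Complex.I / 2 * (((Complex.I • lineDirection p) a).re * L (Pi.single a 1)
        + ((Complex.I • lineDirection p) a).im * L (Pi.single a Complex.I)) := by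
    intro a
    simp only [funDelBar, ← hL, Pi.smul_apply, smul_eq_mul, lineDirection,
      Complex.mul_re, Complex.mul_im, Complex.I_re, Complex.I_im, Complex.one_re, Complex.one_im, Complex.conj_re, Complex.conj_im]
    conv_lhs => rw [← Complex.re_add_im (lineSlope p a)]
    push_cast
    linear_combination ((lineSlope p a).im / 2 * L (Pi.single a Complex.I)) * Complex.I_sq
  simp only [e, Finset.sum_add_distrib, ← Finset.mul_sum]
  simp only [← Finset.sum_add_distrib, h1, h2, mul_zero, add_zero]

/-- The functions that represent integration over the twistor lines. -/
def lineDensity (ψ : Spacetime → ℂ) (a : Fin 3) (p : Chart) : ℂ :=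
  lineSlope p a * ψ (toSpacetime p) / (1 + (‖p 0‖ : ℂ) ^ 2) ^ 2

lemma lineDensity_eq (ψ : Spacetime → ℂ) (a : Fin 3) : lineDensity ψ a = fun p =>
    (lineSlope p a * (fubini p * fubini p)) * ψ (toSpacetime p) := by
  funext p
  rw [lineDensity, fubini, div_eq_mul_inv, ← inv_pow]
  ring

/-- The pulled-back factor is constant along the lines. For the weight, the `z̄`-derivative of `(1 +
|z|²)⁻²` gives `-2z (1 + |z|²)⁻³`, which cancels the divergence `2z (1 + |z|²)⁻¹` of the slopes
times the weight. -/
lemma sum_funDelBar_lineDensity {ψ : Spacetime → ℂ} (hψ : Differentiable ℝ ψ) (p : Chart) :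
    ∑ a, funDelBar a (lineDensity ψ a) p = 0 := by
  have hX := contDiff_toSpacetime.differentiable (by simp)
  have hh : DifferentiableAt ℝ (fun p => ψ (toSpacetime p)) p := (hψ _).comp p (hX p)
  have hJ := differentiable_fubini p
  have hJ2 : DifferentiableAt ℝ (fun p => fubini p * fubini p) p := hJ.fun_mul hJ
  have hs : ∀ a, DifferentiableAt ℝ (fun p => lineSlope p a) p := by
    intro a
    fin_cases a
    exacts [differentiableAt_const _, differentiable_beta p, (differentiable_alpha p).fun_neg]
  have hdiv : ∀ a, funDelBar a (lineDensity ψ a) p =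
      fubini p ^ 2 * (lineSlope p a * funDelBar a (fun p => ψ (toSpacetime p)) p)
      + ψ (toSpacetime p) * (2 * lineSlope p a * fubini p * funDelBar a fubini p
        + fubini p ^ 2 * funDelBar a (fun p => lineSlope p a) p) := by
    intro a
    rw [lineDensity_eq, funDelBar_mul a ((hs a).fun_mul hJ2) hh, funDelBar_mul a (hs a) hJ2,
      funDelBar_mul a hJ hJ]
    ring
  have h0 : funDelBar 0 (fun p => lineSlope p 0) p = 0 := by
    have : (fun p => lineSlope p 0) = fun _ => (1 : ℂ) := rfl
    rw [this, funDelBar]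
    simp
  have h1 : funDelBar 1 (fun p => lineSlope p 1) p = p 0 * fubini p := funDelBar_one_beta p
  have h2 : funDelBar 2 (fun p => lineSlope p 2) p = p 0 * fubini p := by
    have : (fun p => lineSlope p 2) = fun p => -alpha p := rfl
    rw [this, ← neg_eq_iff_eq_neg.2 (funDelBar_two_alpha p), funDelBar, funDelBar, fderiv_fun_neg]
    simp only [neg_apply]
    ring
  have hs0 : lineSlope p 0 = 1 := rfl
  simp only [hdiv, Finset.sum_add_distrib, ← Finset.mul_sum, sum_lineSlope_mul_funDelBar hψ p]
  rw [Fin.sum_univ_three, Fin.sum_univ_three, h0, h1, h2, funDelBar_zero_fubini,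
    funDelBar_fubini (by decide : (1 : Fin 3) ≠ 0), funDelBar_fubini (by decide : (2 : Fin 3) ≠ 0),
    hs0]
  ring

/-- Gauge invariance of the line integral. Moving `∂̄` onto the test functions leaves a divergence
that is zero near the support of `χ`. Equality of `Φ` with the density near the surface, not just on
it, is needed to compare derivatives. -/
lemma sum_dbar_apply_eq_zero {z₀ : ℂ} {χ : Dist} (hχ : χ ∈ supportedOn z₀)
    {ψ : Spacetime → ℂ} (hψ : Differentiable ℝ ψ) (Φ : Fin 3 → Test)
    (hΦ : ∀ a, ∀ᶠ p in 𝓝ˢ {p : Chart | p 0 = z₀}, Φ a p = lineDensity ψ a p) :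
    ∑ a, dbar χ a (Φ a) = 0 := by
  have ht := fun a => isTest_coe (Φ a)
  have hb := fun a => isTest_funDelBar a (ht a)
  have e : ∑ a, dbar χ a (Φ a) = -χ (toTest fun p =>
      funDelBar 0 (Φ 0) p + funDelBar 1 (Φ 1) p + funDelBar 2 (Φ 2) p) := by
    rw [toTest_add ((hb 0).add (hb 1)) (hb 2), toTest_add (hb 0) (hb 1), map_add, map_add,
      Fin.sum_univ_three]
    simp only [dbar_apply]
    have h : ∀ a, delBar a χ (Φ a) = -χ (toTest (funDelBar a (Φ a))) := by
      intro a
      rw [← delBar_toTest a χ (ht a), toTest_coe]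
    rw [h, h, h]
    ring
  have hz : IsTest fun _ : Chart => (0 : ℂ) := ⟨contDiff_const, HasCompactSupport.zero⟩
  rw [e, neg_eq_zero, eq_of_mem_supportedOn hχ (((hb 0).add (hb 1)).add (hb 2)) hz]
  · have : toTest (fun _ : Chart => (0 : ℂ)) = 0 := toTest_coe 0
    rw [this, map_zero]
  · have hall : ∀ᶠ p in 𝓝ˢ {p : Chart | p 0 = z₀}, ∀ a, Φ a p = lineDensity ψ a p :=
      Filter.eventually_all.2 hΦ
    obtain ⟨U, hU, hSU, hUeq⟩ := mem_nhdsSet_iff_exists.1 hall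
    refine mem_nhdsSet_iff_exists.2 ⟨U, hU, hSU, fun p hp => ?_⟩
    have hfd : ∀ a, funDelBar a (Φ a) p = funDelBar a (lineDensity ψ a) p := by
      intro a
      have : (Φ a : Chart → ℂ) =ᶠ[𝓝 p] lineDensity ψ a := by
        filter_upwards [hU.mem_nhds hp] with q hq
        exact hUeq hq a
      rw [funDelBar, funDelBar, this.fderiv_eq]
    have := sum_funDelBar_lineDensity hψ p
    rw [Fin.sum_univ_three] at this
    simp only [Set.mem_ofPred_eq, hfd, this]

/-! ### The change of variables from a surface to space-time -/

/-- The identification of `ℂ²` with `ℝ⁴`. -/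
def fromComplex (v : ℂ × ℂ) : Spacetime := !₂[v.1.re, v.1.im, v.2.re, v.2.im]

/-- The identification of `ℂ²` with `ℝ⁴` as an equivalence of measurable spaces. -/
def fromComplexEquiv : ℂ × ℂ ≃ᵐ Spacetime :=
  (((Complex.measurableEquivPi.prodCongr Complex.measurableEquivPi).trans
    (MeasurableEquiv.sumPiEquivProdPi fun _ : Fin 2 ⊕ Fin 2 => ℝ).symm).trans
    (MeasurableEquiv.piCongrLeft (fun _ : Fin 4 => ℝ) (finSumFinEquiv (m := 2) (n := 2)))).trans
    (MeasurableEquiv.toLp 2 _)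

lemma fromComplexEquiv_apply (v : ℂ × ℂ) : fromComplexEquiv v = fromComplex v := by
  ext i
  fin_cases i <;> rfl

lemma measurePreserving_fromComplexEquiv : MeasurePreserving fromComplexEquiv :=
  (PiLp.volume_preserving_toLp (Fin 4)).comp
    ((volume_measurePreserving_piCongrLeft (fun _ : Fin 4 => ℝ)
      (finSumFinEquiv (m := 2) (n := 2))).comp
      ((volume_measurePreserving_sumPiEquivProdPi_symm fun _ : Fin 2 ⊕ Fin 2 => ℝ).comp
        (Complex.volume_preserving_equiv_pi.prod Complex.volume_preserving_equiv_pi)))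

lemma integral_spacetime_eq (f : Spacetime → ℂ) : ∫ x, f x = ∫ v, f (fromComplex v) := by
  rw [← measurePreserving_fromComplexEquiv.integral_comp fromComplexEquiv.measurableEmbedding]
  simp only [fromComplexEquiv_apply]

/-- The evaluation of twistor lines at `z`, in complex coordinates on `ℝ⁴`. -/
def evalLine (z : ℂ) : ℂ × ℂ →L[ℝ] ℂ × ℂ :=
  (ContinuousLinearMap.fst ℝ ℂ ℂ
      + z • (Complex.conjCLE.toContinuousLinearMap ∘L ContinuousLinearMap.snd ℝ ℂ ℂ)).prod
    (ContinuousLinearMap.snd ℝ ℂ ℂ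
      - z • (Complex.conjCLE.toContinuousLinearMap ∘L ContinuousLinearMap.fst ℝ ℂ ℂ))

lemma evalLine_apply (z : ℂ) (v : ℂ × ℂ) :
    evalLine z v = (v.1 + z * conj v.2, v.2 - z * conj v.1) := rfl

lemma evalLine_eq (z : ℂ) (v : ℂ × ℂ) :
    evalLine z v = (v₁ z (fromComplex v), v₂ z (fromComplex v)) := by
  have e : ∀ w : ℂ, conj w = w.re - Complex.I * w.im := fun w => by
    conv_lhs => rw [← Complex.re_add_im w]
    simp only [map_add, map_mul, Complex.conj_ofReal, Complex.conj_I]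
    ring
  have e' : ∀ w : ℂ, w.re + Complex.I * w.im = w := fun w => by
    rw [mul_comm, Complex.re_add_im]
  rw [evalLine_apply, v₁, v₂]
  simp [fromComplex, e, e']

lemma toSpacetime_surfaceEmb_evalLine (z : ℂ) (v : ℂ × ℂ) :
    toSpacetime (surfaceEmb z (evalLine z v)) = fromComplex v := by
  have h1 : surfaceEmb z (evalLine z v) 1 = v.1 + surfaceEmb z (evalLine z v) 0 * conj v.2 := rfl
  have h2 : surfaceEmb z (evalLine z v) 2 = v.2 - surfaceEmb z (evalLine z v) 0 * conj v.1 := rfl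
  rw [toSpacetime, alpha_eq_of h1 h2, beta_eq_of h1 h2, fromComplex]

/-- With `S = diag(-1, 1)`, one has `S M S M = (1 + |z|²) id` on a real space of dimension four.
Since `(det S)² = 1`, this gives `(det M)² = (1 + |z|²)⁴`. -/
lemma abs_det_evalLine (z : ℂ) : |(evalLine z).det| = (1 + ‖z‖ ^ 2) ^ 2 := by
  let S : ℂ × ℂ →ₗ[ℝ] ℂ × ℂ := (-LinearMap.fst ℝ ℂ ℂ).prod (LinearMap.snd ℝ ℂ ℂ)
  let M : ℂ × ℂ →ₗ[ℝ] ℂ × ℂ := evalLine z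
  have hM : ∀ v, M v = (v.1 + z * conj v.2, v.2 - z * conj v.1) := fun v => rfl
  have hS : ∀ v, S v = (-v.1, v.2) := fun v => rfl
  have hSS : S ∘ₗ S = LinearMap.id := by
    ext v <;> simp [hS]
  have hSM : (S ∘ₗ M ∘ₗ S) ∘ₗ M = (1 + ‖z‖ ^ 2 : ℝ) • LinearMap.id := by
    refine LinearMap.ext fun v => Prod.ext ?_ ?_
    · simp only [LinearMap.comp_apply, hS, hM, LinearMap.smul_apply, LinearMap.id_apply,
        Prod.smul_fst, Complex.real_smul]
      push_cast
      rw [← Complex.mul_conj']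
      simp only [map_sub, map_mul, Complex.conj_conj]
      ring
    · simp only [LinearMap.comp_apply, hS, hM, LinearMap.smul_apply, LinearMap.id_apply,
        Prod.smul_snd, Complex.real_smul]
      push_cast
      rw [← Complex.mul_conj']
      simp only [map_add, map_neg, map_mul, Complex.conj_conj]
      ring
  have d1 := congrArg LinearMap.det hSS
  have d2 := congrArg LinearMap.det hSM
  rw [LinearMap.det_comp, LinearMap.det_id] at d1
  rw [LinearMap.det_comp, LinearMap.det_comp, LinearMap.det_comp, LinearMap.det_smul,
    LinearMap.det_id, mul_one, Module.finrank_prod, Complex.finrank_real_complex] at d2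
  have hdet : (evalLine z).det = LinearMap.det M := rfl
  have d3 : (evalLine z).det ^ 2 = ((1 + ‖z‖ ^ 2) ^ 2) ^ 2 := by
    rw [hdet]
    linear_combination d2 - LinearMap.det M ^ 2 * d1
  have := (sq_eq_sq_iff_abs_eq_abs _ _).1 d3
  rw [this, abs_of_nonneg (by positivity)]

lemma evalLine_injective (z : ℂ) : Function.Injective (evalLine z) := by
  intro v w h
  have h1 : fromComplex v = fromComplex w := by
    rw [← toSpacetime_surfaceEmb_evalLine z, h, toSpacetime_surfaceEmb_evalLine]
  rw [← fromComplexEquiv_apply, ← fromComplexEquiv_apply] at h1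
  exact fromComplexEquiv.injective h1

lemma evalLine_surjective (z : ℂ) : Function.Surjective (evalLine z) :=
  LinearMap.surjective_of_injective (f := (evalLine z : ℂ × ℂ →ₗ[ℝ] ℂ × ℂ)) (evalLine_injective z)

lemma integral_comp_evalLine (z : ℂ) (g : ℂ × ℂ → ℂ) :
    ∫ w, g w = ∫ v, (1 + (‖z‖ : ℂ) ^ 2) ^ 2 * g (evalLine z v) := by
  have : (volume : Measure (ℂ × ℂ)).IsAddHaarMeasure :=
    Measure.prod.instIsAddHaarMeasure volume volume
  have h := integral_image_eq_integral_abs_det_fderiv_smul (volume : Measure (ℂ × ℂ))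
    MeasurableSet.univ (f := evalLine z) (f' := fun _ => evalLine z)
    (fun v _ => (evalLine z).hasFDerivAt.hasFDerivWithinAt) (evalLine_injective z).injOn g
  rw [Set.image_univ, (evalLine_surjective z).range_eq, setIntegral_univ, setIntegral_univ,
    abs_det_evalLine] at h
  rw [h]
  congr 1
  funext v
  rw [Complex.real_smul]
  push_cast
  rfl

/-- Integrating a density on the surface `p 0 = z₀` over the twistor lines. -/
lemma integral_lineDensity (z₀ : ℂ) (P : Chart → ℂ) (ψ : Spacetime → ℂ) :
    ∫ v, lineDensity ψ 0 (surfaceEmb z₀ v) * P (surfaceEmb z₀ v) =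
      ∫ x, P ![z₀, v₁ z₀ x, v₂ z₀ x] * ψ x := by
  rw [integral_comp_evalLine z₀, integral_spacetime_eq]
  congr 1
  funext v
  have hs : lineSlope (surfaceEmb z₀ (evalLine z₀ v)) 0 = 1 := rfl
  have h0 : surfaceEmb z₀ (evalLine z₀ v) 0 = z₀ := rfl
  have hne := one_add_norm_sq_ne_zero (surfaceEmb z₀ (evalLine z₀ v))
  rw [lineDensity, hs, toSpacetime_surfaceEmb_evalLine, h0, one_mul]
  rw [h0] at hne
  have e : surfaceEmb z₀ (evalLine z₀ v)
      = ![z₀, v₁ z₀ (fromComplex v), v₂ z₀ (fromComplex v)] := by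
    rw [evalLine_eq, surfaceEmb]
  rw [e]
  field_simp

/-! ### Coefficients of homogeneous polynomials -/

lemma eq_zero_of_forall_sum_pow {m : ℕ} {a : Fin (m + 1) → ℂ}
    (h : ∀ t : ℂ, ∑ i, a i * t ^ (m - (i : ℕ)) = 0) : a = 0 := by
  let q : Polynomial ℂ := ∑ i, Polynomial.C (a i) * Polynomial.X ^ (m - (i : ℕ))
  have hq : q = 0 := by
    refine Polynomial.funext fun t => ?_
    simp only [q, Polynomial.eval_finsetSum, Polynomial.eval_mul, Polynomial.eval_C,
      Polynomial.eval_pow, Polynomial.eval_X, h, Polynomial.eval_zero]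
  funext j
  have hj : q.coeff (m - (j : ℕ)) = a j := by
    simp only [q, Polynomial.finsetSum_coeff, Polynomial.coeff_C_mul, Polynomial.coeff_X_pow]
    rw [Finset.sum_eq_single j]
    · simp
    · intro i _ hij
      have : m - (j : ℕ) ≠ m - (i : ℕ) := fun e => hij (Fin.ext (by omega))
      simp [this]
    · simp
  rw [← hj, hq, Polynomial.coeff_zero, Pi.zero_apply]

/-- The coefficients of `(v₁ + l v₂) ^ m`. -/
def binomialCoeffs (m : ℕ) (l : ℂ) (i : Fin (m + 1)) : ℂ := m.choose i * l ^ (m - (i : ℕ))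

lemma sum_binomialCoeffs (m : ℕ) (l a b : ℂ) :
    ∑ i, binomialCoeffs m l i * (a ^ (i : ℕ) * b ^ (m - (i : ℕ))) = (a + l * b) ^ m := by
  rw [add_pow, Finset.sum_range]
  refine Finset.sum_congr rfl fun i _ => ?_
  rw [binomialCoeffs, mul_pow]
  ring

/-- A functional that kills all these vectors gives a polynomial in `l` that vanishes identically.
Its coefficients are the functional's values on the basis times non-zero binomial coefficients. -/
lemma span_binomialCoeffs (m : ℕ) : Submodule.span ℂ (Set.range (binomialCoeffs m)) = ⊤ := by
  by_contra hne
  obtain ⟨f, hf0, hf⟩ := Submodule.exists_le_ker_of_lt_top _ (lt_top_iff_ne_top.2 hne)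
  apply hf0
  have hsum : ∀ c : Fin (m + 1) → ℂ, f c = ∑ i, c i * f (Pi.single i 1) := by
    intro c
    conv_lhs => rw [pi_eq_sum_univ' c]
    simp only [map_sum, map_smul, smul_eq_mul]
  have h0 := eq_zero_of_forall_sum_pow (a := fun i => m.choose i * f (Pi.single i 1)) fun t => by
    have h1 : f (binomialCoeffs m t) = 0 := hf (Submodule.subset_span ⟨t, rfl⟩)
    rw [hsum] at h1
    rw [← h1]
    refine Finset.sum_congr rfl fun i _ => ?_
    rw [binomialCoeffs]
    ring
  ext i
  have hi := congrFun h0 i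
  have hc : (m.choose i : ℂ) ≠ 0 :=
    Nat.cast_ne_zero.2 (Nat.choose_pos (Nat.lt_succ_iff.1 i.2)).ne'
  simpa [hc] using hi

/-! ### Coordinates on the spaces of primary states -/

/-- The function on space-time with given coefficients as a polynomial in `v₁` and `v₂`. -/
def coeffFun (z₀ : ℂ) (m : ℕ) : (Fin (m + 1) → ℂ) →ₗ[ℂ] (Spacetime → ℂ) :=
  Fintype.linearCombination ℂ fun (i : Fin (m + 1)) x => v₁ z₀ x ^ (i : ℕ) * v₂ z₀ x ^ (m - (i : ℕ))

lemma coeffFun_apply (z₀ : ℂ) (m : ℕ) (c : Fin (m + 1) → ℂ) (x : Spacetime) :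
    coeffFun z₀ m c x = ∑ i, c i * (v₁ z₀ x ^ (i : ℕ) * v₂ z₀ x ^ (m - (i : ℕ))) := by
  rw [coeffFun, Fintype.linearCombination_apply, Finset.sum_apply]
  rfl

/-- The distribution on a surface with given coefficients of its polynomial density. -/
def coeffDist (z₀ : ℂ) (m : ℕ) : (Fin (m + 1) → ℂ) →ₗ[ℂ] Dist :=
  Fintype.linearCombination ℂ fun i : Fin (m + 1) => monomialDist z₀ i (m - (i : ℕ))

lemma coeffDist_apply (z₀ : ℂ) (m : ℕ) (c : Fin (m + 1) → ℂ) :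
    coeffDist z₀ m c = ∑ i, c i • monomialDist z₀ i (m - (i : ℕ)) := by
  rw [coeffDist, Fintype.linearCombination_apply]

lemma coeffDist_eq_surfaceDist (z₀ : ℂ) (m : ℕ) (c : Fin (m + 1) → ℂ) :
    coeffDist z₀ m c = surfaceDist z₀ fun p => ∑ i, c i * (p 1 ^ (i : ℕ) * p 2 ^ (m - (i : ℕ))) := by
  have hcont : Continuous fun p : Chart => ∑ i, c i * (p 1 ^ (i : ℕ) * p 2 ^ (m - (i : ℕ))) :=
    continuous_finsetSum _ fun i _ => continuous_const.mul (continuous_monomial _ _)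
  ext g
  have hint : ∀ i : Fin (m + 1), Integrable fun v =>
      c i * (g (surfaceEmb z₀ v) * (surfaceEmb z₀ v 1 ^ (i : ℕ)
        * surfaceEmb z₀ v 2 ^ (m - (i : ℕ)))) := by
    intro i
    have hs : ContDiff ℝ ((⊤ : ℕ∞) : WithTop ℕ∞) fun p : Chart =>
        c i * (p 1 ^ (i : ℕ) * p 2 ^ (m - (i : ℕ))) := by fun_prop
    refine (integrable_surface (IsTest.mul_left hs (isTest_coe g)) z₀).congr
      (Filter.Eventually.of_forall fun v => ?_)
    ring
  rw [surfaceDist_apply z₀ hcont, coeffDist_apply]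
  have e : (∑ i, c i • monomialDist z₀ i (m - (i : ℕ))) g
      = ∑ i, c i * monomialDist z₀ i (m - (i : ℕ)) g := by
    rw [sum_apply]
    rfl
  rw [e]
  simp only [monomialDist, surfaceDist_apply z₀ (continuous_monomial _ _), ← integral_const_mul]
  rw [← integral_finsetSum _ fun i _ => hint i]
  congr 1
  funext v
  rw [Finset.mul_sum]
  refine Finset.sum_congr rfl fun i _ => ?_
  ring

lemma isPrimary_coeffDist (z₀ : ℂ) (m : ℕ) (c : Fin (m + 1) → ℂ) :
    IsPrimary z₀ m (coeffDist z₀ m c) := by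
  have hz : IsPrimary z₀ m 0 := by
    refine ⟨⟨Submodule.zero_mem _, map_zero _, map_zero _⟩, map_zero _, map_zero _, ?_⟩
    rw [map_zero, dist_smul_zero]
  rw [coeffDist_apply]
  refine Finset.sum_induction _ (IsPrimary z₀ m) (fun _ _ h h' => h.add h') hz fun i _ => ?_
  have h := isPrimary_monomialDist z₀ i (m - (i : ℕ))
  rw [Nat.add_sub_cancel' (Nat.lt_succ_iff.1 i.2)] at h
  exact h.smul (c i)

lemma IsPrimary.exists_coeffDist {z₀ : ℂ} {m : ℕ} {D : Dist} (hD : IsPrimary z₀ m D) :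
    ∃ c, coeffDist z₀ m c = D := by
  have hle : polynomialDists z₀ m ≤ LinearMap.range (coeffDist z₀ m) := by
    refine Submodule.span_le.2 ?_
    rintro _ ⟨i, j, rfl, rfl⟩
    refine ⟨Pi.single ⟨i, by omega⟩ 1, ?_⟩
    rw [coeffDist_apply, Finset.sum_eq_single (⟨i, by omega⟩ : Fin (i + j + 1))]
    · rw [Pi.single_eq_same, one_smul, Nat.add_sub_cancel_left]
    · intro k _ hk
      rw [Pi.single_eq_of_ne hk, dist_zero_smul]
    · simp
  exact hle hD.mem_polynomialDists

/-! ### Linear independence of the monomial densities -/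

lemma del_one_monomialDist (z₀ : ℂ) (i j : ℕ) :
    del 1 (monomialDist z₀ i j) = (i : ℂ) • monomialDist z₀ (i - 1) j := by
  induction i with
  | zero =>
    have h : del 1 (monomialDist z₀ 0 j) = 0 := by
      induction j with
      | zero => rw [monomialDist_zero, del_surfaceDelta z₀ (by decide)]
      | succ j ih =>
        rw [← mulCoord_two_monomialDist, del_mulCoord _ (by decide), ih, map_zero]
    rw [h, Nat.cast_zero, dist_zero_smul]
  | succ i ih =>
    rw [← mulCoord_one_monomialDist, del_mulCoord_self, ih, map_smul, mulCoord_one_monomialDist,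
      Nat.add_sub_cancel]
    rcases i with _ | i
    · rw [Nat.cast_zero, dist_zero_smul]
      simp
    · rw [Nat.add_sub_cancel]
      push_cast
      module

lemma del_two_monomialDist (z₀ : ℂ) (i j : ℕ) :
    del 2 (monomialDist z₀ i j) = (j : ℂ) • monomialDist z₀ i (j - 1) := by
  induction j with
  | zero =>
    have h : del 2 (monomialDist z₀ i 0) = 0 := by
      induction i with
      | zero => rw [monomialDist_zero, del_surfaceDelta z₀ (by decide)]
      | succ j ih =>
        rw [← mulCoord_one_monomialDist, del_mulCoord _ (by decide), ih, map_zero]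
    rw [h, Nat.cast_zero, dist_zero_smul]
  | succ j ih =>
    rw [← mulCoord_two_monomialDist, del_mulCoord_self, ih, map_smul, mulCoord_two_monomialDist,
      Nat.add_sub_cancel]
    rcases j with _ | j
    · rw [Nat.cast_zero, dist_zero_smul]
      simp
    · rw [Nat.add_sub_cancel]
      push_cast
      module

lemma del_one_pow_monomialDist (z₀ : ℂ) (a i j : ℕ) :
    ((del 1 : Module.End ℂ Dist) ^ a) (monomialDist z₀ i j)
      = (i.descFactorial a : ℂ) • monomialDist z₀ (i - a) j := by
  induction a with
  | zero => simp
  | succ a ih =>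
    rw [pow_succ', Module.End.mul_apply, ih, map_smul, del_one_monomialDist, Nat.descFactorial_succ,
      Nat.sub_sub]
    push_cast
    module

lemma del_two_pow_monomialDist (z₀ : ℂ) (a i j : ℕ) :
    ((del 2 : Module.End ℂ Dist) ^ a) (monomialDist z₀ i j)
      = (j.descFactorial a : ℂ) • monomialDist z₀ i (j - a) := by
  induction a with
  | zero => simp
  | succ a ih =>
    rw [pow_succ', Module.End.mul_apply, ih, map_smul, del_two_monomialDist, Nat.descFactorial_succ,
      Nat.sub_sub]
    push_cast
    module

/-- Applying `∂₁ ^ j ∂₂ ^ (m-j)` kills every monomial of degree `m` except the `j`th, which becomes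
a non-zero multiple of the surface delta. -/
lemma coeffDist_injective (z₀ : ℂ) (m : ℕ) : Function.Injective (coeffDist z₀ m) := by
  rw [← LinearMap.ker_eq_bot, LinearMap.ker_eq_bot']
  intro c hc
  funext j
  have hj := Nat.lt_succ_iff.1 j.2
  have h := congrArg (fun T => ((del 1 : Module.End ℂ Dist) ^ (j : ℕ))
    (((del 2 : Module.End ℂ Dist) ^ (m - (j : ℕ))) T)) hc
  simp only [coeffDist_apply, map_sum, map_smul, map_zero, del_two_pow_monomialDist,
    del_one_pow_monomialDist] at h
  rw [Finset.sum_eq_single j] at h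
  · rw [Nat.sub_self, Nat.sub_self, monomialDist_zero, Nat.descFactorial_self,
      Nat.descFactorial_self] at h
    have h1 := congrArg (fun T : Dist => T (toTest (productBump z₀))) h
    simp only [smul_apply, smul_eq_mul, zero_apply, mul_eq_zero, Nat.cast_eq_zero,
      Nat.factorial_ne_zero, surfaceDelta_productBump_ne_zero z₀, or_false] at h1
    exact h1
  · intro i _ hij
    have hne : (i : ℕ) ≠ j := fun e => hij (Fin.ext e)
    rcases lt_or_gt_of_ne hne with hlt | hgt
    · rw [Nat.descFactorial_of_lt hlt, Nat.cast_zero, dist_zero_smul, dist_smul_zero,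
        dist_smul_zero]
    · have : m - (i : ℕ) < m - (j : ℕ) := by have := i.2; omega
      rw [Nat.descFactorial_of_lt this, Nat.cast_zero, dist_zero_smul, dist_smul_zero]
  · simp

/-- Every value of `(v₁, v₂)` is attained at some point of `ℝ⁴`; the values `(1, t)` reduce the
claim to one variable. -/
lemma coeffFun_injective (z₀ : ℂ) (m : ℕ) : Function.Injective (coeffFun z₀ m) := by
  rw [← LinearMap.ker_eq_bot, LinearMap.ker_eq_bot']
  intro c hc
  refine eq_zero_of_forall_sum_pow fun t => ?_
  obtain ⟨v, hv⟩ := evalLine_surjective z₀ (1, t)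
  rw [evalLine_eq, Prod.mk.injEq] at hv
  have h := congrFun hc (fromComplex v)
  rw [coeffFun_apply, hv.1, hv.2] at h
  simpa using h

lemma wavefunction_eq_coeffFun (z₀ l : ℂ) (m : ℕ) :
    wavefunction (-(m : ℤ)) z₀ l = coeffFun z₀ m (binomialCoeffs m l) := by
  funext x
  rw [wavefunction_neg_natCast, coeffFun_apply, sum_binomialCoeffs]
  rfl

lemma range_coeffFun (z₀ : ℂ) (m : ℕ) :
    LinearMap.range (coeffFun z₀ m) = spacetimePrimaries (-(m : ℤ)) z₀ := by
  apply le_antisymm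
  · rw [LinearMap.range_eq_map, ← span_binomialCoeffs, Submodule.map_span, Submodule.span_le]
    rintro _ ⟨_, ⟨l, rfl⟩, rfl⟩
    refine Submodule.subset_span ⟨l, isConformalPrimary_iff_exists_smul.2 ⟨1, ?_⟩⟩
    rw [one_smul, wavefunction_eq_coeffFun]
  · refine Submodule.span_le.2 ?_
    rintro φ ⟨l, hφ⟩
    obtain ⟨c, rfl⟩ := isConformalPrimary_iff_exists_smul.1 hφ
    exact ⟨c • binomialCoeffs m l, by rw [map_smul, wavefunction_eq_coeffFun]⟩

/-- The coordinates on the space of primary states on space-time. -/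
def spacetimeEquiv (z₀ : ℂ) (m : ℕ) :
    (Fin (m + 1) → ℂ) ≃ₗ[ℂ] spacetimePrimaries (-(m : ℤ)) z₀ :=
  (LinearEquiv.ofInjective (coeffFun z₀ m) (coeffFun_injective z₀ m)).trans
    (LinearEquiv.ofEq _ _ (range_coeffFun z₀ m))

lemma spacetimeEquiv_apply (z₀ : ℂ) (m : ℕ) (c : Fin (m + 1) → ℂ) :
    (spacetimeEquiv z₀ m c : Spacetime → ℂ) = coeffFun z₀ m c := rfl

/-! ### Primary states on twistor space -/

lemma IsPrimary.virasoroDist_zero {z₀ : ℂ} {m : ℂ} {D : Dist} (hD : IsPrimary z₀ m D) :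
    virasoroDist z₀ 0 D = (-m / 2) • D := by
  have h := del_mulNormal_self z₀ D
  rw [hD.mulNormal_eq, map_zero] at h
  have h' : mulNormal z₀ (Twistor.del 0 D) = -D := eq_neg_of_add_eq_zero_left h.symm
  rw [virasoroDist_apply, hD.fibreEuler_eq]
  simp only [zero_add, pow_one, pow_zero, Module.End.one_apply, Nat.cast_zero, h']
  module

lemma IsPrimary.virasoroDist_pos {z₀ : ℂ} {m : ℂ} {D : Dist} (hD : IsPrimary z₀ m D) {k : ℕ}
    (hk : 0 < k) : virasoroDist z₀ k D = 0 := by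
  obtain ⟨k, rfl⟩ := Nat.exists_eq_succ_of_ne_zero hk.ne'
  have h := del_mulNormal_self z₀ D
  rw [hD.mulNormal_eq, map_zero] at h
  have h' : mulNormal z₀ (Twistor.del 0 D) = -D := eq_neg_of_add_eq_zero_left h.symm
  rw [virasoroDist_apply, hD.fibreEuler_eq]
  simp only [Nat.succ_eq_add_one, pow_succ, Module.End.mul_apply, h', map_neg, map_smul,
    hD.mulNormal_eq, map_zero, dist_smul_zero]
  simp

lemma mem_primaryFields {h z₀ : ℂ} {A : Current} : A ∈ primaryFields h z₀ ↔
    A ∈ localizedFields z₀ ∧ (∀ k, 0 < k → virasoro z₀ k A ∈ gaugeTrivial z₀) ∧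
      virasoro z₀ 0 A - h • A ∈ gaugeTrivial z₀ := by
  simp only [primaryFields, Submodule.mem_inf, Submodule.mem_iInf, Submodule.mem_comap, and_assoc]
  rfl

lemma IsPrimary.single_mem {z₀ : ℂ} {m : ℂ} {D : Dist} (hD : IsPrimary z₀ m D) {h : ℂ}
    (hh : h = -m / 2) : Pi.single 0 D ∈ primaryFields h z₀ := by
  have hbar : ∀ a, a ≠ 0 → delBar a D = 0 := by
    intro a ha
    fin_cases a
    exacts [absurd rfl ha, hD.delBar₁, hD.delBar₂]
  refine mem_primaryFields.2 ⟨⟨fun a b => ?_, fun a => ?_⟩, fun k hk => ?_, ?_⟩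
  · by_cases ha : a = 0 <;> by_cases hb : b = 0
    · rw [ha, hb]
    · rw [ha, Pi.single_eq_same, Pi.single_eq_of_ne hb, map_zero, hbar b hb]
    · rw [hb, Pi.single_eq_same, Pi.single_eq_of_ne ha, map_zero, hbar a ha]
    · rw [Pi.single_eq_of_ne hb, Pi.single_eq_of_ne ha, map_zero, map_zero]
  · by_cases ha : a = 0
    · rw [ha, Pi.single_eq_same]
      exact hD.mem
    · rw [Pi.single_eq_of_ne ha]
      exact Submodule.zero_mem _
  · rw [virasoro_single, hD.virasoroDist_pos hk, Pi.single_zero]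
    exact Submodule.zero_mem _
  · rw [virasoro_single, hD.virasoroDist_zero, hh, ← Pi.single_smul, sub_self]
    exact Submodule.zero_mem _

/-- Gauge fix, then note that `L_k` preserves both the gauge condition and gauge triviality. The
conditions for `k = 0, 1` become equations for the normal form and already determine its shape. -/
lemma exists_isPrimary {z₀ h : ℂ} {m : ℕ} (hh : h = -(m : ℂ) / 2) {A : Current}
    (hA : A ∈ primaryFields h z₀) :
    ∃ χ ∈ supportedOn z₀, ∃ D, IsPrimary z₀ m D ∧ A = Pi.single 0 D + dbar χ := by
  obtain ⟨hloc, hpos, hzero⟩ := mem_primaryFields.1 hA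
  obtain ⟨χ, hχ, B, hB, rfl⟩ := exists_normalForm hloc
  have hmem : ∀ k, virasoro z₀ k (dbar χ) ∈ gaugeTrivial z₀ := fun k => by
    rw [virasoro_dbar]
    exact Submodule.mem_map_of_mem (dbar_virasoroDist_mem k hχ)
  have h1 : virasoroDist z₀ 1 B = 0 := by
    refine IsNormalForm.eq_zero_of_mem_gaugeTrivial (z₀ := z₀) ?_ ?_
    · rw [mulNormalBar_virasoroDist, hB.mulNormalBar_eq, map_zero]
    · have h := hpos 1 one_pos
      rw [map_add, Submodule.add_mem_iff_left _ (hmem 1), virasoro_single] at h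
      exact h
  have h0 : virasoroDist z₀ 0 B = (-(m : ℂ) / 2) • B := by
    rw [← sub_eq_zero]
    refine IsNormalForm.eq_zero_of_mem_gaugeTrivial (z₀ := z₀) ?_ ?_
    · rw [map_sub, map_smul, mulNormalBar_virasoroDist, hB.mulNormalBar_eq, map_zero,
        dist_smul_zero, sub_zero]
    · have e : virasoro z₀ 0 (Pi.single 0 B + dbar χ) - h • (Pi.single 0 B + dbar χ)
          = Pi.single 0 (virasoroDist z₀ 0 B - h • B)
            + (virasoro z₀ 0 (dbar χ) - h • dbar χ) := by
        have es : (Pi.single 0 (h • B) : Current) = h • Pi.single 0 B :=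
          (LinearMap.single ℂ (fun _ => Dist) 0).map_smul h B
        rw [map_add, virasoro_single, Pi.single_sub, es]
        module
      rw [e, Submodule.add_mem_iff_left _ (Submodule.sub_mem _ (hmem 0)
        (Submodule.smul_mem _ _ (Submodule.mem_map_of_mem hχ)))] at hzero
      rw [← hh]
      exact hzero
  obtain ⟨hW, hE⟩ := hB.primary h1 h0
  exact ⟨χ, hχ, B, ⟨⟨hB.mem, hW, hB.mulNormalBar_eq⟩, hB.delBar₁, hB.delBar₂, hE⟩, rfl⟩

/-- The field on twistor space with given coefficients of its polynomial density. -/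
def coeffField (z₀ : ℂ) (m : ℕ) : (Fin (m + 1) → ℂ) →ₗ[ℂ] Current :=
  LinearMap.single ℂ (fun _ : Fin 3 => Dist) 0 ∘ₗ ((Complex.I / 2) • coeffDist z₀ m)

lemma coeffField_apply (z₀ : ℂ) (m : ℕ) (c : Fin (m + 1) → ℂ) :
    coeffField z₀ m c = Pi.single 0 ((Complex.I / 2) • coeffDist z₀ m c) := rfl

lemma coeffField_mem (z₀ : ℂ) (m : ℕ) (c : Fin (m + 1) → ℂ) :
    coeffField z₀ m c ∈ primaryFields (((-(m : ℤ) : ℤ) : ℂ) / 2) z₀ :=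
  ((isPrimary_coeffDist z₀ m c).smul _).single_mem (by push_cast; rfl)

lemma exists_coeffField {z₀ : ℂ} {m : ℕ} {A : Current}
    (hA : A ∈ primaryFields (((-(m : ℤ) : ℤ) : ℂ) / 2) z₀) :
    ∃ χ ∈ supportedOn z₀, ∃ c, A = coeffField z₀ m c + dbar χ := by
  obtain ⟨χ, hχ, D, hD, rfl⟩ := exists_isPrimary (by push_cast; rfl) hA
  -- The factor `-2i` undoes the normalization `i/2` of the delta form built into `coeffField`.
  obtain ⟨c, hc⟩ := (hD.smul (-2 * Complex.I)).exists_coeffDist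
  refine ⟨χ, hχ, c, ?_⟩
  rw [coeffField_apply, hc, smul_smul]
  have : Complex.I / 2 * (-2 * Complex.I) = 1 := by linear_combination -Complex.I_sq
  rw [this, one_smul]

/-- The gauge class with given coefficients. -/
def coeffClass (z₀ : ℂ) (m : ℕ) :
    (Fin (m + 1) → ℂ) →ₗ[ℂ] twistorPrimaries (((-(m : ℤ) : ℤ) : ℂ) / 2) z₀ :=
  LinearMap.codRestrict _ ((gaugeTrivial z₀).mkQ ∘ₗ coeffField z₀ m) fun c =>
    Submodule.mem_map_of_mem (coeffField_mem z₀ m c)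

lemma coeffClass_injective (z₀ : ℂ) (m : ℕ) : Function.Injective (coeffClass z₀ m) := by
  rw [← LinearMap.ker_eq_bot, LinearMap.ker_eq_bot']
  intro c hc
  have h1 : (gaugeTrivial z₀).mkQ (coeffField z₀ m c) = 0 := congrArg Subtype.val hc
  rw [Submodule.mkQ_apply, Submodule.Quotient.mk_eq_zero, coeffField_apply] at h1
  have hP := (isPrimary_coeffDist z₀ m c).smul (Complex.I / 2)
  have h2 := IsNormalForm.eq_zero_of_mem_gaugeTrivial hP.mulNormalBar_eq h1
  have h3 : (Complex.I / 2) ≠ 0 := div_ne_zero Complex.I_ne_zero two_ne_zero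
  rw [← map_smul] at h2
  have h4 := coeffDist_injective z₀ m (h2.trans (map_zero _).symm)
  exact (smul_eq_zero.1 h4).resolve_left h3

lemma gaugeClass_eq_coeffClass {z₀ : ℂ} {m : ℕ}
    (A : primaryFields (((-(m : ℤ) : ℤ) : ℂ) / 2) z₀) {χ : Dist} (hχ : χ ∈ supportedOn z₀)
    {c : Fin (m + 1) → ℂ} (h : (A : Current) = coeffField z₀ m c + dbar χ) :
    gaugeClass A = coeffClass z₀ m c := by
  refine Subtype.ext ?_
  change (gaugeTrivial z₀).mkQ (A : Current) = (gaugeTrivial z₀).mkQ (coeffField z₀ m c)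
  rw [h, map_add, add_eq_left, Submodule.mkQ_apply, Submodule.Quotient.mk_eq_zero]
  exact Submodule.mem_map_of_mem hχ

lemma coeffClass_surjective (z₀ : ℂ) (m : ℕ) : Function.Surjective (coeffClass z₀ m) := by
  rintro ⟨_, A, hA, rfl⟩
  obtain ⟨χ, hχ, c, h⟩ := exists_coeffField hA
  exact ⟨c, (gaugeClass_eq_coeffClass ⟨A, hA⟩ hχ h).symm⟩

/-- The coordinates on the space of primary states on twistor space. -/
def twistorEquiv (z₀ : ℂ) (m : ℕ) :
    (Fin (m + 1) → ℂ) ≃ₗ[ℂ] twistorPrimaries (((-(m : ℤ) : ℤ) : ℂ) / 2) z₀ :=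
  LinearEquiv.ofBijective (coeffClass z₀ m) ⟨coeffClass_injective z₀ m, coeffClass_surjective z₀ m⟩

/-- Integration over the twistor lines, in coordinates. -/
def lineTransform (z₀ : ℂ) (m : ℕ) :
    twistorPrimaries (((-(m : ℤ) : ℤ) : ℂ) / 2) z₀ ≃ₗ[ℂ] spacetimePrimaries (-(m : ℤ)) z₀ :=
  (twistorEquiv z₀ m).symm.trans (spacetimeEquiv z₀ m)

lemma lineTransform_gaugeClass {z₀ : ℂ} {m : ℕ}
    (A : primaryFields (((-(m : ℤ) : ℤ) : ℂ) / 2) z₀) {χ : Dist} (hχ : χ ∈ supportedOn z₀)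
    {c : Fin (m + 1) → ℂ} (h : (A : Current) = coeffField z₀ m c + dbar χ) :
    (lineTransform z₀ m (gaugeClass A) : Spacetime → ℂ) = coeffFun z₀ m c := by
  have e : gaugeClass A = twistorEquiv z₀ m c := gaugeClass_eq_coeffClass A hχ h
  rw [e, lineTransform, LinearEquiv.trans_apply, LinearEquiv.symm_apply_apply, spacetimeEquiv_apply]

/-- The gauge term drops out and only the `dz̄` component remains, for which only the values of `Φ
0` on the surface matter. The constants cancel through `-2i · i/2 = 1`. -/
lemma isFibreIntegral_coeffField (z₀ : ℂ) (m : ℕ) (c : Fin (m + 1) → ℂ) {χ : Dist}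
    (hχ : χ ∈ supportedOn z₀) :
    IsFibreIntegral z₀ (coeffField z₀ m c + dbar χ) (coeffFun z₀ m c) := by
  intro ψ Φ hΦ
  have hψ : Differentiable ℝ ψ := ψ.contDiff.differentiable (by simp)
  have hgauge := sum_dbar_apply_eq_zero hχ hψ Φ hΦ
  have hsum : ∑ a, (coeffField z₀ m c + dbar χ) a (Φ a)
      = Complex.I / 2 * coeffDist z₀ m c (Φ 0) := by
    have e : ∀ a, (coeffField z₀ m c + dbar χ) a (Φ a)
        = coeffField z₀ m c a (Φ a) + dbar χ a (Φ a) := fun a => rfl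
    simp only [e, Finset.sum_add_distrib, hgauge, add_zero]
    rw [Finset.sum_eq_single 0]
    · rw [coeffField_apply, Pi.single_eq_same]
      rfl
    · intro a _ ha
      rw [coeffField_apply, Pi.single_eq_of_ne ha]
      rfl
    · simp
  have hcont : Continuous fun p : Chart => ∑ i, c i * (p 1 ^ (i : ℕ) * p 2 ^ (m - (i : ℕ))) :=
    continuous_finsetSum _ fun i _ => continuous_const.mul (continuous_monomial _ _)
  have hΦ0 : ∀ v, Φ 0 (surfaceEmb z₀ v) = lineDensity ψ 0 (surfaceEmb z₀ v) := fun v =>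
    (hΦ 0).self_of_nhdsSet _ rfl
  rw [hsum, coeffDist_eq_surfaceDist, surfaceDist_apply z₀ hcont]
  simp only [hΦ0]
  rw [integral_lineDensity z₀ (fun p => ∑ i, c i * (p 1 ^ (i : ℕ) * p 2 ^ (m - (i : ℕ)))) ψ]
  have e : ∀ x, coeffFun z₀ m c x = ∑ i, c i * (![z₀, v₁ z₀ x, v₂ z₀ x] 1 ^ (i : ℕ)
      * ![z₀, v₁ z₀ x, v₂ z₀ x] 2 ^ (m - (i : ℕ))) := coeffFun_apply z₀ m c
  simp only [e]
  rw [← mul_assoc]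
  have : -2 * Complex.I * (Complex.I / 2) = 1 := by linear_combination -Complex.I_sq
  rw [this, one_mul]

lemma twistorRep_eq_coeffField (z₀ l : ℂ) (m : ℕ) :
    twistorRep (-(m : ℤ)) z₀ l = coeffField z₀ m (binomialCoeffs m l) := by
  rw [coeffField_apply, coeffDist_eq_surfaceDist]
  simp only [sum_binomialCoeffs]
  rw [twistorRep, deltaField, surfaceDist]
  simp only [neg_neg, zpow_natCast]

end Twistor

end

/-! ### The correspondence of primary states -/

theorem mainTheorem9 (n : ℤ) (hn : n ≤ 0) (z₀ : ℂ) :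
    -- the conformal primaries at `(z₀, l)` are the multiples of the standard wavefunction
    (∀ (l : ℂ) (φ : Twistor.Spacetime → ℂ), Twistor.IsConformalPrimary n z₀ l φ ↔
      ∃ c : ℂ, φ = c • Twistor.wavefunction n z₀ l) ∧
    -- integration over the twistor lines is a bijection of the spaces of primary states
    ∃ F : Twistor.twistorPrimaries ((n : ℂ) / 2) z₀ ≃ₗ[ℂ] Twistor.spacetimePrimaries n z₀,
      (∀ A : Twistor.primaryFields ((n : ℂ) / 2) z₀,
        Twistor.IsFibreIntegral z₀ A (F (Twistor.gaugeClass A))) ∧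
      -- it sends the twistor representatives to the standard wavefunctions
      ∀ l : ℂ, ∃ h : Twistor.twistorRep n z₀ l ∈ Twistor.primaryFields ((n : ℂ) / 2) z₀,
        (F (Twistor.gaugeClass ⟨Twistor.twistorRep n z₀ l, h⟩) : Twistor.Spacetime → ℂ)
          = Twistor.wavefunction n z₀ l := by
  obtain ⟨m, rfl⟩ : ∃ m : ℕ, n = -(m : ℤ) := ⟨n.natAbs, by omega⟩
  refine ⟨fun l φ => Twistor.isConformalPrimary_iff_exists_smul, Twistor.lineTransform z₀ m,
    fun A => ?_, fun l => ?_⟩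
  · obtain ⟨χ, hχ, c, h⟩ := Twistor.exists_coeffField A.2
    rw [Twistor.lineTransform_gaugeClass A hχ h, h]
    exact Twistor.isFibreIntegral_coeffField z₀ m c hχ
  · have e := Twistor.twistorRep_eq_coeffField z₀ l m
    refine ⟨e ▸ Twistor.coeffField_mem z₀ m _, ?_⟩
    -- The representative is already a coefficient field, so the gauge parameter is `χ = 0`.
    rw [Twistor.lineTransform_gaugeClass _ (Submodule.zero_mem (Twistor.supportedOn z₀))
      (c := Twistor.binomialCoeffs m l) (by rw [map_zero, add_zero]; exact e),
      Twistor.wavefunction_eq_coeffFun]
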